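/- Let $\nu\ge 1$ be an integer, let $0<\eta<1/2$, and let $\hat q,\hat r:[0,2\pi)^\nu\to[\eta,1-\eta]$ be measurable. Let $F:\ell^2(\mathbb Z^\nu)\to L^2([0,2\pi)^\nu,(2\pi)^{-\nu}dx)$ be the Fourier transformation, $F\mathbf 1_{\mathbf k}=e^{i\langle \mathbf k,\cdot\rangle}$, and let $Q=F^{-1}M_{\hat q}F$, $R=F^{-1}M_{\hat r}F$, where $M_{\hat a}$ is multiplication by $\hat a$. Let $\omega_Q$ be the (shift-invariant) quasi-free state with symbol $Q$ on the CAR algebra over $\ell^2(\mathbb Z^\nu)$, i.e. the state with $$\omega_Q\big(c(x_1)^*\cdots c(x_m)^*c(y_n)\cdots c(y_1)\big)=\delta_{m,n}\det\{\langle y_i,Qx_j\rangle\}_{i,j},$$ and let $\omega_R$ be the quasi-free state with symbol $R$. For $n\in\mathbb N$ let $\mathcal H_n=\mathrm{span}\{\mathbf 1_{\mathbf k}: 0\le k_1,\dots,k_\nu\le n-1\}$, and let $\hat\rho_n,\hat\sigma_n$ be the density operators, on the antisymmetric Fock space $\mathcal F(\mathcal H_n)$, of the restrictions of $\omega_Q,\omega_R$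 to $\mathrm{CAR}(\mathcal H_n)=\mathcal B(\mathcal F(\mathcal H_n))$. Put $\psi_n(t)=\log\operatorname{Tr}\hat\rho_n^t\hat\sigma_n^{1-t}$ and $$\psi(t)=\frac1{(2\pi)^\nu}\int_{[0,2\pi)^\nu}\log\big[\hat q(x)^t\hat r(x)^{1-t}+(1-\hat q(x))^t(1-\hat r(x))^{1-t}\big]\,dx,\qquad t\in\mathbb R.$$ Then the following limits (the mean Chernoff bound, the mean Hoeffding bounds, and the mean relative entropy) exist as real numbers: $$C=\lim_n\frac1{n^\nu}\Big(-\min_{0\le t\le1}\psi_n(t)\Big),\quad H_s=\lim_n\frac1{n^\nu}\sup_{0\le t<1}\frac{-t\,n^\nu s-\psi_n(t)}{1-t}\ \ (s\ge0),\quad S=\lim_n\frac1{n^\nu}\operatorname{Tr}\hat\rho_n(\log\hat\rho_n-\log\hat\sigma_n),$$ and $$C=-\min_{0\le t\le1}\psi(t),\qquad H_s=\max_{0\le t<1}\frac{-ts-\psi(t)}{1-t}\ \ (s>0),\qquad S=H_0=\partial^-\psi(1)=\sup_{0\le t<1}\frac{-\psi(t)}{1-t},$$ where $\partial^-\psi(1)$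 is the left derivative of $\psi$ at $1$. Moreover, for sequences of tests $T_n\in\mathcal B(\mathcal F(\mathcal H_n))$, $0\le T_n\le I$, with error probabilities $\alpha_n(T_n)=\operatorname{Tr}\hat\rho_n(I-T_n)$ and $\beta_n(T_n)=\operatorname{Tr}\hat\sigma_nT_n$ (and $\log0=-\infty$): 1. $\sup_{\{T_n\}}\lim_n-\frac1{n^\nu}\log(\alpha_n(T_n)+\beta_n(T_n))=C$; 2. for every $s\ge0$, $\sup\{\lim_n-\frac1{n^\nu}\log\beta_n(T_n) : \limsup_n\frac1{n^\nu}\log\alpha_n(T_n)<-s\}=H_s$; 3. $\sup\{\lim_n-\frac1{n^\nu}\log\beta_n(T_n) : \lim_n\alpha_n(T_n)=0\}=S$; where in each case the supremum is over the sequences $\{T_n\}$ satisfying the constraint for which the limit exists; and in each of 1, 2, 3 the same equality holds when this limit is replaced by $\liminf_n$ or by $\limsup_n$ and the supremum is taken over all sequences satisfying the constraint. -/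

import Mathlib

open MeasureTheory Filter Topology
open scoped ENNReal ComplexConjugate ComplexOrder InnerProductSpace

noncomputable section

namespace CARLattice

section Fock

variable {κ : Type*} [LinearOrder κ]

/-- The one-particle Hilbert space `ℓ²(κ)`; the inner product is linear in the second variable. -/
abbrev OneParticle (κ : Type*) : Type _ := lp (fun _ : κ => ℂ) 2

/-- The antisymmetric Fock space over `ℓ²(κ)` in the occupation number representation: the
basis vector at `S = {k₁ < ⋯ < k_m}` is the unit vector `1_{k₁} ∧ ⋯ ∧ 1_{k_m}` of the `m`-particle
space, and the one at `∅` is the vacuum. -/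
abbrev FockSpace (κ : Type*) : Type _ := lp (fun _ : Finset κ => ℂ) 2

/-- The sign in `1_k ∧ (wedge of S) = wedgeSign k S • (wedge of insert k S)` for `k ∉ S`.
It only depends on `S \ {k}`. -/
def wedgeSign (k : κ) (S : Finset κ) : ℂ := (-1) ^ (S.filter (fun j => j < k)).card

/-- The wedge product `x ∧ f` in the occupation number representation. -/
def wedgeFun (x : κ → ℂ) (f : Finset κ → ℂ) (S : Finset κ) : ℂ :=
  ∑ k ∈ S, x k * wedgeSign k S * f (S.erase k)

/-- The adjoint of `wedgeFun` when only the modes in the finite set `u` are present. It serves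
in the proof that creation operators are bounded. -/
def contractFun (u : Finset κ) (x : κ → ℂ) (f : Finset κ → ℂ) (S : Finset κ) : ℂ :=
  ∑ k ∈ u \ S, conj (x k) * wedgeSign k S * f (insert k S)

theorem wedgeSign_conj (k : κ) (S : Finset κ) : conj (wedgeSign k S) = wedgeSign k S := by
  simp [wedgeSign]

theorem wedgeSign_mul_self (k : κ) (S : Finset κ) : wedgeSign k S * wedgeSign k S = 1 := by
  rw [wedgeSign, ← mul_pow]; simp

theorem wedgeSign_erase_self (k : κ) (S : Finset κ) :
    wedgeSign k (S.erase k) = wedgeSign k S := by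
  have : (S.erase k).filter (fun j => j < k) = S.filter (fun j => j < k) := by
    ext a; simp only [Finset.mem_filter, Finset.mem_erase]
    exact ⟨fun h => ⟨h.1.2, h.2⟩, fun h => ⟨⟨h.2.ne, h.1⟩, h.2⟩⟩
  rw [wedgeSign, wedgeSign, this]

theorem wedgeSign_insert_self (k : κ) (S : Finset κ) :
    wedgeSign k (insert k S) = wedgeSign k S := by
  rw [← wedgeSign_erase_self k (insert k S), ← wedgeSign_erase_self k S, Finset.erase_insert_eq_erase]

theorem wedgeSign_insert_of_lt {k j : κ} {S : Finset κ} (hk : k ∉ S) (h : k < j) :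
    wedgeSign j (insert k S) = - wedgeSign j S := by
  rw [wedgeSign, wedgeSign, Finset.filter_insert, if_pos h, Finset.card_insert_of_notMem (by simp [hk]),
    pow_succ]
  ring

theorem wedgeSign_insert_of_gt {k j : κ} {S : Finset κ} (h : j < k) :
    wedgeSign j (insert k S) = wedgeSign j S := by
  rw [wedgeSign, wedgeSign, Finset.filter_insert, if_neg h.not_gt]

theorem wedgeSign_anticomm {j k : κ} {S : Finset κ} (hj : j ∈ S) (hk : k ∉ S) :
    wedgeSign k S * wedgeSign j (insert k S) + wedgeSign j S * wedgeSign k (S.erase j) = 0 := by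
  have hne : j ≠ k := fun h => hk (h ▸ hj)
  have hS : S = insert j (S.erase j) := (Finset.insert_erase hj).symm
  rcases lt_or_gt_of_ne hne with h | h
  · rw [wedgeSign_insert_of_gt h]
    have : wedgeSign k S = - wedgeSign k (S.erase j) := by
      conv_lhs => rw [hS]
      exact wedgeSign_insert_of_lt (by simp) h
    rw [this]; ring
  · rw [wedgeSign_insert_of_lt hk h]
    have : wedgeSign k S = wedgeSign k (S.erase j) := by
      conv_lhs => rw [hS]
      exact wedgeSign_insert_of_gt h
    rw [this]; ring

theorem sum_conj_mul_wedgeFun (u : Finset κ) (x : κ → ℂ) (f g : Finset κ → ℂ) :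
    ∑ S ∈ u.powerset, conj (g S) * wedgeFun x f S =
      ∑ S ∈ u.powerset, conj (contractFun u x g S) * f S := by
  simp only [wedgeFun, contractFun, Finset.mul_sum, map_sum, Finset.sum_mul]
  rw [Finset.sum_sigma', Finset.sum_sigma']
  refine Finset.sum_bij' (fun p _ => ⟨p.1.erase p.2, p.2⟩) (fun p _ => ⟨insert p.2 p.1, p.2⟩)
    ?_ ?_ ?_ ?_ ?_
  · rintro ⟨S, k⟩ h
    simp only [Finset.mem_sigma, Finset.mem_powerset, Finset.mem_sdiff] at h ⊢
    exact ⟨(Finset.erase_subset _ _).trans h.1, h.1 h.2, by simp⟩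
  · rintro ⟨S, k⟩ h
    simp only [Finset.mem_sigma, Finset.mem_powerset, Finset.mem_sdiff] at h ⊢
    exact ⟨Finset.insert_subset h.2.1 h.1, by simp⟩
  · rintro ⟨S, k⟩ h
    simp only [Finset.mem_sigma] at h
    simp [Finset.insert_erase h.2]
  · rintro ⟨S, k⟩ h
    simp only [Finset.mem_sigma, Finset.mem_sdiff] at h
    simp [Finset.erase_insert h.2.2]
  · rintro ⟨S, k⟩ h
    simp only [Finset.mem_sigma] at h
    simp only [map_mul, wedgeSign_conj, Complex.conj_conj, Finset.insert_erase h.2,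
      wedgeSign_erase_self]
    ring

/-- The canonical anticommutation relation for `x` on the modes in `u`. -/
theorem contractFun_wedgeFun_add (u : Finset κ) (x : κ → ℂ) (f : Finset κ → ℂ) {S : Finset κ}
    (hS : S ⊆ u) :
    contractFun u x (wedgeFun x f) S + wedgeFun x (contractFun u x f) S =
      (∑ k ∈ u, ((‖x k‖ ^ 2 : ℝ) : ℂ)) * f S := by
  have hx : ∀ k, conj (x k) * x k = ((‖x k‖ ^ 2 : ℝ) : ℂ) := fun k => by
    rw [mul_comm, Complex.mul_conj, Complex.normSq_eq_norm_sq]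
  have h1 : contractFun u x (wedgeFun x f) S = (∑ k ∈ u \ S, ((‖x k‖ ^ 2 : ℝ) : ℂ)) * f S +
      ∑ k ∈ u \ S, ∑ j ∈ S, conj (x k) * x j *
        (wedgeSign k S * wedgeSign j (insert k S)) * f ((insert k S).erase j) := by
    rw [contractFun, Finset.sum_mul, ← Finset.sum_add_distrib]
    refine Finset.sum_congr rfl fun k hk => ?_
    have hk' : k ∉ S := (Finset.mem_sdiff.1 hk).2
    rw [wedgeFun, Finset.sum_insert hk', wedgeSign_insert_self, Finset.erase_insert hk', mul_add,
      Finset.mul_sum, ← hx k]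
    congr 1
    · linear_combination (conj (x k) * x k * f S) * wedgeSign_mul_self k S
    · exact Finset.sum_congr rfl fun j _ => by ring
  have h2 : wedgeFun x (contractFun u x f) S = (∑ k ∈ S, ((‖x k‖ ^ 2 : ℝ) : ℂ)) * f S +
      ∑ k ∈ u \ S, ∑ j ∈ S, conj (x k) * x j *
        (wedgeSign j S * wedgeSign k (S.erase j)) * f ((insert k S).erase j) := by
    rw [Finset.sum_comm, wedgeFun, Finset.sum_mul, ← Finset.sum_add_distrib]
    refine Finset.sum_congr rfl fun j hj => ?_
    have hsd : u \ S.erase j = insert j (u \ S) := by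
      rw [Finset.sdiff_erase (hS hj)]
    rw [contractFun, hsd, Finset.sum_insert (by simp [hj]), Finset.insert_erase hj, mul_add,
      Finset.mul_sum, ← hx j, wedgeSign_erase_self]
    congr 1
    · linear_combination (conj (x j) * x j * f S) * wedgeSign_mul_self j S
    · refine Finset.sum_congr rfl fun k hk => ?_
      have hk' : k ∉ S := (Finset.mem_sdiff.1 hk).2
      have hne : k ≠ j := fun h => hk' (h ▸ hj)
      rw [Finset.erase_insert_of_ne hne]
      ring
  have h3 : (∑ k ∈ u \ S, ∑ j ∈ S, conj (x k) * x j *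
        (wedgeSign k S * wedgeSign j (insert k S)) * f ((insert k S).erase j)) +
      ∑ k ∈ u \ S, ∑ j ∈ S, conj (x k) * x j *
        (wedgeSign j S * wedgeSign k (S.erase j)) * f ((insert k S).erase j) = 0 := by
    rw [← Finset.sum_add_distrib]
    refine Finset.sum_eq_zero fun k hk => ?_
    rw [← Finset.sum_add_distrib]
    refine Finset.sum_eq_zero fun j hj => ?_
    linear_combination (conj (x k) * x j * f ((insert k S).erase j)) *
      wedgeSign_anticomm hj (Finset.mem_sdiff.1 hk).2
  rw [h1, h2, ← Finset.sum_sdiff hS]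
  linear_combination h3

theorem sum_powerset_norm_wedgeFun_le (u : Finset κ) (x : κ → ℂ) (f : Finset κ → ℂ) :
    ∑ S ∈ u.powerset, ‖wedgeFun x f S‖ ^ 2 ≤
      (∑ k ∈ u, ‖x k‖ ^ 2) * ∑ S ∈ u.powerset, ‖f S‖ ^ 2 := by
  have hz : ∀ z : ℂ, ((‖z‖ ^ 2 : ℝ) : ℂ) = conj z * z := fun z => by
    rw [mul_comm, Complex.mul_conj, Complex.normSq_eq_norm_sq]
  have key : ((∑ S ∈ u.powerset, ‖wedgeFun x f S‖ ^ 2 +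
      ∑ S ∈ u.powerset, ‖contractFun u x f S‖ ^ 2 : ℝ) : ℂ) =
      (((∑ k ∈ u, ‖x k‖ ^ 2) * ∑ S ∈ u.powerset, ‖f S‖ ^ 2 : ℝ) : ℂ) := by
    have e1 : ((∑ S ∈ u.powerset, ‖wedgeFun x f S‖ ^ 2 : ℝ) : ℂ) =
        ∑ S ∈ u.powerset, conj (f S) * contractFun u x (wedgeFun x f) S := by
      rw [Complex.ofReal_sum]
      have := congrArg conj (sum_conj_mul_wedgeFun u x f (wedgeFun x f))
      simp only [map_sum, map_mul, Complex.conj_conj] at this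
      calc _ = ∑ S ∈ u.powerset, wedgeFun x f S * conj (wedgeFun x f S) :=
            Finset.sum_congr rfl fun S _ => by rw [hz, mul_comm]
        _ = _ := this
        _ = _ := Finset.sum_congr rfl fun S _ => mul_comm _ _
    have e2 : ((∑ S ∈ u.powerset, ‖contractFun u x f S‖ ^ 2 : ℝ) : ℂ) =
        ∑ S ∈ u.powerset, conj (f S) * wedgeFun x (contractFun u x f) S := by
      rw [Complex.ofReal_sum, sum_conj_mul_wedgeFun]
      exact Finset.sum_congr rfl fun S _ => hz _
    rw [Complex.ofReal_add, e1, e2, ← Finset.sum_add_distrib, Complex.ofReal_mul,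
      Complex.ofReal_sum, Complex.ofReal_sum, Finset.mul_sum]
    refine Finset.sum_congr rfl fun S hS => ?_
    rw [← mul_add, contractFun_wedgeFun_add u x f (Finset.mem_powerset.1 hS), hz (f S)]
    ring
  have key' := Complex.ofReal_injective key
  have : 0 ≤ ∑ S ∈ u.powerset, ‖contractFun u x f S‖ ^ 2 :=
    Finset.sum_nonneg fun _ _ => by positivity
  linarith

theorem sum_norm_wedgeFun_le (x : OneParticle κ) (f : FockSpace κ) (s : Finset (Finset κ)) :
    ∑ S ∈ s, ‖wedgeFun x f S‖ ^ (2 : ℝ≥0∞).toReal ≤ (‖x‖ * ‖f‖) ^ (2 : ℝ≥0∞).toReal := by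
  have h2 : 0 < (2 : ℝ≥0∞).toReal := by simp
  have hx := lp.sum_rpow_le_norm_rpow h2 x (s.sup id)
  have hf := lp.sum_rpow_le_norm_rpow h2 f (s.sup id).powerset
  simp only [ENNReal.toReal_ofNat, Real.rpow_ofNat] at hx hf ⊢
  have hs : s ⊆ (s.sup id).powerset := fun S hS => Finset.mem_powerset.2 (Finset.le_sup (f := id) hS)
  calc _ ≤ ∑ S ∈ (s.sup id).powerset, ‖wedgeFun x f S‖ ^ 2 :=
        Finset.sum_le_sum_of_subset_of_nonneg hs fun _ _ _ => by positivity
    _ ≤ _ := sum_powerset_norm_wedgeFun_le _ _ _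
    _ ≤ ‖x‖ ^ 2 * ‖f‖ ^ 2 := by gcongr
    _ = _ := by ring

/-- The creation operator `f ↦ x ∧ f`, with norm at most `‖x‖`. -/
def creation (x : OneParticle κ) : FockSpace κ →L[ℂ] FockSpace κ :=
  LinearMap.mkContinuous
    { toFun := fun f => ⟨fun S => wedgeFun x f S, memℓp_gen' (sum_norm_wedgeFun_le x f)⟩
      map_add' := fun f g => by
        ext S
        simp only [wedgeFun, lp.coeFn_add, Pi.add_apply, mul_add, Finset.sum_add_distrib]
      map_smul' := fun c f => by
        ext S
        simp [wedgeFun, Finset.mul_sum, mul_left_comm] }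
    ‖x‖ fun f => lp.norm_le_of_forall_sum_le (by simp) (by positivity) (sum_norm_wedgeFun_le x f)

/-- The annihilation operator, the adjoint of the creation operator. -/
def annihilation (x : OneParticle κ) : FockSpace κ →L[ℂ] FockSpace κ :=
  ContinuousLinearMap.adjoint (creation x)


/-- The C*-algebra of operators on Fock space generated by the annihilation operators of `x ∈ W`. -/
def carAlgebra (W : Set (OneParticle κ)) :
    StarSubalgebra ℂ (FockSpace κ →L[ℂ] FockSpace κ) :=
  (StarAlgebra.adjoin ℂ (annihilation '' W)).topologicalClosure

/-- A state: a positive normalized linear functional. -/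
structure AlgState {B : Type*} [Ring B] [StarRing B] [Algebra ℂ B] [StarModule ℂ B]
    (A : StarSubalgebra ℂ B) where
  toLin : A →ₗ[ℂ] ℂ
  map_one : toLin 1 = 1
  nonneg : ∀ a : A, 0 ≤ toLin (star a * a)

/-- The annihilation operator of `x` as an element of the CAR algebra over `ℓ²(κ)`. -/
def annih (x : OneParticle κ) : carAlgebra (Set.univ : Set (OneParticle κ)) :=
  ⟨annihilation x, StarSubalgebra.le_topologicalClosure _
    (StarAlgebra.subset_adjoin ℂ _ ⟨x, Set.mem_univ x, rfl⟩)⟩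

/-- The monomial `c(x₁)* ⋯ c(x_m)* c(y_n) ⋯ c(y₁)`. -/
def carMonomial {m n : ℕ} (x : Fin m → OneParticle κ) (y : Fin n → OneParticle κ) :
    carAlgebra (Set.univ : Set (OneParticle κ)) :=
  (List.ofFn fun i => star (annih (x i))).prod * (List.ofFn fun i => annih (y i)).reverse.prod

/-- The state `ω` is the quasi-free state with symbol `Q`. -/
def IsQuasiFree (ω : AlgState (carAlgebra (Set.univ : Set (OneParticle κ))))
    (Q : OneParticle κ →L[ℂ] OneParticle κ) : Prop :=
  (∀ (n : ℕ) (x y : Fin n → OneParticle κ),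
    ω.toLin (carMonomial x y) = (Matrix.of fun i j => ⟪y i, Q (x j)⟫_ℂ).det) ∧
  (∀ (m n : ℕ) (x : Fin m → OneParticle κ) (y : Fin n → OneParticle κ), m ≠ n →
    ω.toLin (carMonomial x y) = 0)

end Fock

section Lattice

/-- The lattice `ℤ^ν`. The lexicographic order only fixes the sign convention for the Fock basis. -/
abbrev Site (ν : ℕ) : Type := Lex (Fin ν → ℤ)

/-- The cube `[0, 2π)^ν`. -/
def brillouin (ν : ℕ) : Set (Fin ν → ℝ) := Set.univ.pi fun _ => Set.Ico 0 (2 * Real.pi)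

/-- Normalized Lebesgue measure on `[0, 2π)^ν`. -/
def momentumMeasure (ν : ℕ) : Measure (Fin ν → ℝ) :=
  ENNReal.ofReal (1 / (2 * Real.pi) ^ ν) • volume.restrict (brillouin ν)

/-- The function `x ↦ exp(i⟨k, x⟩)`. -/
def planeWave {ν : ℕ} (k : Site ν) (x : Fin ν → ℝ) : ℂ :=
  Complex.exp (Complex.I * ((∑ i, (ofLex k i : ℝ) * x i : ℝ) : ℂ))

theorem norm_planeWave {ν : ℕ} (k : Site ν) (x : Fin ν → ℝ) : ‖planeWave k x‖ = 1 := by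
  rw [planeWave, mul_comm, Complex.norm_exp_ofReal_mul_I]

theorem continuous_planeWave {ν : ℕ} (k : Site ν) : Continuous (planeWave k) := by
  unfold planeWave
  fun_prop

theorem volume_brillouin_lt_top (ν : ℕ) : volume (brillouin ν) < ∞ := by
  rw [brillouin, Real.volume_pi_Ico]
  exact ENNReal.prod_lt_top fun _ _ => ENNReal.ofReal_lt_top

instance isFiniteMeasure_momentumMeasure (ν : ℕ) : IsFiniteMeasure (momentumMeasure ν) := by
  have : IsFiniteMeasure ((volume : Measure (Fin ν → ℝ)).restrict (brillouin ν)) :=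
    ⟨by simpa using volume_brillouin_lt_top ν⟩
  exact Measure.smul_finite _ ENNReal.ofReal_ne_top

theorem memLp_planeWave {ν : ℕ} (k : Site ν) : MemLp (planeWave k) 2 (momentumMeasure ν) :=
  MemLp.of_bound (continuous_planeWave k).aestronglyMeasurable 1
    (Eventually.of_forall fun x => (norm_planeWave k x).le)

/-- The plane wave as an element of `L²([0, 2π)^ν)`. -/
def planeWaveLp {ν : ℕ} (k : Site ν) : Lp ℂ 2 (momentumMeasure ν) := (memLp_planeWave k).toLp

theorem integral_exp_int (m : ℤ) :
    ∫ x in Set.Ico 0 (2 * Real.pi), Complex.exp (Complex.I * (m * x : ℝ)) =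
      if m = 0 then ((2 * Real.pi : ℝ) : ℂ) else 0 := by
  rw [integral_Ico_eq_integral_Ioc, ← intervalIntegral.integral_of_le (by positivity)]
  split_ifs with h
  · simp [h]
  · have hc : Complex.I * m ≠ 0 := by simp [h]
    have := integral_exp_mul_complex (a := 0) (b := 2 * Real.pi) hc
    have e : Complex.exp (Complex.I * m * ((2 * Real.pi : ℝ) : ℂ)) = 1 := by
      rw [Complex.exp_eq_one_iff]
      exact ⟨m, by push_cast; ring⟩
    rw [e] at this
    simpa [mul_assoc] using this

theorem orthonormal_planeWaveLp (ν : ℕ) :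
    Orthonormal ℂ (planeWaveLp : Site ν → Lp ℂ 2 (momentumMeasure ν)) := by
  rw [orthonormal_iff_ite]
  intro j k
  have h1 : ⟪planeWaveLp j, planeWaveLp k⟫_ℂ =
      ∫ x, ∏ i, Complex.exp (Complex.I * (((ofLex k i - ofLex j i : ℤ) : ℝ) * x i : ℝ))
        ∂(momentumMeasure ν) := by
    rw [L2.inner_def]
    refine integral_congr_ae ?_
    filter_upwards [(memLp_planeWave j).coeFn_toLp, (memLp_planeWave k).coeFn_toLp] with x hj hk
    rw [planeWaveLp, planeWaveLp, hj, hk, RCLike.inner_apply, planeWave, planeWave,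
      ← Complex.exp_conj, ← Complex.exp_add, ← Complex.exp_sum]
    congr 1
    rw [map_mul, Complex.conj_I, Complex.conj_ofReal, ← Finset.mul_sum, neg_mul, ← sub_eq_add_neg,
      ← mul_sub, ← Complex.ofReal_sub, ← Finset.sum_sub_distrib, ← Complex.ofReal_sum]
    congr 2
    refine Finset.sum_congr rfl fun i _ => ?_
    push_cast
    ring
  have h2 : (volume : Measure (Fin ν → ℝ)).restrict (brillouin ν) =
      Measure.pi fun _ => volume.restrict (Set.Ico 0 (2 * Real.pi)) := by
    rw [brillouin, volume_pi, Measure.restrict_pi_pi]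
  have hpi : (2 * Real.pi) ^ ν ≠ 0 := by positivity
  rw [h1, momentumMeasure, integral_smul_measure, h2,
    integral_fintype_prod_eq_prod (𝕜 := ℂ)
      (fun i (y : ℝ) => Complex.exp (Complex.I * (((ofLex k i - ofLex j i : ℤ) : ℝ) * y : ℝ)))]
  simp only [integral_exp_int]
  rw [ENNReal.toReal_ofReal (by positivity)]
  by_cases hjk : j = k
  · subst hjk
    simp
  · obtain ⟨i, hi⟩ : ∃ i, ofLex k i ≠ ofLex j i := by
      by_contra hcon
      push Not at hcon
      exact hjk (funext fun i => (hcon i).symm)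
    rw [if_neg hjk, Finset.prod_eq_zero (Finset.mem_univ i) (if_neg (sub_ne_zero.2 hi)), smul_zero]

/-- The Fourier transformation `ℓ²(ℤ^ν) → L²([0, 2π)^ν)` sending the basis vector at `k` to the
plane wave of `k`. -/
def latticeFourier (ν : ℕ) : OneParticle (Site ν) →ₗᵢ[ℂ] Lp ℂ 2 (momentumMeasure ν) :=
  (orthonormal_planeWaveLp ν).orthogonalFamily.linearIsometry

/-- `A = F⁻¹ M_a F`, that is `F A f = a · F f` for every `f ∈ ℓ²(ℤ^ν)`: the shift-invariant
operator `A` is multiplication by `a` in the Fourier picture. -/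
def IsMultiplication {ν : ℕ} (A : OneParticle (Site ν) →L[ℂ] OneParticle (Site ν))
    (a : (Fin ν → ℝ) → ℝ) : Prop :=
  ∀ f, latticeFourier ν (A f) =ᵐ[momentumMeasure ν] fun x => (a x : ℂ) * latticeFourier ν f x

/-- The sites with all coordinates in `{0, …, n-1}`. -/
def box (ν n : ℕ) : Finset (Site ν) :=
  (Fintype.piFinset fun _ : Fin ν => Finset.Ico (0 : ℤ) n).map toLex.toEmbedding

/-- The one-particle space of the box, spanned by the basis vectors of its sites. -/
def localSpace (ν n : ℕ) : Submodule ℂ (OneParticle (Site ν)) :=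
  Submodule.span ℂ ((fun k => lp.single 2 k (1 : ℂ)) '' (box ν n : Set (Site ν)))

/-- The sets of sites of the box; they index the basis of its Fock space. -/
abbrev LocalIndex (ν n : ℕ) : Type := ↥(box ν n).powerset

/-- The matrix of `A` on the Fock space of the box, a subspace of the full Fock space which is
invariant under the local CAR algebra. On that algebra this is the identification of
`CAR(H_n)` with all operators on the Fock space of `H_n`. -/
def localMatrix {ν : ℕ} (n : ℕ) (A : FockSpace (Site ν) →L[ℂ] FockSpace (Site ν)) :
    Matrix (LocalIndex ν n) (LocalIndex ν n) ℂ :=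
  Matrix.of fun S T => ⟪(lp.single 2 (S : Finset (Site ν)) (1 : ℂ) : FockSpace (Site ν)),
    A (lp.single 2 (T : Finset (Site ν)) (1 : ℂ))⟫_ℂ

/-- `D` is the density of the restriction of `ω` to `CAR(H_n)`: `ω(A) = Tr D A` there. -/
def IsLocalDensity {ν : ℕ} (ω : AlgState (carAlgebra (Set.univ : Set (OneParticle (Site ν)))))
    (n : ℕ) (D : Matrix (LocalIndex ν n) (LocalIndex ν n) ℂ) : Prop :=
  ∀ A : carAlgebra (Set.univ : Set (OneParticle (Site ν))),
    (A : FockSpace (Site ν) →L[ℂ] FockSpace (Site ν)) ∈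
      carAlgebra (localSpace ν n : Set (OneParticle (Site ν))) →
    ω.toLin A = (D * localMatrix n A).trace

end Lattice

section Testing

variable {ι : Type*} [Fintype ι] [DecidableEq ι]

/-- The power `D^t` of a positive matrix by functional calculus, with the convention `0^t = 0`. -/
def mpow (D : Matrix ι ι ℂ) (t : ℝ) : Matrix ι ι ℂ :=
  cfc (fun x : ℝ => if x = 0 then 0 else x ^ t) D

/-- The logarithm of a positive matrix by functional calculus. -/
def mlog (D : Matrix ι ι ℂ) : Matrix ι ι ℂ := cfc Real.log D

/-- `log Tr D^t E^{1-t}`. -/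
def logOverlap (D E : Matrix ι ι ℂ) (t : ℝ) : ℝ :=
  Real.log (mpow D t * mpow E (1 - t)).trace.re

/-- The Chernoff bound of two densities; the infimum over `[0, 1]` is attained. -/
def chernoffBound (D E : Matrix ι ι ℂ) : ℝ :=
  -sInf (logOverlap D E '' Set.Icc 0 1)

/-- The Hoeffding bound of two densities. -/
def hoeffdingBound (r : ℝ) (D E : Matrix ι ι ℂ) : ℝ :=
  sSup ((fun t => (-t * r - logOverlap D E t) / (1 - t)) '' Set.Ico 0 1)

/-- The relative entropy `Tr D (log D - log E)`. -/
def relEntropy (D E : Matrix ι ι ℂ) : ℝ := (D * (mlog D - mlog E)).trace.re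

/-- Error probability of the first kind of the test `T`, for the null-hypothesis `D`. -/
def errorFirst (D T : Matrix ι ι ℂ) : ℝ := (D * (1 - T)).trace.re

/-- Error probability of the second kind of the test `T`, for the alternative `E`. -/
def errorSecond (E T : Matrix ι ι ℂ) : ℝ := (E * T).trace.re

/-- Extended logarithm with `log 0 = -∞`. -/
def logE (p : ℝ) : EReal := ENNReal.log (ENNReal.ofReal p)

/-- `n^{-ν} log p`. -/
def scaledLog (ν n : ℕ) (p : ℝ) : EReal := ((1 / (n : ℝ) ^ ν : ℝ) : EReal) * logE p

end Testing

section Exponents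

variable {J : ℕ → Type*} [∀ n, Fintype (J n)] [∀ n, DecidableEq (J n)]

/-- A sequence of tests `0 ≤ T_n ≤ 1`. -/
def IsTestSeq (T : ∀ n, Matrix (J n) (J n) ℂ) : Prop :=
  ∀ n, (T n).PosSemidef ∧ (1 - T n).PosSemidef

/-- `-n^{-ν} log(α_n(T_n) + β_n(T_n))`. -/
def chernoffRate (ν : ℕ) (ρ σ T : ∀ n, Matrix (J n) (J n) ℂ) (n : ℕ) : EReal :=
  -scaledLog ν n (errorFirst (ρ n) (T n) + errorSecond (σ n) (T n))

/-- `-n^{-ν} log β_n(T_n)`. -/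
def secondRate (ν : ℕ) (σ T : ∀ n, Matrix (J n) (J n) ℂ) (n : ℕ) : EReal :=
  -scaledLog ν n (errorSecond (σ n) (T n))

/-- Tests with `limsup n^{-ν} log α_n(T_n) < -r`. -/
def HoeffdingAdmissible (ν : ℕ) (r : ℝ) (ρ T : ∀ n, Matrix (J n) (J n) ℂ) : Prop :=
  IsTestSeq T ∧
    limsup (fun n => scaledLog ν n (errorFirst (ρ n) (T n))) atTop < ((-r : ℝ) : EReal)

/-- Tests with `α_n(T_n) → 0`. -/
def SteinAdmissible (ρ T : ∀ n, Matrix (J n) (J n) ℂ) : Prop :=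
  IsTestSeq T ∧ Tendsto (fun n => errorFirst (ρ n) (T n)) atTop (𝓝 0)

/-- Optimal Chernoff exponent over the test sequences for which the limit exists. -/
def chernoffLim (ν : ℕ) (ρ σ : ∀ n, Matrix (J n) (J n) ℂ) : EReal :=
  sSup {L | ∃ T, IsTestSeq T ∧ Tendsto (chernoffRate ν ρ σ T) atTop (𝓝 L)}

/-- The version with the lower limit. -/
def chernoffLiminf (ν : ℕ) (ρ σ : ∀ n, Matrix (J n) (J n) ℂ) : EReal :=
  sSup {L | ∃ T, IsTestSeq T ∧ liminf (chernoffRate ν ρ σ T) atTop = L}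

/-- The version with the upper limit. -/
def chernoffLimsup (ν : ℕ) (ρ σ : ∀ n, Matrix (J n) (J n) ℂ) : EReal :=
  sSup {L | ∃ T, IsTestSeq T ∧ limsup (chernoffRate ν ρ σ T) atTop = L}

/-- Optimal Hoeffding exponent over the admissible sequences for which the limit exists. -/
def hoeffdingLim (ν : ℕ) (r : ℝ) (ρ σ : ∀ n, Matrix (J n) (J n) ℂ) : EReal :=
  sSup {L | ∃ T, HoeffdingAdmissible ν r ρ T ∧ Tendsto (secondRate ν σ T) atTop (𝓝 L)}

/-- The version with the lower limit. -/
def hoeffdingLiminf (ν : ℕ) (r : ℝ) (ρ σ : ∀ n, Matrix (J n) (J n) ℂ) : EReal :=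
  sSup {L | ∃ T, HoeffdingAdmissible ν r ρ T ∧ liminf (secondRate ν σ T) atTop = L}

/-- The version with the upper limit. -/
def hoeffdingLimsup (ν : ℕ) (r : ℝ) (ρ σ : ∀ n, Matrix (J n) (J n) ℂ) : EReal :=
  sSup {L | ∃ T, HoeffdingAdmissible ν r ρ T ∧ limsup (secondRate ν σ T) atTop = L}

/-- Optimal Stein exponent over the admissible sequences for which the limit exists. -/
def steinLim (ν : ℕ) (ρ σ : ∀ n, Matrix (J n) (J n) ℂ) : EReal :=
  sSup {L | ∃ T, SteinAdmissible ρ T ∧ Tendsto (secondRate ν σ T) atTop (𝓝 L)}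

/-- The version with the lower limit. -/
def steinLiminf (ν : ℕ) (ρ σ : ∀ n, Matrix (J n) (J n) ℂ) : EReal :=
  sSup {L | ∃ T, SteinAdmissible ρ T ∧ liminf (secondRate ν σ T) atTop = L}

/-- The version with the upper limit. -/
def steinLimsup (ν : ℕ) (ρ σ : ∀ n, Matrix (J n) (J n) ℂ) : EReal :=
  sSup {L | ∃ T, SteinAdmissible ρ T ∧ limsup (secondRate ν σ T) atTop = L}

/-- The mean Chernoff bound exists and equals `C`. -/
def HasMeanChernoff (ν : ℕ) (ρ σ : ∀ n, Matrix (J n) (J n) ℂ) (C : ℝ) : Prop :=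
  Tendsto (fun n : ℕ => 1 / (n : ℝ) ^ ν * chernoffBound (ρ n) (σ n)) atTop (𝓝 C)

/-- The mean Hoeffding bound at `r` exists and equals `H`. -/
def HasMeanHoeffding (ν : ℕ) (r : ℝ) (ρ σ : ∀ n, Matrix (J n) (J n) ℂ) (H : ℝ) : Prop :=
  Tendsto (fun n : ℕ => 1 / (n : ℝ) ^ ν * hoeffdingBound ((n : ℝ) ^ ν * r) (ρ n) (σ n))
    atTop (𝓝 H)

/-- The mean relative entropy exists and equals `S`. -/
def HasMeanRelEntropy (ν : ℕ) (ρ σ : ∀ n, Matrix (J n) (J n) ℂ) (S : ℝ) : Prop :=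
  Tendsto (fun n : ℕ => 1 / (n : ℝ) ^ ν * relEntropy (ρ n) (σ n)) atTop (𝓝 S)

end Exponents

/-- The function `ψ` of the two symbol functions `q` and `r`. -/
def psi {ν : ℕ} (q r : (Fin ν → ℝ) → ℝ) (t : ℝ) : ℝ :=
  1 / (2 * Real.pi) ^ ν * ∫ x in brillouin ν,
    Real.log (q x ^ t * r x ^ (1 - t) + (1 - q x) ^ t * (1 - r x) ^ (1 - t))

end CARLattice

end

open CARLattice

/-! The proof has two independent halves. The first is a large-deviation argument for arbitrary
positive definite densities for which `ψ_n / n^ν` converges pointwise to a differentiable function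
`ψ` (`OverlapAsymptotics`, `error_exponents`). The second is a Szegő-type limit theorem which shows
that quasi-free densities have this property.

Optimality in the first half rests on the Nussbaum–Szkoła reduction. The squared overlaps of the two
eigenbases give a classical pair of laws with log-likelihood ratio `L`. Its moment generating
function is `Tr ρ^t σ^(1-t)`, and every quantum test has weighted error at least half of the
truncated moment `E min(e^L, c)` (`half_sum_min_le_error`, `exists_classical_model`). Tilting by
`e^(tL)` concentrates `L / n^ν` at `ψ'(t)`, as in the Gärtner–Ellis theorem, and this bounds the
truncated moment from below (`eventually_le_truncMoment`). The Chernoff and Hoeffding converses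
follow by choosing `t` well. The Stein converse uses that derivatives of convex functions converge
with the functions, so that the relative entropy per site tends to `ψ'(1)`. Achievability is the
Audenaert inequality (`exists_test_error_le`), whose test does not depend on `t`.

In the second half, the determinant formula identifies the local density as a product density of
independent modes, rotated by the second quantization of a unitary (`density_eq_quasiFreeDensity`).
Since second quantization is multiplicative and `Tr Γ(W) = det(1 + W)`, the function `ψ_n(t)` is a
sum of three traces of functions of the compressions of `Q` and `R` to the box
(`logOverlap_quasiFreeDensity`). The Fourier coefficients of the symbols are square summable, so
compression is multiplicative up to a Hilbert–Schmidt error `o(n^(ν/2))`. Polynomials, then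
continuous functions, and products of these may therefore be computed on the symbols when the trace
per site is taken (`HasSymbol`, `HasSymbol.tendsto_trace`). The bounds `η` and `1 - η` keep the
logarithms and powers continuous on the spectra and allow differentiation under the integral that
defines `ψ`. -/

open CARLattice

/-! ### Nussbaum–Szkoła weights and lower bounds for test errors. -/

section SpectralOverlap

variable {ι : Type*} [Fintype ι] [DecidableEq ι]

/-- Squared overlaps of the eigenvectors of two Hermitian matrices. -/
noncomputable def overlapWeight {A B : Matrix ι ι ℂ} (hA : A.IsHermitian) (hB : B.IsHermitian)
    (i j : ι) : ℝ :=
  Complex.normSq ((star (hA.eigenvectorUnitary : Matrix ι ι ℂ) *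
    (hB.eigenvectorUnitary : Matrix ι ι ℂ)) i j)

theorem overlapWeight_nonneg {A B : Matrix ι ι ℂ} (hA : A.IsHermitian) (hB : B.IsHermitian)
    (i j : ι) : 0 ≤ overlapWeight hA hB i j := Complex.normSq_nonneg _

theorem trace_diagonal_conj (f g : ι → ℂ) (W : Matrix ι ι ℂ) :
    (Matrix.diagonal f * W * Matrix.diagonal g * star W).trace =
      ∑ i, ∑ j, f i * g j * (Complex.normSq (W i j) : ℂ) := by
  rw [Matrix.trace]
  refine Finset.sum_congr rfl fun i _ => ?_
  rw [Matrix.diag, Matrix.mul_apply]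
  refine Finset.sum_congr rfl fun j _ => ?_
  rw [Matrix.mul_diagonal, Matrix.diagonal_mul, ← Complex.mul_conj, Matrix.star_apply,
    Complex.star_def]
  ring

theorem trace_cfc_mul_cfc {A B : Matrix ι ι ℂ} (hA : A.IsHermitian) (hB : B.IsHermitian)
    (f g : ℝ → ℝ) :
    (cfc f A * cfc g B).trace =
      ((∑ i, ∑ j, f (hA.eigenvalues i) * g (hB.eigenvalues j) * overlapWeight hA hB i j : ℝ) : ℂ) := by
  rw [hA.cfc_eq, hB.cfc_eq, Matrix.IsHermitian.cfc, Matrix.IsHermitian.cfc,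
    Unitary.conjStarAlgAut_apply, Unitary.conjStarAlgAut_apply]
  set U : Matrix ι ι ℂ := (hA.eigenvectorUnitary : Matrix ι ι ℂ) with hU
  set V : Matrix ι ι ℂ := (hB.eigenvectorUnitary : Matrix ι ι ℂ) with hV
  have : (U * Matrix.diagonal (RCLike.ofReal ∘ f ∘ hA.eigenvalues) * star U *
      (V * Matrix.diagonal (RCLike.ofReal ∘ g ∘ hB.eigenvalues) * star V)).trace =
      (Matrix.diagonal (RCLike.ofReal ∘ f ∘ hA.eigenvalues) * (star U * V) *
        Matrix.diagonal (RCLike.ofReal ∘ g ∘ hB.eigenvalues) * star (star U * V)).trace := by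
    rw [star_mul, star_star, Matrix.mul_assoc U, Matrix.mul_assoc U, Matrix.trace_mul_comm U]
    simp only [Matrix.mul_assoc]
  erw [this, trace_diagonal_conj]
  push_cast
  rfl

theorem trace_mul_cfc_left {A : Matrix ι ι ℂ} (hA : A.IsHermitian) (X : Matrix ι ι ℂ) (f : ℝ → ℝ) :
    (cfc f A * X).trace = ∑ i, (f (hA.eigenvalues i) : ℂ) *
      (star (hA.eigenvectorUnitary : Matrix ι ι ℂ) * X * hA.eigenvectorUnitary) i i := by
  rw [hA.cfc_eq, Matrix.IsHermitian.cfc, Unitary.conjStarAlgAut_apply, Matrix.mul_assoc,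
    Matrix.mul_assoc, Matrix.trace_mul_comm, Matrix.mul_assoc, Matrix.trace]
  refine Finset.sum_congr rfl fun i _ => ?_
  rw [Matrix.diag, Matrix.diagonal_mul]
  rfl

theorem sum_normSq_row {U : Matrix ι ι ℂ} (h : U * star U = 1) (i : ι) :
    ∑ j, Complex.normSq (U i j) = 1 := by
  have := congrFun (congrFun h i) i
  rw [Matrix.mul_apply, Matrix.one_apply_eq] at this
  apply Complex.ofReal_injective
  push_cast
  rw [← this]
  exact Finset.sum_congr rfl fun j _ => by rw [← Complex.mul_conj]; rfl

/-- Because `T - T² = T(1 - T)T + (1 - T)T(1 - T)`. -/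
theorem posSemidef_sub_mul_self {T : Matrix ι ι ℂ} (hT : T.PosSemidef)
    (hT' : (1 - T).PosSemidef) : (T - T * T).PosSemidef := by
  have h1 := hT'.mul_mul_conjTranspose_same T
  have h2 := hT.mul_mul_conjTranspose_same (1 - T)
  rw [hT.1.eq] at h1
  rw [hT'.1.eq] at h2
  convert h1.add h2 using 1
  noncomm_ring

/-- As `V` is unitary, summing over `j` turns the left side into `Tr A T²`, and `T² ≤ T`. -/
theorem sum_eigenvalues_mul_normSq_le {A T V : Matrix ι ι ℂ} (hA : A.PosSemidef)
    (hT : T.PosSemidef) (hT' : (1 - T).PosSemidef) (hV : V * star V = 1) :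
    ∑ i, ∑ j, hA.1.eigenvalues i * Complex.normSq
      ((star (hA.1.eigenvectorUnitary : Matrix ι ι ℂ) * T * V) i j) ≤ (A * T).trace.re := by
  have hid : cfc (fun x : ℝ => x) A = A := cfc_id' ℝ A hA.1
  conv_rhs => rw [← hid]
  rw [trace_mul_cfc_left hA.1]
  set U : Matrix ι ι ℂ := (hA.1.eigenvectorUnitary : Matrix ι ι ℂ) with hU
  rw [Complex.re_sum]
  refine Finset.sum_le_sum fun i _ => ?_
  rw [← Finset.mul_sum, Complex.re_ofReal_mul]
  refine mul_le_mul_of_nonneg_left ?_ (hA.eigenvalues_nonneg i)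
  have h1 : ((star U * T * V) * star (star U * T * V)) i i =
      ((∑ j, Complex.normSq ((star U * T * V) i j) : ℝ) : ℂ) := by
    rw [Matrix.mul_apply]
    push_cast
    refine Finset.sum_congr rfl fun j _ => ?_
    rw [Matrix.star_apply, Complex.star_def, Complex.mul_conj]
  have h2 : (star U * T * V) * star (star U * T * V) = star U * (T * T) * U := by
    have hTs : star T = T := hT.1
    simp only [star_mul, star_star, hTs]
    calc _ = star U * T * (V * star V) * T * U := by simp only [Matrix.mul_assoc]
      _ = _ := by rw [hV, Matrix.mul_one]; simp only [Matrix.mul_assoc]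
  have h3 := (posSemidef_sub_mul_self hT hT').conjTranspose_mul_mul_same U
  have h4 := (Complex.le_def.1 (h3.diag_nonneg (i := i))).1
  rw [h2] at h1
  have h5 : (star U * (T * T) * U) i i = (star U * T * U) i i -
      (U.conjTranspose * (T - T * T) * U) i i := by
    rw [← Matrix.star_eq_conjTranspose, Matrix.mul_sub, Matrix.sub_mul, Matrix.sub_apply]
    ring
  rw [h5] at h1
  have h6 := congrArg Complex.re h1
  rw [Complex.sub_re, Complex.ofReal_re] at h6
  rw [Complex.zero_re] at h4
  linarith

theorem normSq_conj_apply {ι : Type*} [Fintype ι] (U T V : Matrix ι ι ℂ) (hT : T.IsHermitian)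
    (i j : ι) :
    Complex.normSq ((star V * T * U) j i) = Complex.normSq ((star U * T * V) i j) := by
  have : star V * T * U = star (star U * T * V) := by
    have hTs : star T = T := hT
    simp only [star_mul, star_star, hTs, Matrix.mul_assoc]
  rw [this, Matrix.star_apply, Complex.star_def, Complex.normSq_conj]

/-- From `|z + w|² ≤ 2|z|² + 2|w|²` and the minimum lying below both weights. The factor `1/2` of
the converse bounds originates here. -/
theorem normSq_add_mul_min_le (z w : ℂ) {a b : ℝ} (ha : 0 ≤ a) (hb : 0 ≤ b) :
    1 / 2 * (Complex.normSq (z + w) * min a b) ≤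
      a * Complex.normSq z + b * Complex.normSq w := by
  have h4 : Complex.normSq (z + w) ≤ 2 * (Complex.normSq z + Complex.normSq w) := by
    simp only [Complex.normSq_apply, Complex.add_re, Complex.add_im]
    nlinarith [sq_nonneg (z.re - w.re), sq_nonneg (z.im - w.im)]
  have h5 := mul_le_mul_of_nonneg_right (min_le_left a b) (Complex.normSq_nonneg z)
  have h6 := mul_le_mul_of_nonneg_right (min_le_right a b) (Complex.normSq_nonneg w)
  linarith [mul_le_mul_of_nonneg_left h4 (le_min ha hb)]

/-- Inserting `1 = (1 - T) + T` between two eigenvectors splits their inner product into the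
amplitudes that enter the two error probabilities. -/
theorem overlapWeight_eq_normSq_add {A B : Matrix ι ι ℂ} (hA : A.IsHermitian)
    (hB : B.IsHermitian) (T : Matrix ι ι ℂ) (i j : ι) :
    overlapWeight hA hB i j = Complex.normSq
      ((star (hA.eigenvectorUnitary : Matrix ι ι ℂ) * (1 - T) * hB.eigenvectorUnitary) i j +
      (star (hA.eigenvectorUnitary : Matrix ι ι ℂ) * T * hB.eigenvectorUnitary) i j) := by
  rw [overlapWeight, ← Matrix.add_apply, ← Matrix.add_mul, ← Matrix.mul_add, sub_add_cancel,
    Matrix.mul_one]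

/-- The Nussbaum–Szkoła lower bound for the weighted error of a quantum test. -/
theorem half_sum_min_le_error {A B : Matrix ι ι ℂ} (hA : A.PosSemidef) (hB : B.PosSemidef)
    {T : Matrix ι ι ℂ} (hT : T.PosSemidef) (hT' : (1 - T).PosSemidef) {c : ℝ} (hc : 0 ≤ c) :
    1 / 2 * ∑ i, ∑ j, overlapWeight hA.1 hB.1 i j *
      min (hA.1.eigenvalues i) (c * hB.1.eigenvalues j) ≤ errorFirst A T + c * errorSecond B T := by
  have hT'' : (1 - (1 - T)).PosSemidef := by rwa [sub_sub_cancel]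
  have h1 := sum_eigenvalues_mul_normSq_le hA hT' hT''
    (Unitary.mul_star_self_of_mem hB.1.eigenvectorUnitary.2)
  have h2 : ∑ i, ∑ j, hB.1.eigenvalues j * Complex.normSq
      ((star (hA.1.eigenvectorUnitary : Matrix ι ι ℂ) * T * hB.1.eigenvectorUnitary) i j) ≤
      (B * T).trace.re := by
    -- The roles of `A` and `B` are exchanged: the eigenvectors of `A` now form the complete system
    -- that is summed out. As `T` is Hermitian, the matrix element keeps its modulus.
    refine le_trans (le_of_eq ?_) (sum_eigenvalues_mul_normSq_le hB hT hT'
      (Unitary.mul_star_self_of_mem hA.1.eigenvectorUnitary.2))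
    rw [Finset.sum_comm]
    refine Finset.sum_congr rfl fun i _ => Finset.sum_congr rfl fun j _ => ?_
    rw [normSq_conj_apply _ _ _ hT.1]
  refine le_trans ?_ (add_le_add h1 (mul_le_mul_of_nonneg_left h2 hc))
  rw [Finset.mul_sum, Finset.mul_sum, ← Finset.sum_add_distrib]
  refine Finset.sum_le_sum fun i _ => ?_
  rw [Finset.mul_sum, Finset.mul_sum, ← Finset.sum_add_distrib]
  refine Finset.sum_le_sum fun j _ => ?_
  rw [overlapWeight_eq_normSq_add hA.1 hB.1 T, ← mul_assoc c]
  exact normSq_add_mul_min_le _ _ (hA.eigenvalues_nonneg i)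
    (mul_nonneg hc (hB.eigenvalues_nonneg j))

theorem sum_overlapWeight_right {A B : Matrix ι ι ℂ} (hA : A.IsHermitian) (hB : B.IsHermitian)
    (i : ι) : ∑ j, overlapWeight hA hB i j = 1 := by
  refine sum_normSq_row ?_ i
  rw [star_mul, star_star, Matrix.mul_assoc, ← Matrix.mul_assoc _ (star _),
    Unitary.mul_star_self_of_mem hB.eigenvectorUnitary.2, Matrix.one_mul,
    Unitary.star_mul_self_of_mem hA.eigenvectorUnitary.2]

/-- The overlap weights are doubly stochastic: columns for the pair are rows for the exchanged pair,
by symmetry of `|⟨e, f⟩|`. -/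
theorem sum_overlapWeight_left {A B : Matrix ι ι ℂ} (hA : A.IsHermitian) (hB : B.IsHermitian)
    (j : ι) : ∑ i, overlapWeight hA hB i j = 1 := by
  rw [← sum_overlapWeight_right hB hA j]
  refine Finset.sum_congr rfl fun i _ => ?_
  simpa [overlapWeight] using
    normSq_conj_apply (hB.eigenvectorUnitary : Matrix ι ι ℂ) 1 hA.eigenvectorUnitary
      Matrix.isHermitian_one j i

theorem trace_mpow_mul_mpow {A B : Matrix ι ι ℂ} (hA : A.PosDef) (hB : B.PosDef) (t : ℝ) :
    (mpow A t * mpow B (1 - t)).trace.re = ∑ i, ∑ j, overlapWeight hA.1 hB.1 i j *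
      (hA.1.eigenvalues i ^ t * hB.1.eigenvalues j ^ (1 - t)) := by
  rw [mpow, mpow, trace_cfc_mul_cfc hA.1 hB.1, Complex.ofReal_re]
  refine Finset.sum_congr rfl fun i _ => Finset.sum_congr rfl fun j _ => ?_
  rw [if_neg (hA.eigenvalues_pos i).ne', if_neg (hB.eigenvalues_pos j).ne', mul_comm]

theorem relEntropy_eq {A B : Matrix ι ι ℂ} (hA : A.PosDef) (hB : B.PosDef) :
    relEntropy A B = ∑ i, ∑ j, overlapWeight hA.1 hB.1 i j *
      (hA.1.eigenvalues i * (Real.log (hA.1.eigenvalues i) - Real.log (hB.1.eigenvalues j))) := by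
  have hid : cfc (fun x : ℝ => x) A = A := cfc_id' ℝ A hA.1
  have h1 := trace_cfc_mul_cfc hA.1 hB.1 (fun x => x) Real.log
  -- Pairing `x log x` with the constant function `1` writes `Tr A log A` as a double sum over the
  -- same weights.
  have h2 := trace_cfc_mul_cfc hA.1 hB.1 (fun x => x * Real.log x) fun _ => 1
  have h3 : cfc (fun x : ℝ => x * Real.log x) A = A * cfc Real.log A := by
    rw [cfc_mul (fun x : ℝ => x) Real.log A (Set.finite_coe_iff.1
      (Matrix.finite_real_spectrum)|>.continuousOn _) (Set.finite_coe_iff.1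
      (Matrix.finite_real_spectrum)|>.continuousOn _), hid]
  rw [hid] at h1
  have h4 : cfc (fun _ : ℝ => (1 : ℝ)) B = 1 := cfc_const_one ℝ B (ha := hB.1)
  rw [h3, h4, Matrix.mul_one] at h2
  rw [relEntropy, mlog, mlog, Matrix.mul_sub, Matrix.trace_sub, h1, h2, ← Complex.ofReal_sub,
    Complex.ofReal_re, ← Finset.sum_sub_distrib]
  refine Finset.sum_congr rfl fun i _ => ?_
  rw [← Finset.sum_sub_distrib]
  exact Finset.sum_congr rfl fun j _ => by ring

theorem sum_eigenvalues_eq_one {A : Matrix ι ι ℂ} (hA : A.IsHermitian) (h : A.trace = 1) :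
    ∑ i, hA.eigenvalues i = 1 := by
  have := hA.trace_eq_sum_eigenvalues
  rw [h] at this
  apply Complex.ofReal_injective
  push_cast
  exact this.symm

end SpectralOverlap

/-! ### The Audenaert inequality. -/

section NeymanPearson

variable {ι : Type*} [Fintype ι] [DecidableEq ι]

open scoped Matrix.Norms.L2Operator MatrixOrder

/-- Zero is not in the spectrum, so the convention `0^t = 0` plays no role. -/
theorem mpow_eq_rpow {A : Matrix ι ι ℂ} (hA : A.PosDef) (t : ℝ) : mpow A t = A ^ t := by
  rw [CFC.rpow_eq_cfc_real hA.posSemidef.nonneg, mpow]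
  refine cfc_congr fun x hx => ?_
  have : x ≠ 0 := by
    rintro rfl
    exact spectrum.zero_notMem ℝ hA.isUnit hx
  simp [this]

theorem trace_mul_re_le {A B C : Matrix ι ι ℂ} (hAB : A ≤ B) (hC : 0 ≤ C) :
    (A * C).trace.re ≤ (B * C).trace.re := by
  obtain ⟨S, rfl⟩ := CStarAlgebra.nonneg_iff_eq_star_mul_self.1 hC
  have h := (Complex.le_def.1 ((Matrix.le_iff.1 hAB).mul_mul_conjTranspose_same S).trace_nonneg).1
  rw [Matrix.mul_assoc, Matrix.trace_mul_comm, Matrix.mul_assoc, Matrix.sub_mul, Matrix.trace_sub,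
    Complex.sub_re, Complex.zero_re] at h
  exact sub_nonneg.1 h

theorem trace_mul_re_le' {A B C : Matrix ι ι ℂ} (hAB : A ≤ B) (hC : 0 ≤ C) :
    (C * A).trace.re ≤ (C * B).trace.re := by
  rw [Matrix.trace_mul_comm C, Matrix.trace_mul_comm C]
  exact trace_mul_re_le hAB hC

/-- The Audenaert inequality. -/
theorem exists_test_error_le {A B : Matrix ι ι ℂ} (hA : A.PosDef) (hB : B.PosDef) :
    ∃ T : Matrix ι ι ℂ, T.PosSemidef ∧ (1 - T).PosSemidef ∧ ∀ t ∈ Set.Icc (0 : ℝ) 1,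
      errorFirst A T + errorSecond B T ≤ (mpow A t * mpow B (1 - t)).trace.re := by
  have hD : IsSelfAdjoint (A - B) := hA.1.sub hB.1
  have hc : ∀ f : ℝ → ℝ, ContinuousOn f (spectrum ℝ (A - B)) := fun f =>
    (Matrix.finite_real_spectrum (A := A - B)).continuousOn f
  -- The Neyman–Pearson test: `T` is the spectral projection of `A - B` on the positive half-line
  -- and `P` is the positive part of `A - B`. The matrix `B + P` dominates both `A` and `B`.
  set T : Matrix ι ι ℂ := cfc (fun x : ℝ => if 0 < x then (1 : ℝ) else 0) (A - B) with hTdef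
  set P : Matrix ι ι ℂ := cfc (fun x : ℝ => max x 0) (A - B) with hPdef
  have hT0 : 0 ≤ T := cfc_nonneg fun x _ => by split_ifs <;> norm_num
  have hT1 : T ≤ 1 := cfc_le_one _ _ fun x _ => by split_ifs <;> norm_num
  have hP0 : 0 ≤ P := cfc_nonneg fun x _ => le_max_right _ _
  have hPT : (A - B) * T = P := by
    have := cfc_mul (fun x : ℝ => x) (fun x : ℝ => if 0 < x then (1 : ℝ) else 0) (A - B)
      (hc _) (hc _)
    rw [cfc_id' ℝ (A - B) hD] at this
    rw [hTdef, ← this, hPdef]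
    refine cfc_congr fun x _ => ?_
    split_ifs with h
    · rw [mul_one, max_eq_left h.le]
    · rw [mul_zero, max_eq_right (not_lt.1 h)]
  have hPD : A - B ≤ P := by
    conv_lhs => rw [← cfc_id' ℝ (A - B) hD]
    exact cfc_mono (fun x _ => le_max_left _ _) (hc _) (hc _)
  have hA0 : 0 ≤ A := hA.posSemidef.nonneg
  have hB0 : 0 ≤ B := hB.posSemidef.nonneg
  have hBC : B ≤ B + P := le_add_of_nonneg_right hP0
  have hAC : A ≤ B + P := by rw [add_comm]; exact sub_le_iff_le_add.1 hPD
  have hCpd : (B + P).PosDef := hB.add_posSemidef (Matrix.nonneg_iff_posSemidef.1 hP0)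
  refine ⟨T, Matrix.nonneg_iff_posSemidef.1 hT0, Matrix.le_iff.1 hT1, fun t ht => ?_⟩
  have hs : 1 - t ∈ Set.Icc (0 : ℝ) 1 := ⟨by linarith [ht.2], by linarith [ht.1]⟩
  have hpow : ∀ X : Matrix ι ι ℂ, X.PosDef → X ^ t * X ^ (1 - t) = X := fun X hX => by
    rw [← CFC.rpow_add (a := X) hX.isUnit, add_sub_cancel, CFC.rpow_one X hX.posSemidef.nonneg]
  rw [mpow_eq_rpow hA, mpow_eq_rpow hB, errorFirst, errorSecond, mul_sub, mul_one,
    Matrix.trace_sub]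
  have e1 : (A * T).trace.re = (B * T).trace.re + P.trace.re := by
    rw [← hPT, Matrix.sub_mul, Matrix.trace_sub, Complex.sub_re]; ring
  -- Put `C = B + P`. Powers in `[0, 1]` are operator monotone, so `Tr A ≤ Tr A^t C^(1-t)`, and `Tr
  -- A^t (C^(1-t) - B^(1-t)) ≤ Tr C^t (C^(1-t) - B^(1-t)) ≤ Tr C - Tr B = Tr P`. Together `Tr A - Tr
  -- P ≤ Tr A^t B^(1-t)`, and by `e1` the left side is the total error of `T`.
  have e2 : A.trace.re ≤ (A ^ t * (B + P) ^ (1 - t)).trace.re := by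
    conv_lhs => rw [← hpow A hA]
    exact trace_mul_re_le' (CFC.rpow_le_rpow hs hAC) CFC.rpow_nonneg
  have e3 := trace_mul_re_le (CFC.rpow_le_rpow ht hAC)
    (sub_nonneg.2 (CFC.rpow_le_rpow hs hBC))
  have e4 : B.trace.re ≤ ((B + P) ^ t * B ^ (1 - t)).trace.re := by
    conv_lhs => rw [← hpow B hB]
    exact trace_mul_re_le (CFC.rpow_le_rpow ht hBC) CFC.rpow_nonneg
  rw [mul_sub, mul_sub, hpow _ hCpd, Matrix.trace_sub, Matrix.trace_sub, Matrix.trace_add] at e3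
  simp only [Complex.sub_re, Complex.add_re] at e3 ⊢
  linarith

end NeymanPearson

/-! ### Moment generating functions and truncated moments on a finite space. -/

section FiniteCumulant

variable {Ω : Type*} [Fintype Ω]

/-- The moment generating function of `L` under the weights `v`. -/
noncomputable def expMoment (v L : Ω → ℝ) (t : ℝ) : ℝ := ∑ i, v i * Real.exp (t * L i)

/-- The truncated moment `∑ v min(e^L, c)`. -/
noncomputable def truncMoment (v L : Ω → ℝ) (c : ℝ) : ℝ := ∑ i, v i * min (Real.exp (L i)) c

variable {v L : Ω → ℝ}

theorem expMoment_pos (hv : ∀ i, 0 ≤ v i) (hs : 0 < ∑ i, v i) (t : ℝ) : 0 < expMoment v L t := by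
  obtain ⟨i, -, hi⟩ := Finset.exists_lt_of_sum_lt
    (show ∑ i : Ω, (0 : ℝ) < ∑ i, v i by simpa using hs)
  exact Finset.sum_pos' (fun i _ => mul_nonneg (hv i) (Real.exp_pos _).le)
    ⟨i, Finset.mem_univ i, mul_pos hi (Real.exp_pos _)⟩

theorem expMoment_zero : expMoment v L 0 = ∑ i, v i := by simp [expMoment]

/-- Hölder's inequality, obtained by summing the weighted arithmetic-geometric mean inequality for
the normalized terms `p i / P` and `q i / Q`. -/
theorem sum_rpow_mul_rpow_le {p q : Ω → ℝ} (hp : ∀ i, 0 ≤ p i) (hq : ∀ i, 0 ≤ q i)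
    (hP : 0 < ∑ i, p i) (hQ : 0 < ∑ i, q i) {a b : ℝ} (ha : 0 ≤ a) (hb : 0 ≤ b) (hab : a + b = 1) :
    ∑ i, p i ^ a * q i ^ b ≤ (∑ i, p i) ^ a * (∑ i, q i) ^ b := by
  set P := ∑ i, p i
  set Q := ∑ i, q i
  have h1 : ∀ i, p i ^ a * q i ^ b ≤ P ^ a * Q ^ b * (a * (p i / P) + b * (q i / Q)) := fun i => by
    have := Real.geom_mean_le_arith_mean2_weighted ha hb (div_nonneg (hp i) hP.le)
      (div_nonneg (hq i) hQ.le) hab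
    rw [Real.div_rpow (hp i) hP.le, Real.div_rpow (hq i) hQ.le] at this
    have hPa := Real.rpow_pos_of_pos hP a
    have hQb := Real.rpow_pos_of_pos hQ b
    calc _ = P ^ a * Q ^ b * (p i ^ a / P ^ a * (q i ^ b / Q ^ b)) := by field_simp
      _ ≤ _ := by gcongr
  refine (Finset.sum_le_sum fun i _ => h1 i).trans (le_of_eq ?_)
  rw [← Finset.mul_sum, Finset.sum_add_distrib, ← Finset.mul_sum, ← Finset.mul_sum,
    ← Finset.sum_div, ← Finset.sum_div, div_self hP.ne', div_self hQ.ne', mul_one, mul_one, hab,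
    mul_one]

/-- Hölder's inequality between the weights tilted by `x` and by `y`. -/
theorem convexOn_log_expMoment (hv : ∀ i, 0 ≤ v i) (hs : 0 < ∑ i, v i) :
    ConvexOn ℝ Set.univ fun t => Real.log (expMoment v L t) := by
  refine ⟨convex_univ, fun x _ y _ a b ha hb hab => ?_⟩
  have hx := expMoment_pos (L := L) hv hs x
  have hy := expMoment_pos (L := L) hv hs y
  have h := sum_rpow_mul_rpow_le (p := fun i => v i * Real.exp (x * L i))
    (q := fun i => v i * Real.exp (y * L i)) (fun i => mul_nonneg (hv i) (Real.exp_pos _).le)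
    (fun i => mul_nonneg (hv i) (Real.exp_pos _).le) hx hy ha hb hab
  have e : expMoment v L (a • x + b • y) =
      ∑ i, (v i * Real.exp (x * L i)) ^ a * (v i * Real.exp (y * L i)) ^ b := by
    refine Finset.sum_congr rfl fun i _ => ?_
    rw [Real.mul_rpow (hv i) (Real.exp_pos _).le, Real.mul_rpow (hv i) (Real.exp_pos _).le,
      ← Real.exp_mul, ← Real.exp_mul]
    have : v i ^ a * v i ^ b = v i := by
      rcases (hv i).eq_or_lt with h0 | h0
      · rw [← h0, ← Real.rpow_add_of_nonneg le_rfl ha hb, hab, Real.rpow_one]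
      · rw [← Real.rpow_add h0, hab, Real.rpow_one]
    calc _ = v i * (Real.exp (x * L i * a) * Real.exp (y * L i * b)) := by
          rw [← Real.exp_add]; congr 2; simp only [smul_eq_mul]; ring
      _ = (v i ^ a * v i ^ b) * (Real.exp (x * L i * a) * Real.exp (y * L i * b)) := by rw [this]
      _ = _ := by ring
  simp only [smul_eq_mul] at e ⊢
  calc _ ≤ Real.log (expMoment v L x ^ a * expMoment v L y ^ b) :=
        Real.log_le_log (expMoment_pos hv hs _) (e ▸ h)
    _ = _ := by
      rw [Real.log_mul (Real.rpow_pos_of_pos hx _).ne' (Real.rpow_pos_of_pos hy _).ne',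
        Real.log_rpow hx, Real.log_rpow hy]

theorem hasDerivAt_log_expMoment (hv : ∀ i, 0 ≤ v i) (hs : 0 < ∑ i, v i) (t : ℝ) :
    HasDerivAt (fun t => Real.log (expMoment v L t))
      ((∑ i, v i * (Real.exp (t * L i) * L i)) / expMoment v L t) t := by
  refine HasDerivAt.log ?_ (expMoment_pos hv hs t).ne'
  unfold expMoment
  refine HasDerivAt.fun_sum fun i _ => HasDerivAt.const_mul _ ?_
  simpa using ((hasDerivAt_id t).mul_const (L i)).exp

/-- Split `min(e^L, c)` into its powers `1 - t` and `t`, and bound the first by `c^(1-t)` and the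
second by `e^(tL)`. -/
theorem truncMoment_le (hv : ∀ i, 0 ≤ v i) {c t : ℝ} (hc : 0 < c) (ht : t ∈ Set.Icc (0 : ℝ) 1) :
    truncMoment v L c ≤ c ^ (1 - t) * expMoment v L t := by
  rw [truncMoment, expMoment, Finset.mul_sum]
  refine Finset.sum_le_sum fun i _ => ?_
  rw [mul_left_comm]
  refine mul_le_mul_of_nonneg_left ?_ (hv i)
  have hm : 0 < min (Real.exp (L i)) c := lt_min (Real.exp_pos _) hc
  calc min (Real.exp (L i)) c = min (Real.exp (L i)) c ^ (1 - t) * min (Real.exp (L i)) c ^ t := by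
        rw [← Real.rpow_add hm, sub_add_cancel, Real.rpow_one]
    _ ≤ c ^ (1 - t) * Real.exp (L i) ^ t :=
        mul_le_mul (Real.rpow_le_rpow hm.le (min_le_right _ _) (by linarith [ht.2]))
          (Real.rpow_le_rpow hm.le (min_le_left _ _) ht.1) (by positivity) (by positivity)
    _ = _ := by rw [← Real.exp_mul, mul_comm t]

/-- Cramér's tilting in finite form. On the window `x ≤ L ≤ y` both `e^L` and `c` dominate `e^(tL)`
times the prefactor. Outside the window one of the subtracted Markov terms, `e^(h(L-y))` or
`e^(h(x-L))`, exceeds `1` and makes the bracket nonpositive. The inequality therefore holds term by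
term. -/
theorem le_truncMoment (hv : ∀ i, 0 ≤ v i) {c t : ℝ} (hc : 0 < c) (ht : t ∈ Set.Icc (0 : ℝ) 1)
    {h : ℝ} (hh : 0 < h) (x y : ℝ) :
    min (Real.exp ((1 - t) * x)) (c * Real.exp (-t * y)) *
      (expMoment v L t - Real.exp (-h * y) * expMoment v L (t + h) -
        Real.exp (h * x) * expMoment v L (t - h)) ≤ truncMoment v L c := by
  rw [truncMoment, expMoment, expMoment, expMoment, Finset.mul_sum, Finset.mul_sum,
    ← Finset.sum_sub_distrib, ← Finset.sum_sub_distrib, Finset.mul_sum]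
  refine Finset.sum_le_sum fun i _ => ?_
  have e1 : Real.exp (-h * y) * (v i * Real.exp ((t + h) * L i)) =
      v i * Real.exp (t * L i) * Real.exp (h * (L i - y)) := by
    rw [mul_left_comm, ← Real.exp_add, mul_assoc, ← Real.exp_add]; congr 2; ring
  have e2 : Real.exp (h * x) * (v i * Real.exp ((t - h) * L i)) =
      v i * Real.exp (t * L i) * Real.exp (h * (x - L i)) := by
    rw [mul_left_comm, ← Real.exp_add, mul_assoc, ← Real.exp_add]; congr 2; ring
  rw [e1, e2]
  have hm : 0 < min (Real.exp ((1 - t) * x)) (c * Real.exp (-t * y)) :=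
    lt_min (Real.exp_pos _) (mul_pos hc (Real.exp_pos _))
  have hr : 0 ≤ v i * min (Real.exp (L i)) c :=
    mul_nonneg (hv i) (le_min (Real.exp_pos _).le hc.le)
  have hvt : 0 ≤ v i * Real.exp (t * L i) := mul_nonneg (hv i) (Real.exp_pos _).le
  have f1 := Real.exp_pos (h * (L i - y))
  have f2 := Real.exp_pos (h * (x - L i))
  by_cases h1 : y < L i
  · refine le_trans (mul_nonpos_of_nonneg_of_nonpos hm.le ?_) hr
    have : 1 ≤ Real.exp (h * (L i - y)) := Real.one_le_exp (by nlinarith)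
    nlinarith [mul_nonneg hvt f2.le]
  by_cases h2 : L i < x
  · refine le_trans (mul_nonpos_of_nonneg_of_nonpos hm.le ?_) hr
    have : 1 ≤ Real.exp (h * (x - L i)) := Real.one_le_exp (by nlinarith)
    nlinarith [mul_nonneg hvt f1.le]
  rw [not_lt] at h1 h2
  calc _ ≤ min (Real.exp ((1 - t) * x)) (c * Real.exp (-t * y)) * (v i * Real.exp (t * L i)) := by
        refine mul_le_mul_of_nonneg_left ?_ hm.le
        nlinarith [mul_nonneg hvt f1.le, mul_nonneg hvt f2.le]
    _ = v i * (min (Real.exp ((1 - t) * x)) (c * Real.exp (-t * y)) * Real.exp (t * L i)) := by ring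
    _ ≤ _ := by
      refine mul_le_mul_of_nonneg_left (le_min ?_ ?_) (hv i)
      · calc _ ≤ Real.exp ((1 - t) * x) * Real.exp (t * L i) := by gcongr; exact min_le_left _ _
          _ = Real.exp ((1 - t) * x + t * L i) := by rw [Real.exp_add]
          _ ≤ _ := Real.exp_le_exp.2 (by nlinarith [ht.2])
      · calc _ ≤ c * Real.exp (-t * y) * Real.exp (t * L i) := by gcongr; exact min_le_right _ _
          _ = c * Real.exp (t * (L i - y)) := by
            rw [mul_assoc, ← Real.exp_add]; congr 2; ring
          _ ≤ c * 1 := by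
            gcongr
            rw [Real.exp_le_one_iff]; nlinarith [ht.1]
          _ = c := mul_one c

end FiniteCumulant

/-! ### Large deviations from convergence of scaled cumulant generating functions. -/

section LargeDeviation

theorem tangent_le_of_convexOn {f : ℝ → ℝ} (hf : ConvexOn ℝ Set.univ f) {d t : ℝ}
    (hd : HasDerivAt f d t) (u : ℝ) : f t + (u - t) * d ≤ f u := by
  rcases lt_trichotomy u t with hu | rfl | hu
  · have := hf.slope_le_of_hasDerivAt (Set.mem_univ _) (Set.mem_univ _) hu hd
    rw [slope_def_field, div_le_iff₀ (by linarith)] at this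
    linarith
  · simp
  · have := hf.le_slope_of_hasDerivAt (Set.mem_univ _) (Set.mem_univ _) hu hd
    rw [slope_def_field, le_div_iff₀ (by linarith)] at this
    linarith

/-- Derivatives of convex functions converging pointwise converge to the derivative of the limit. -/
theorem tendsto_deriv_of_convex {f : ℕ → ℝ → ℝ} {f' : ℕ → ℝ} {g : ℝ → ℝ} {g' x : ℝ}
    (hf : ∀ᶠ n in atTop, ConvexOn ℝ Set.univ (f n)) (hf' : ∀ᶠ n in atTop, HasDerivAt (f n) (f' n) x)
    (hlim : ∀ y, Tendsto (fun n => f n y) atTop (𝓝 (g y))) (hg : HasDerivAt g g' x) :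
    Tendsto f' atTop (𝓝 g') := by
  have hs := hasDerivAt_iff_tendsto_slope.1 hg
  refine tendsto_order.2 ⟨fun a ha => ?_, fun a ha => ?_⟩
  -- A point `y < x` is fixed first, near enough to `x` that the chord of `g` has slope above `a`.
  -- The chord slopes of `f n` over the same interval converge to it, and convexity places them
  -- below `f' n`.
  · have h1 : ∀ᶠ y in 𝓝[<] x, a < slope g x y :=
      (hs.mono_left (nhdsWithin_mono _ fun y hy => ne_of_lt hy)).eventually_const_lt ha
    obtain ⟨y, hy, hyx⟩ := (h1.and self_mem_nhdsWithin).exists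
    have h2 : Tendsto (fun n => slope (f n) x y) atTop (𝓝 (slope g x y)) := by
      simp only [slope_def_field]
      exact ((hlim y).sub (hlim x)).div_const _
    filter_upwards [hf, hf', h2.eventually_const_lt hy] with n h3 h4 h5
    refine h5.trans_le ?_
    rw [slope_comm]
    exact h3.slope_le_of_hasDerivAt (Set.mem_univ _) (Set.mem_univ _) hyx h4
  · have h1 : ∀ᶠ y in 𝓝[>] x, slope g x y < a :=
      (hs.mono_left (nhdsWithin_mono _ fun y hy => ne_of_gt hy)).eventually_lt_const ha
    obtain ⟨y, hy, hyx⟩ := (h1.and self_mem_nhdsWithin).exists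
    have h2 : Tendsto (fun n => slope (f n) x y) atTop (𝓝 (slope g x y)) := by
      simp only [slope_def_field]
      exact ((hlim y).sub (hlim x)).div_const _
    filter_upwards [hf, hf', h2.eventually_lt_const hy] with n h3 h4 h5
    exact (h3.le_slope_of_hasDerivAt (Set.mem_univ _) (Set.mem_univ _) hyx h4).trans_lt h5

theorem convexOn_of_tendsto {f : ℕ → ℝ → ℝ} {g : ℝ → ℝ}
    (hf : ∀ᶠ n in atTop, ConvexOn ℝ Set.univ (f n))
    (hlim : ∀ y, Tendsto (fun n => f n y) atTop (𝓝 (g y))) : ConvexOn ℝ Set.univ g := by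
  refine ⟨convex_univ, fun x _ y _ a b ha hb hab => ?_⟩
  refine le_of_tendsto_of_tendsto (hlim _)
    (((hlim x).const_smul a).add ((hlim y).const_smul b)) ?_
  filter_upwards [hf] with n hn
  exact hn.2 (Set.mem_univ x) (Set.mem_univ y) ha hb hab

variable {Ω : ℕ → Type*} [∀ n, Fintype (Ω n)] {v L : ∀ n, Ω n → ℝ} {N : ℕ → ℝ} {ψ : ℝ → ℝ}

/-- Exponential upper tail bound for `expMoment` ratios. -/
theorem eventually_exp_mul_expMoment_le (hv : ∀ n i, 0 ≤ v n i) (hs : ∀ n, 0 < ∑ i, v n i)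
    (hN : Tendsto N atTop atTop)
    (hψ : ∀ t, Tendsto (fun n => 1 / N n * Real.log (expMoment (v n) (L n) t)) atTop (𝓝 (ψ t)))
    {t u k : ℝ} (hk : k + ψ u < ψ t) :
    ∀ᶠ n in atTop, Real.exp (N n * k) * expMoment (v n) (L n) u ≤ 1 / 4 * expMoment (v n) (L n) t := by
  -- Up to a constant, the logarithm of the ratio of the two sides is `N n` times a quantity with
  -- negative limit. The factor `1 / 4` is chosen so that two such tails take away at most half of
  -- the moment.
  have h1 : Tendsto (fun n => k + 1 / N n * Real.log (expMoment (v n) (L n) u) -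
      1 / N n * Real.log (expMoment (v n) (L n) t)) atTop (𝓝 (k + ψ u - ψ t)) :=
    ((hψ u).const_add k).sub (hψ t)
  have h2 := h1.neg_mul_atTop (sub_neg.2 hk) hN
  filter_upwards [h2.eventually_le_atBot (Real.log (1 / 4)), hN.eventually_gt_atTop 0] with n hn hn0
  have hu := expMoment_pos (L := L n) (hv n) (hs n) u
  have ht := expMoment_pos (L := L n) (hv n) (hs n) t
  rw [← Real.log_le_log_iff (by positivity) (by positivity), Real.log_mul (by positivity) hu.ne',
    Real.log_mul (by positivity) ht.ne', Real.log_exp]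
  have : (k + 1 / N n * Real.log (expMoment (v n) (L n) u) -
      1 / N n * Real.log (expMoment (v n) (L n) t)) * N n = N n * k +
      Real.log (expMoment (v n) (L n) u) - Real.log (expMoment (v n) (L n) t) := by
    field_simp
  linarith

/-- Under the law tilted by `e^(tL)` the ratio `L / N` concentrates at `d = ψ'(t)`. For `L` near `N
d`, the truncated exponential is `e^(tL)` times roughly `exp(N min((1-t)d, θ - t d))`, while the
total mass of `e^(tL)` is roughly `e^(Nψ(t))`. -/
theorem eventually_le_truncMoment (hv : ∀ n i, 0 ≤ v n i) (hs : ∀ n, 0 < ∑ i, v n i)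
    (hN : Tendsto N atTop atTop)
    (hψ : ∀ t, Tendsto (fun n => 1 / N n * Real.log (expMoment (v n) (L n) t)) atTop (𝓝 (ψ t)))
    {t d : ℝ} (ht : t ∈ Set.Icc (0 : ℝ) 1) (hd : HasDerivAt ψ d t) (θ : ℝ) {ε : ℝ} (hε : 0 < ε) :
    ∀ᶠ n in atTop, Real.exp (N n * (ψ t + min ((1 - t) * d) (θ - t * d) - ε)) ≤
      truncMoment (v n) (L n) (Real.exp (N n * θ)) := by
  -- One third each for the width of the window around `d`, for the factor `1/2` left after removing
  -- the tails, and for the convergence of the scaled logarithm at `t`.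
  set δ := ε / 3 with hδ
  have hδ0 : 0 < δ := by positivity
  have hsl := hasDerivAt_iff_tendsto_slope.1 hd
  -- Differentiability at `t` yields a single `h` for which the exponents of both tail estimates lie
  -- strictly below `ψ t`.
  have hup : ∃ h > 0, ψ (t + h) - ψ t < h * (d + δ) ∧ ψ (t - h) - ψ t < - h * (d - δ) := by
    have h0 : Tendsto (fun h : ℝ => t + h) (𝓝[>] 0) (𝓝[≠] t) := by
      refine tendsto_nhdsWithin_iff.2 ⟨?_, ?_⟩
      · have : Tendsto (fun h : ℝ => t + h) (𝓝 0) (𝓝 (t + 0)) := (continuous_const_add t).tendsto 0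
        rw [add_zero] at this
        exact this.mono_left nhdsWithin_le_nhds
      · filter_upwards [self_mem_nhdsWithin] with h hh
        simpa using (ne_of_gt hh)
    have h0' : Tendsto (fun h : ℝ => t - h) (𝓝[>] 0) (𝓝[≠] t) := by
      refine tendsto_nhdsWithin_iff.2 ⟨?_, ?_⟩
      · have : Tendsto (fun h : ℝ => t - h) (𝓝 0) (𝓝 (t - 0)) := (continuous_sub_left t).tendsto 0
        rw [sub_zero] at this
        exact this.mono_left nhdsWithin_le_nhds
      · filter_upwards [self_mem_nhdsWithin] with h hh
        simpa using (ne_of_gt hh)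
    have h1 := (hsl.comp h0).eventually_lt_const (show d < d + δ by linarith)
    have h2 := (hsl.comp h0').eventually_const_lt (show d - δ < d by linarith)
    obtain ⟨h, ⟨h3, h4⟩, h5⟩ := ((h1.and h2).and self_mem_nhdsWithin).exists
    have h5' : 0 < h := h5
    simp only [Function.comp, slope_def_field] at h3 h4
    refine ⟨h, h5', ?_, ?_⟩
    · rw [div_lt_iff₀ (by linarith)] at h3; linarith
    · rw [show t - h - t = -h by ring, lt_div_iff_of_neg (by linarith)] at h4; linarith
  obtain ⟨h, hh, hp, hm⟩ := hup
  have a1 := eventually_exp_mul_expMoment_le hv hs hN hψ (t := t) (u := t + h) (k := -h * (d + δ))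
    (by linarith)
  have a2 := eventually_exp_mul_expMoment_le hv hs hN hψ (t := t) (u := t - h) (k := h * (d - δ))
    (by linarith)
  have a3 := (hψ t).eventually_const_lt (show ψ t - δ < ψ t by linarith)
  have a4 := (hN.atTop_mul_const hδ0).eventually_ge_atTop (Real.log 2)
  filter_upwards [a1, a2, a3, a4, hN.eventually_gt_atTop 0] with n b1 b2 b3 b4 hn0
  have key := le_truncMoment (L := L n) (hv n) (Real.exp_pos (N n * θ)) ht hh (N n * (d - δ))
    (N n * (d + δ))
  refine le_trans ?_ key
  have hZ := expMoment_pos (L := L n) (hv n) (hs n) t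
  have hZ' : Real.exp (N n * (ψ t - δ)) ≤ expMoment (v n) (L n) t := by
    rw [← Real.le_log_iff_exp_le hZ]
    rw [one_div, lt_inv_mul_iff₀ hn0] at b3
    exact b3.le
  have hhalf : Real.exp (-(N n * δ)) ≤ 1 / 2 := by
    rw [← Real.le_log_iff_exp_le (by norm_num), one_div, Real.log_inv]; linarith
  have hmin : Real.exp (N n * (min ((1 - t) * d) (θ - t * d) - δ)) ≤
      min (Real.exp ((1 - t) * (N n * (d - δ)))) (Real.exp (N n * θ) * Real.exp (-t * (N n * (d + δ)))) := by
    rw [← Real.exp_add]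
    refine le_min (Real.exp_le_exp.2 ?_) (Real.exp_le_exp.2 ?_)
    · have := min_le_left ((1 - t) * d) (θ - t * d)
      calc _ ≤ N n * ((1 - t) * d - δ) := by gcongr
        _ ≤ N n * ((1 - t) * (d - δ)) := by gcongr; nlinarith [ht.1]
        _ = _ := by ring
    · have := min_le_right ((1 - t) * d) (θ - t * d)
      calc _ ≤ N n * (θ - t * d - δ) := by gcongr
        _ ≤ N n * (θ - t * (d + δ)) :=
          mul_le_mul_of_nonneg_left (by nlinarith [ht.2]) hn0.le
        _ = _ := by ring
  have hlow : Real.exp (-(N n * δ)) * Real.exp (N n * (ψ t - δ)) ≤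
      expMoment (v n) (L n) t - Real.exp (-h * (N n * (d + δ))) * expMoment (v n) (L n) (t + h) -
        Real.exp (h * (N n * (d - δ))) * expMoment (v n) (L n) (t - h) := by
    rw [show N n * (-h * (d + δ)) = -h * (N n * (d + δ)) by ring] at b1
    rw [show N n * (h * (d - δ)) = h * (N n * (d - δ)) by ring] at b2
    have : Real.exp (-(N n * δ)) * Real.exp (N n * (ψ t - δ)) ≤ 1 / 2 * expMoment (v n) (L n) t := by
      gcongr
    linarith
  calc _ = Real.exp (N n * (min ((1 - t) * d) (θ - t * d) - δ)) *
        (Real.exp (-(N n * δ)) * Real.exp (N n * (ψ t - δ))) := by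
        rw [← Real.exp_add, ← Real.exp_add]; congr 1; rw [hδ]; ring
    _ ≤ _ := mul_le_mul hmin hlow (by positivity) (by positivity)

end LargeDeviation

/-! ### The classical model of a pair of densities and its consequences. -/

section ClassicalModel

variable {ι : Type*} [Fintype ι] [DecidableEq ι]

/-- The Nussbaum–Szkoła classical model of a pair of densities: a probability vector `v` and
log-likelihood ratios `L`. -/
theorem exists_classical_model {A B : Matrix ι ι ℂ} (hA : A.PosDef) (hB : B.PosDef)
    (hA1 : A.trace = 1) (hB1 : B.trace = 1) :
    ∃ v L : ι × ι → ℝ, (∀ i, 0 ≤ v i) ∧ ∑ i, v i = 1 ∧ expMoment v L 1 = 1 ∧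
      (∀ t, logOverlap A B t = Real.log (expMoment v L t)) ∧
      relEntropy A B = ∑ i, v i * (Real.exp (1 * L i) * L i) ∧
      (∀ T : Matrix ι ι ℂ, T.PosSemidef → (1 - T).PosSemidef → ∀ c : ℝ, 0 ≤ c →
        1 / 2 * truncMoment v L c ≤ errorFirst A T + c * errorSecond B T) ∧
      ∀ t, (mpow A t * mpow B (1 - t)).trace.re = expMoment v L t := by
  set l := hA.1.eigenvalues with hl
  set m := hB.1.eigenvalues with hm
  have hl0 : ∀ i, 0 < l i := hA.eigenvalues_pos
  have hm0 : ∀ i, 0 < m i := hB.eigenvalues_pos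
  -- The weights `v` are the law of the pair of indices under the alternative, and `e^L v` is its
  -- law under the null hypothesis. Tilting by `t` interpolates between the two.
  have hexp : ∀ i j t, m j * Real.exp (t * (Real.log (l i) - Real.log (m j))) =
      l i ^ t * m j ^ (1 - t) := fun i j t => by
    conv_lhs => rw [← Real.exp_log (hm0 j)]
    rw [Real.rpow_def_of_pos (hl0 i), Real.rpow_def_of_pos (hm0 j), ← Real.exp_add,
      ← Real.exp_add, Real.exp_log (hm0 j)]
    congr 1; ring
  have hexp1 : ∀ i j, m j * Real.exp (Real.log (l i) - Real.log (m j)) = l i := fun i j => by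
    have := hexp i j 1
    simpa [errorFirst, errorSecond] using this
  have htrace : ∀ t, (mpow A t * mpow B (1 - t)).trace.re =
      expMoment (fun p : ι × ι => overlapWeight hA.1 hB.1 p.1 p.2 * m p.2)
        (fun p => Real.log (l p.1) - Real.log (m p.2)) t := fun t => by
    simp only [expMoment, mul_assoc, hexp]
    rw [Fintype.sum_prod_type, trace_mpow_mul_mpow hA hB]
  refine ⟨fun p => overlapWeight hA.1 hB.1 p.1 p.2 * m p.2,
    fun p => Real.log (l p.1) - Real.log (m p.2), fun p =>
      mul_nonneg (overlapWeight_nonneg _ _ _ _) (hm0 _).le, ?_, ?_,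
      fun t => by rw [logOverlap, htrace], ?_, ?_, htrace⟩
  · rw [Fintype.sum_prod_type, Finset.sum_comm]
    simp only [← Finset.sum_mul, sum_overlapWeight_left, one_mul]
    exact sum_eigenvalues_eq_one hB.1 hB1
  · simp only [expMoment, mul_assoc, hexp]
    rw [Fintype.sum_prod_type]
    simp only [Real.rpow_one, sub_self, Real.rpow_zero, mul_one, ← Finset.sum_mul,
      sum_overlapWeight_right, one_mul]
    exact sum_eigenvalues_eq_one hA.1 hA1
  · rw [relEntropy_eq hA hB, Fintype.sum_prod_type]
    refine Finset.sum_congr rfl fun i _ => Finset.sum_congr rfl fun j _ => ?_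
    dsimp only
    rw [← hl, ← hm, one_mul, ← mul_assoc, ← mul_assoc, mul_assoc _ (m j), hexp1 i j]
  · intro T hT hT' c hc
    refine le_trans (le_of_eq ?_) (half_sum_min_le_error hA.posSemidef hB.posSemidef hT hT' hc)
    rw [truncMoment, Fintype.sum_prod_type]
    congr 1
    refine Finset.sum_congr rfl fun i _ => Finset.sum_congr rfl fun j _ => ?_
    dsimp only
    rw [mul_assoc, mul_min_of_nonneg _ _ (hm0 j).le, hexp1 i j, mul_comm (m j) c]

/-- For `L ≤ y` only `e^L L ≥ -1` is needed; for `L ≥ y` one has `e^L L ≥ y e^L`. In the mean, the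
relative entropy is at least `y` times the part of the mass that truncation at `e^y` cuts off, minus
`1`. -/
theorem mul_le_exp_mul_self_add {L y : ℝ} (hy : 0 ≤ y) :
    y * (Real.exp L - min (Real.exp L) (Real.exp y)) - 1 ≤ Real.exp L * L := by
  have h0 : -1 ≤ Real.exp L * L := by
    have h1 := Real.add_one_le_exp (-L)
    rw [Real.exp_neg] at h1
    have h2 : 0 < Real.exp L := Real.exp_pos L
    have h3 : -L ≤ (Real.exp L)⁻¹ := by linarith
    have h4 : Real.exp L * -L ≤ 1 := by
      calc Real.exp L * -L ≤ Real.exp L * (Real.exp L)⁻¹ := by gcongr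
        _ = 1 := mul_inv_cancel₀ h2.ne'
    linarith
  rcases le_total L y with h | h
  · rw [min_eq_left (Real.exp_le_exp.2 h), sub_self, mul_zero]; linarith
  · rw [min_eq_right (Real.exp_le_exp.2 h)]
    nlinarith [Real.exp_pos L, Real.exp_pos y, mul_nonneg hy (Real.exp_pos y).le,
      mul_le_mul_of_nonneg_left h (Real.exp_pos L).le]

/-- A lower bound of the relative entropy in terms of the errors of a test. -/
theorem le_relEntropy_of_test {A B : Matrix ι ι ℂ} (hA : A.PosDef) (hB : B.PosDef)
    (hA1 : A.trace = 1) (hB1 : B.trace = 1) {T : Matrix ι ι ℂ} (hT : T.PosSemidef)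
    (hT' : (1 - T).PosSemidef) {y : ℝ} (hy : 0 ≤ y) :
    y * (1 - 2 * (errorFirst A T + Real.exp y * errorSecond B T)) - 1 ≤ relEntropy A B := by
  obtain ⟨v, L, hv, hv1, hL1, -, hrel, htr, -⟩ := exists_classical_model hA hB hA1 hB1
  have h1 := htr T hT hT' _ (Real.exp_pos y).le
  have h2 : y * (1 - truncMoment v L (Real.exp y)) - 1 ≤ relEntropy A B := by
    rw [hrel]
    have e : y * (1 - truncMoment v L (Real.exp y)) - 1 =
        ∑ i, v i * (y * (Real.exp (L i) - min (Real.exp (L i)) (Real.exp y)) - 1) := by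
      have : ∀ i, v i * (y * (Real.exp (L i) - min (Real.exp (L i)) (Real.exp y)) - 1) =
          y * (v i * Real.exp (1 * L i)) - y * (v i * min (Real.exp (L i)) (Real.exp y)) - v i :=
        fun i => by rw [one_mul]; ring
      simp only [this, Finset.sum_sub_distrib, ← Finset.mul_sum]
      rw [hv1, ← expMoment, hL1, truncMoment]
      ring
    rw [e]
    refine Finset.sum_le_sum fun i _ => mul_le_mul_of_nonneg_left ?_ (hv i)
    rw [one_mul]
    exact mul_le_exp_mul_self_add hy
  refine le_trans ?_ h2
  have := mul_le_mul_of_nonneg_left h1 hy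
  linarith

theorem convexOn_logOverlap {A B : Matrix ι ι ℂ} (hA : A.PosDef) (hB : B.PosDef)
    (hA1 : A.trace = 1) (hB1 : B.trace = 1) : ConvexOn ℝ Set.univ (logOverlap A B) := by
  obtain ⟨v, L, hv, hv1, -, hlog, -, -⟩ := exists_classical_model hA hB hA1 hB1
  rw [show logOverlap A B = _ from funext hlog]
  exact convexOn_log_expMoment hv (hv1 ▸ one_pos)

theorem logOverlap_zero {A B : Matrix ι ι ℂ} (hA : A.PosDef) (hB : B.PosDef)
    (hA1 : A.trace = 1) (hB1 : B.trace = 1) : logOverlap A B 0 = 0 := by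
  obtain ⟨v, L, hv, hv1, -, hlog, -, -⟩ := exists_classical_model hA hB hA1 hB1
  rw [hlog, expMoment_zero, hv1, Real.log_one]

theorem logOverlap_one {A B : Matrix ι ι ℂ} (hA : A.PosDef) (hB : B.PosDef)
    (hA1 : A.trace = 1) (hB1 : B.trace = 1) : logOverlap A B 1 = 0 := by
  obtain ⟨v, L, hv, hv1, h1, hlog, -, -⟩ := exists_classical_model hA hB hA1 hB1
  rw [hlog, h1, Real.log_one]

/-- The derivative of a log moment is the mean of `L` under the tilted law. At `1` that law is `e^L
v`, of total mass `1`, and the mean is the relative entropy. -/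
theorem hasDerivAt_logOverlap_one {A B : Matrix ι ι ℂ} (hA : A.PosDef) (hB : B.PosDef)
    (hA1 : A.trace = 1) (hB1 : B.trace = 1) :
    HasDerivAt (logOverlap A B) (relEntropy A B) 1 := by
  obtain ⟨v, L, hv, hv1, h1, hlog, hrel, -⟩ := exists_classical_model hA hB hA1 hB1
  rw [show logOverlap A B = _ from funext hlog, hrel]
  simpa [h1] using hasDerivAt_log_expMoment (L := L) hv (hv1 ▸ one_pos) 1

theorem differentiable_logOverlap {A B : Matrix ι ι ℂ} (hA : A.PosDef) (hB : B.PosDef)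
    (hA1 : A.trace = 1) (hB1 : B.trace = 1) : Differentiable ℝ (logOverlap A B) := by
  obtain ⟨v, L, hv, hv1, h1, hlog, hrel, -⟩ := exists_classical_model hA hB hA1 hB1
  rw [show logOverlap A B = _ from funext hlog]
  exact fun t => (hasDerivAt_log_expMoment (L := L) hv (hv1 ▸ one_pos) t).differentiableAt

theorem mpow_smul {B : Matrix ι ι ℂ} (hB : B.PosDef) {c : ℝ} (hc : 0 < c) (s : ℝ) :
    mpow (c • B) s = c ^ s • mpow B s := by
  have hcont : ∀ f : ℝ → ℝ, ContinuousOn f (spectrum ℝ B) := fun f =>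
    (Matrix.finite_real_spectrum (A := B)).continuousOn f
  have hB' : IsSelfAdjoint B := hB.1
  rw [mpow, mpow, ← cfc_comp_smul c _ B (((Matrix.finite_real_spectrum (A := B)).image _).continuousOn _),
    ← cfc_smul _ _ B (hcont _)]
  refine cfc_congr fun x hx => ?_
  have hx0 : 0 < x := by
    obtain ⟨i, rfl⟩ := hB.1.spectrum_real_eq_range_eigenvalues ▸ hx
    exact hB.eigenvalues_pos i
  simp only [smul_eq_mul]
  rw [if_neg (mul_pos hc hx0).ne', if_neg hx0.ne', Real.mul_rpow hc.le hx0.le]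

/-- The Audenaert inequality for weighted errors. -/
theorem exists_test_weighted_error_le {A B : Matrix ι ι ℂ} (hA : A.PosDef) (hB : B.PosDef)
    (hA1 : A.trace = 1) (hB1 : B.trace = 1) (x : ℝ) :
    ∃ T : Matrix ι ι ℂ, T.PosSemidef ∧ (1 - T).PosSemidef ∧ ∀ t ∈ Set.Icc (0 : ℝ) 1,
      errorFirst A T + Real.exp x * errorSecond B T ≤
        Real.exp (x * (1 - t) + logOverlap A B t) := by
  -- The weight is absorbed into the second matrix: the Audenaert inequality does not require trace
  -- one, and is applied to `A` and `e^x B`.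
  obtain ⟨T, hT, hT', h⟩ := exists_test_error_le hA (hB.smul (Real.exp_pos x))
  refine ⟨T, hT, hT', fun t ht => ?_⟩
  obtain ⟨v, L, hv, hv1, -, hlog, -, -, htrace⟩ := exists_classical_model hA hB hA1 hB1
  have e1 : errorSecond (Real.exp x • B) T = Real.exp x * errorSecond B T := by
    rw [errorSecond, errorSecond, Matrix.smul_mul, Matrix.trace_smul, Complex.smul_re, smul_eq_mul]
  have e2 : (mpow A t * mpow B (1 - t)).trace.re = Real.exp (logOverlap A B t) := by
    rw [hlog, htrace, Real.exp_log (expMoment_pos hv (hv1 ▸ one_pos) t)]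
  have h2 := h t ht
  rw [e1, mpow_smul hB (Real.exp_pos x), Matrix.mul_smul, Matrix.trace_smul, Complex.smul_re,
    smul_eq_mul, e2, ← Real.exp_mul, ← Real.exp_add] at h2
  exact h2

theorem errorFirst_nonneg {A T : Matrix ι ι ℂ} (hA : A.PosSemidef) (hT' : (1 - T).PosSemidef) :
    0 ≤ errorFirst A T := by
  open scoped Matrix.Norms.L2Operator MatrixOrder in
  have := trace_mul_re_le hA.nonneg hT'.nonneg
  simpa [errorFirst, errorSecond] using this

theorem errorSecond_nonneg {B T : Matrix ι ι ℂ} (hB : B.PosSemidef) (hT : T.PosSemidef) :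
    0 ≤ errorSecond B T := by
  open scoped Matrix.Norms.L2Operator MatrixOrder in
  have := trace_mul_re_le hB.nonneg hT.nonneg
  simpa [errorFirst, errorSecond] using this

end ClassicalModel

/-! ### Scaled logarithms and suprema of exponents. -/

section ScaledLog

theorem scaledLog_of_nonpos {ν n : ℕ} (hn : 0 < n) {p : ℝ} (hp : p ≤ 0) : scaledLog ν n p = ⊥ := by
  rw [scaledLog, logE, ENNReal.log_ofReal, if_pos hp, EReal.coe_mul_bot_of_pos (by positivity)]

theorem scaledLog_of_pos {ν n : ℕ} {p : ℝ} (hp : 0 < p) :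
    scaledLog ν n p = ((1 / (n : ℝ) ^ ν * Real.log p : ℝ) : EReal) := by
  rw [scaledLog, logE, ENNReal.log_ofReal, if_neg (not_le.2 hp), EReal.coe_mul]

theorem scaledLog_le {ν n : ℕ} (hn : 0 < n) {p x : ℝ} (h : p ≤ Real.exp ((n : ℝ) ^ ν * x)) :
    scaledLog ν n p ≤ x := by
  rcases le_or_gt p 0 with hp | hp
  · rw [scaledLog_of_nonpos hn hp]; exact bot_le
  · rw [scaledLog_of_pos hp, EReal.coe_le_coe_iff, one_div, inv_mul_le_iff₀ (by positivity)]
    exact (Real.log_le_iff_le_exp hp).2 h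

theorem le_scaledLog {ν n : ℕ} (hn : 0 < n) {p x : ℝ} (h : Real.exp ((n : ℝ) ^ ν * x) ≤ p) :
    (x : EReal) ≤ scaledLog ν n p := by
  have hp : 0 < p := (Real.exp_pos _).trans_le h
  rw [scaledLog_of_pos hp, EReal.coe_le_coe_iff, one_div, le_inv_mul_iff₀ (by positivity)]
  exact (Real.le_log_iff_exp_le hp).2 h

theorem tendsto_natCast_pow_atTop {ν : ℕ} (hν : 0 < ν) :
    Tendsto (fun n : ℕ => (n : ℝ) ^ ν) atTop atTop :=
  (tendsto_pow_atTop hν.ne').comp tendsto_natCast_atTop_atTop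

/-- Optimal exponents coincide for limits, lower limits and upper limits. -/
theorem optimal_exponents_eq {τ : Type*} {adm : τ → Prop} {rate : τ → ℕ → EReal} {H : ℝ}
    (hup : ∀ T, adm T → ∀ x : ℝ, H < x → ∀ᶠ n in atTop, rate T n ≤ x)
    (hlow : ∀ r : ℝ, r < H → ∃ T, adm T ∧ ∃ L : EReal, r ≤ L ∧ Tendsto (rate T) atTop (𝓝 L)) :
    sSup {L | ∃ T, adm T ∧ Tendsto (rate T) atTop (𝓝 L)} = (H : EReal) ∧
    sSup {L | ∃ T, adm T ∧ liminf (rate T) atTop = L} = (H : EReal) ∧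
    sSup {L | ∃ T, adm T ∧ limsup (rate T) atTop = L} = (H : EReal) := by
  have h1 : ∀ T, adm T → limsup (rate T) atTop ≤ (H : EReal) := fun T hT => by
    refine EReal.le_of_forall_lt_iff_le.1 fun z hz => ?_
    exact limsup_le_of_le (by isBoundedDefault) (hup T hT z (EReal.coe_lt_coe_iff.1 hz))
  -- Each of the three sets is bounded by `H` and contains the limits of all convergent admissible
  -- rates. These two properties determine the supremum.
  have h2 : ∀ S : Set EReal, (∀ L ∈ S, L ≤ (H : EReal)) →
      (∀ T L, adm T → Tendsto (rate T) atTop (𝓝 L) → L ∈ S) → sSup S = (H : EReal) := by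
    intro S hS1 hS2
    refine le_antisymm (sSup_le hS1) (EReal.ge_of_forall_gt_iff_ge.1 fun z hz => ?_)
    obtain ⟨T, hT, L, hL, hlim⟩ := hlow z (EReal.coe_lt_coe_iff.1 hz)
    exact hL.trans (le_sSup (hS2 T L hT hlim))
  refine ⟨h2 _ ?_ fun T L hT hL => ⟨T, hT, hL⟩, h2 _ ?_ fun T L hT hL => ⟨T, hT, hL.liminf_eq⟩,
    h2 _ ?_ fun T L hT hL => ⟨T, hT, hL.limsup_eq⟩⟩
  · rintro L ⟨T, hT, hL⟩
    exact hL.limsup_eq ▸ h1 T hT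
  · rintro L ⟨T, hT, rfl⟩
    exact (liminf_le_limsup (by isBoundedDefault) (by isBoundedDefault)).trans (h1 T hT)
  · rintro L ⟨T, hT, rfl⟩
    exact h1 T hT

end ScaledLog

/-! ### Error exponents for a differentiable limiting overlap function. -/

section Asymptotics

variable {J : ℕ → Type*} [∀ n, Fintype (J n)] [∀ n, DecidableEq (J n)]

/-- Sequences of densities whose logarithmic overlaps converge, after scaling with `n^{-ν}`, to a
differentiable function. -/
structure OverlapAsymptotics (ν : ℕ) (ρ σ : ∀ n, Matrix (J n) (J n) ℂ) (ψ : ℝ → ℝ) : Prop where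
  dim_pos : 0 < ν
  posDef_left : ∀ n, (ρ n).PosDef
  posDef_right : ∀ n, (σ n).PosDef
  trace_left : ∀ n, (ρ n).trace = 1
  trace_right : ∀ n, (σ n).trace = 1
  tendsto_overlap : ∀ t, Tendsto (fun n : ℕ => 1 / (n : ℝ) ^ ν * logOverlap (ρ n) (σ n) t) atTop
    (𝓝 (ψ t))
  differentiable : Differentiable ℝ ψ

namespace OverlapAsymptotics

variable {ν : ℕ} {ρ σ : ∀ n, Matrix (J n) (J n) ℂ} {ψ : ℝ → ℝ}

theorem convexOn_scaled (h : OverlapAsymptotics ν ρ σ ψ) (n : ℕ) :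
    ConvexOn ℝ Set.univ fun t => 1 / (n : ℝ) ^ ν * logOverlap (ρ n) (σ n) t :=
  (convexOn_logOverlap (h.posDef_left n) (h.posDef_right n) (h.trace_left n)
    (h.trace_right n)).smul (c := 1 / (n : ℝ) ^ ν) (by positivity)

theorem convexOn (h : OverlapAsymptotics ν ρ σ ψ) : ConvexOn ℝ Set.univ ψ :=
  convexOn_of_tendsto (Eventually.of_forall h.convexOn_scaled) h.tendsto_overlap

theorem zero (h : OverlapAsymptotics ν ρ σ ψ) : ψ 0 = 0 :=
  tendsto_nhds_unique (h.tendsto_overlap 0) (by simp [fun n => logOverlap_zero (h.posDef_left n)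
    (h.posDef_right n) (h.trace_left n) (h.trace_right n)])

theorem one (h : OverlapAsymptotics ν ρ σ ψ) : ψ 1 = 0 :=
  tendsto_nhds_unique (h.tendsto_overlap 1) (by simp [fun n => logOverlap_one (h.posDef_left n)
    (h.posDef_right n) (h.trace_left n) (h.trace_right n)])

theorem tendsto_deriv (h : OverlapAsymptotics ν ρ σ ψ) (t : ℝ) :
    Tendsto (fun n : ℕ => 1 / (n : ℝ) ^ ν * deriv (logOverlap (ρ n) (σ n)) t) atTop
      (𝓝 (deriv ψ t)) :=
  tendsto_deriv_of_convex (Eventually.of_forall h.convexOn_scaled)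
    (Eventually.of_forall fun n => ((differentiable_logOverlap (h.posDef_left n)
      (h.posDef_right n) (h.trace_left n) (h.trace_right n)) t).hasDerivAt.const_mul _)
    h.tendsto_overlap (h.differentiable t).hasDerivAt

theorem hasMeanRelEntropy (h : OverlapAsymptotics ν ρ σ ψ) :
    HasMeanRelEntropy ν ρ σ (deriv ψ 1) := by
  have := h.tendsto_deriv 1
  simp only [fun n => (hasDerivAt_logOverlap_one (h.posDef_left n) (h.posDef_right n)
    (h.trace_left n) (h.trace_right n)).deriv] at this
  exact this

/-- The tangent of `ψ` at `t` lies below `ψ`. -/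
theorem tangent_le (h : OverlapAsymptotics ν ρ σ ψ) (t u : ℝ) :
    ψ t + (u - t) * deriv ψ t ≤ ψ u :=
  tangent_le_of_convexOn h.convexOn (h.differentiable t).hasDerivAt u

theorem deriv_one_nonneg (h : OverlapAsymptotics ν ρ σ ψ) : 0 ≤ deriv ψ 1 := by
  have := h.tangent_le 1 0
  rw [h.one, h.zero] at this
  linarith

/-- The lower bound on weighted errors of arbitrary tests. -/
theorem eventually_le_error (h : OverlapAsymptotics ν ρ σ ψ) {T : ∀ n, Matrix (J n) (J n) ℂ}
    (hT : IsTestSeq T) {t : ℝ} (ht : t ∈ Set.Icc (0 : ℝ) 1) (θ : ℝ) {ε : ℝ} (hε : 0 < ε) :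
    ∀ᶠ n : ℕ in atTop, 1 / 2 * Real.exp ((n : ℝ) ^ ν *
      (ψ t + min ((1 - t) * deriv ψ t) (θ - t * deriv ψ t) - ε)) ≤
      errorFirst (ρ n) (T n) + Real.exp ((n : ℝ) ^ ν * θ) * errorSecond (σ n) (T n) := by
  choose v L hv hv1 h1 hlog hrel htr htrace using fun n => exists_classical_model (h.posDef_left n)
    (h.posDef_right n) (h.trace_left n) (h.trace_right n)
  have hψ := h.tendsto_overlap
  simp only [hlog] at hψ
  filter_upwards [eventually_le_truncMoment hv (fun n => (hv1 n).symm ▸ one_pos)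
    (tendsto_natCast_pow_atTop h.dim_pos) hψ ht (h.differentiable t).hasDerivAt θ hε] with n hn
  exact le_trans (by gcongr) (htr n (T n) (hT n).1 (hT n).2 _ (Real.exp_pos _).le)

/-- At a stationary point the moment truncated at `1` already has exponent `ψ t`, and by
`truncMoment_le` it lies below the moments at all `u` in `[0, 1]`. The lower bound is thus uniform
in `u`, although only pointwise convergence is assumed. -/
theorem eventually_le_overlap (h : OverlapAsymptotics ν ρ σ ψ)
    {t : ℝ} (ht : t ∈ Set.Icc (0 : ℝ) 1) (hd : deriv ψ t = 0) {ε : ℝ} (hε : 0 < ε) :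
    ∀ᶠ n : ℕ in atTop, ∀ u ∈ Set.Icc (0 : ℝ) 1,
      (n : ℝ) ^ ν * (ψ t - ε) ≤ logOverlap (ρ n) (σ n) u := by
  choose v L hv hv1 h1 hlog hrel htr htrace using fun n => exists_classical_model (h.posDef_left n)
    (h.posDef_right n) (h.trace_left n) (h.trace_right n)
  have hψ := h.tendsto_overlap
  simp only [hlog] at hψ
  filter_upwards [eventually_le_truncMoment hv (fun n => (hv1 n).symm ▸ one_pos)
    (tendsto_natCast_pow_atTop h.dim_pos) hψ ht (h.differentiable t).hasDerivAt 0 hε]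
    with n hn u hu
  have hpos := expMoment_pos (L := L n) (hv n) ((hv1 n).symm ▸ one_pos) u
  rw [hlog, Real.le_log_iff_exp_le hpos]
  have h2 := truncMoment_le (L := L n) (hv n) (Real.exp_pos ((n : ℝ) ^ ν * 0)) hu
  rw [mul_zero, Real.exp_zero, Real.one_rpow, one_mul] at h2
  rw [mul_zero, Real.exp_zero, hd] at hn
  simpa using hn.trans h2

/-! ### The Chernoff bound -/

/-- Rolle's theorem applies because `ψ` vanishes at `0` and `1`. The tangent at the stationary point
is horizontal, and by convexity `ψ` lies above it. -/
theorem exists_interior_minimizer (h : OverlapAsymptotics ν ρ σ ψ) :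
    ∃ t ∈ Set.Icc (0 : ℝ) 1, deriv ψ t = 0 ∧ IsLeast (ψ '' Set.Icc 0 1) (ψ t) := by
  obtain ⟨t, ht, htd⟩ := exists_deriv_eq_zero (f := ψ) (a := 0) (b := 1) one_pos
    h.differentiable.continuous.continuousOn (h.zero.trans h.one.symm)
  refine ⟨t, Set.Ioo_subset_Icc_self ht, htd, ⟨t, Set.Ioo_subset_Icc_self ht, rfl⟩, ?_⟩
  rintro _ ⟨u, -, rfl⟩
  simpa [htd] using h.tangent_le t u

theorem hasMeanChernoff (h : OverlapAsymptotics ν ρ σ ψ) {t : ℝ} (ht : t ∈ Set.Icc (0 : ℝ) 1)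
    (hd : deriv ψ t = 0) : HasMeanChernoff ν ρ σ (-ψ t) := by
  have key : Tendsto (fun n : ℕ => 1 / (n : ℝ) ^ ν *
      sInf (logOverlap (ρ n) (σ n) '' Set.Icc 0 1)) atTop (𝓝 (ψ t)) := by
    have hbdd : ∀ n, BddBelow (logOverlap (ρ n) (σ n) '' Set.Icc 0 1) := fun n =>
      (isCompact_Icc.image_of_continuousOn (differentiable_logOverlap (h.posDef_left n)
        (h.posDef_right n) (h.trace_left n) (h.trace_right n)).continuous.continuousOn).bddBelow
    refine tendsto_order.2 ⟨fun a ha => ?_, fun a ha => ?_⟩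
    · filter_upwards [h.eventually_le_overlap ht hd (ε := (ψ t - a) / 2) (by linarith),
        eventually_gt_atTop 0] with n hn hn0
      have hpos : (0 : ℝ) < (n : ℝ) ^ ν := by positivity
      rw [one_div, lt_inv_mul_iff₀ hpos]
      refine lt_of_lt_of_le ?_ (le_csInf ⟨_, Set.mem_image_of_mem _ ht⟩
        (by rintro _ ⟨u, hu, rfl⟩; exact hn u hu))
      exact mul_lt_mul_of_pos_left (by linarith) hpos
    · filter_upwards [(h.tendsto_overlap t).eventually_lt_const ha] with n hn
      refine lt_of_le_of_lt (mul_le_mul_of_nonneg_left (csInf_le (hbdd n)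
        (Set.mem_image_of_mem _ ht)) (by positivity)) hn
  simpa only [HasMeanChernoff, chernoffBound, mul_neg] using key.neg

theorem eventually_half_exp_ge {N : ℕ → ℝ} (hN : Tendsto N atTop atTop) {c : ℝ} (hc : 0 < c)
    {ε : ℝ} (hε : 0 < ε) : ∀ᶠ n in atTop, Real.exp (-(N n * ε)) ≤ c := by
  filter_upwards [(hN.atTop_mul_const hε).eventually_ge_atTop (-Real.log c)] with n hn
  rw [← Real.le_log_iff_exp_le hc]; linarith

theorem chernoff_converse (h : OverlapAsymptotics ν ρ σ ψ) {t : ℝ} (ht : t ∈ Set.Icc (0 : ℝ) 1)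
    (hd : deriv ψ t = 0) {T : ∀ n, Matrix (J n) (J n) ℂ} (hT : IsTestSeq T) {x : ℝ}
    (hx : -ψ t < x) : ∀ᶠ n in atTop, chernoffRate ν ρ σ T n ≤ x := by
  set ε := (x + ψ t) / 2 with hε
  have hε0 : 0 < ε := by rw [hε]; linarith
  -- For `θ = 0` and `ψ'(t) = 0` both entries of the minimum vanish. One `ε` is spent on the error
  -- bound, the other absorbs the factor `1/2`.
  filter_upwards [h.eventually_le_error hT ht 0 hε0,
    eventually_half_exp_ge (tendsto_natCast_pow_atTop h.dim_pos) (c := 1 / 2) (by norm_num) hε0,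
    eventually_gt_atTop 0] with n hn hn2 hn0
  rw [chernoffRate, EReal.neg_le, ← EReal.coe_neg]
  refine le_scaledLog hn0 ?_
  rw [mul_zero, Real.exp_zero, one_mul, hd, mul_zero, mul_zero, sub_zero, min_self, add_zero] at hn
  refine le_trans ?_ hn
  calc _ = Real.exp (-((n : ℝ) ^ ν * ε)) * Real.exp ((n : ℝ) ^ ν * (ψ t - ε)) := by
        rw [← Real.exp_add]; congr 1; rw [hε]; ring
    _ ≤ _ := by gcongr

theorem chernoff_achievable (h : OverlapAsymptotics ν ρ σ ψ) {t : ℝ} (ht : t ∈ Set.Icc (0 : ℝ) 1)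
    (hd : deriv ψ t = 0) : ∃ T, IsTestSeq T ∧
      Tendsto (chernoffRate ν ρ σ T) atTop (𝓝 ((-ψ t : ℝ) : EReal)) := by
  choose T hT hT' hle using fun n => exists_test_weighted_error_le (h.posDef_left n)
    (h.posDef_right n) (h.trace_left n) (h.trace_right n) 0
  have hTS : IsTestSeq T := fun n => ⟨hT n, hT' n⟩
  refine ⟨T, hTS, tendsto_order.2 ⟨fun a ha => ?_, fun a ha => ?_⟩⟩
  · obtain ⟨r, har, hr⟩ := EReal.lt_iff_exists_real_btwn.1 ha
    rw [EReal.coe_lt_coe_iff] at hr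
    filter_upwards [(h.tendsto_overlap t).eventually_lt_const (show ψ t < -r by linarith),
      eventually_gt_atTop 0] with n hn hn0
    refine har.trans_le ?_
    rw [chernoffRate, EReal.le_neg, ← EReal.coe_neg]
    refine scaledLog_le hn0 ?_
    have := hle n t ht
    rw [Real.exp_zero, one_mul, zero_mul, zero_add] at this
    refine this.trans (Real.exp_le_exp.2 ?_)
    rw [one_div, inv_mul_lt_iff₀ (by positivity)] at hn
    exact hn.le
  · obtain ⟨r, hr, har⟩ := EReal.lt_iff_exists_real_btwn.1 ha
    rw [EReal.coe_lt_coe_iff] at hr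
    filter_upwards [h.chernoff_converse ht hd hTS hr] with n hn
    exact hn.trans_lt har

/-! ### Stein's lemma -/

/-- Take `y` strictly between `ψ'(1)` and `x`. If the second error were below `e^(-Nx)`, then even
weighted by `e^(Ny)` it would tend to zero, as the first error does. By `le_relEntropy_of_test` the
relative entropy would be at least `N y (1 - o(1)) - 1`, against its rate `ψ'(1)`. -/
theorem stein_converse (h : OverlapAsymptotics ν ρ σ ψ) {T : ∀ n, Matrix (J n) (J n) ℂ}
    (hT : SteinAdmissible ρ T) {x : ℝ} (hx : deriv ψ 1 < x) :
    ∀ᶠ n in atTop, secondRate ν σ T n ≤ x := by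
  have hS := h.deriv_one_nonneg
  set y := (deriv ψ 1 + x) / 2 with hy
  have hy0 : 0 ≤ y := by rw [hy]; linarith
  have hyx : 0 < x - y := by rw [hy]; linarith
  have hN := tendsto_natCast_pow_atTop h.dim_pos
  have h1 : Tendsto (fun n : ℕ => Real.exp (-((n : ℝ) ^ ν * (x - y)))) atTop (𝓝 0) :=
    Real.tendsto_exp_neg_atTop_nhds_zero.comp (hN.atTop_mul_const hyx)
  have h2 : Tendsto (fun n : ℕ => 1 / (n : ℝ) ^ ν * relEntropy (ρ n) (σ n) + 1 / (n : ℝ) ^ ν -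
      y * (1 - 2 * (errorFirst (ρ n) (T n) + Real.exp (-((n : ℝ) ^ ν * (x - y)))))) atTop
      (𝓝 (deriv ψ 1 + 0 - y * (1 - 2 * (0 + 0)))) := by
    refine (Tendsto.add h.hasMeanRelEntropy ?_).sub
      (((((hT.2.add h1).const_mul 2).const_sub 1).const_mul y))
    simp only [one_div]
    exact hN.inv_tendsto_atTop
  filter_upwards [h2.eventually_lt_const (show _ < (0 : ℝ) by rw [hy]; linarith),
    eventually_gt_atTop 0] with n hn hn0
  have hpos : (0 : ℝ) < (n : ℝ) ^ ν := by positivity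
  rw [secondRate, EReal.neg_le, ← EReal.coe_neg]
  refine le_scaledLog hn0 ?_
  by_contra! hcon
  have h3 := le_relEntropy_of_test (h.posDef_left n) (h.posDef_right n) (h.trace_left n)
    (h.trace_right n) (hT.1 n).1 (hT.1 n).2 (mul_nonneg hpos.le hy0)
  have h4 : Real.exp ((n : ℝ) ^ ν * y) * errorSecond (σ n) (T n) ≤
      Real.exp (-((n : ℝ) ^ ν * (x - y))) := by
    calc _ ≤ Real.exp ((n : ℝ) ^ ν * y) * Real.exp ((n : ℝ) ^ ν * -x) := by gcongr
      _ = _ := by rw [← Real.exp_add]; congr 1; ring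
  have h5 : (n : ℝ) ^ ν * (y * (1 - 2 * (errorFirst (ρ n) (T n) +
      Real.exp (-((n : ℝ) ^ ν * (x - y)))))) ≤ relEntropy (ρ n) (σ n) + 1 := by
    have : (n : ℝ) ^ ν * y * (1 - 2 * (errorFirst (ρ n) (T n) +
        Real.exp (-((n : ℝ) ^ ν * (x - y))))) ≤ (n : ℝ) ^ ν * y * (1 - 2 * (errorFirst (ρ n) (T n) +
        Real.exp ((n : ℝ) ^ ν * y) * errorSecond (σ n) (T n))) :=
      mul_le_mul_of_nonneg_left (by linarith) (mul_nonneg hpos.le hy0)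
    linarith
  have h6 : y * (1 - 2 * (errorFirst (ρ n) (T n) + Real.exp (-((n : ℝ) ^ ν * (x - y))))) ≤
      1 / (n : ℝ) ^ ν * relEntropy (ρ n) (σ n) + 1 / (n : ℝ) ^ ν := by
    rw [← mul_add_one, one_div, le_inv_mul_iff₀ hpos]
    exact h5
  linarith

/-! ### The Hoeffding bound -/

/-- The weight `e^(Nθ)` with `θ = ψ'(t)` makes the two entries of the minimum in
`eventually_le_error` equal. By `hg`, a first error with exponent strictly below `-s` is negligible
against that lower bound, so the second error has to account for it. -/
theorem hoeffding_converse (h : OverlapAsymptotics ν ρ σ ψ) {s t : ℝ}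
    (ht : t ∈ Set.Icc (0 : ℝ) 1) (hg : -s ≤ ψ t + (1 - t) * deriv ψ t)
    {T : ∀ n, Matrix (J n) (J n) ℂ} (hT : HoeffdingAdmissible ν s ρ T) {x : ℝ}
    (hx : t * deriv ψ t - ψ t < x) : ∀ᶠ n in atTop, secondRate ν σ T n ≤ x := by
  obtain ⟨z, hz1, hz2⟩ := EReal.lt_iff_exists_real_btwn.1 hT.2
  rw [EReal.coe_lt_coe_iff] at hz2
  set d := deriv ψ t with hd
  -- Both slacks are at least `2ε`: one `ε` is lost in the error bound and one absorbs the constants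
  -- `1/2` and `1/4`.
  set ε := min ((-s - z) / 2) ((x - (t * d - ψ t)) / 2) with hε
  have hε0 : 0 < ε := lt_min (by linarith) (by linarith)
  have hε1 : 2 * ε ≤ -s - z := by
    have := min_le_left ((-s - z) / 2) ((x - (t * d - ψ t)) / 2); linarith
  have hε2 : 2 * ε ≤ x - (t * d - ψ t) := by
    have := min_le_right ((-s - z) / 2) ((x - (t * d - ψ t)) / 2); linarith
  have hα : ∀ᶠ n : ℕ in atTop, errorFirst (ρ n) (T n) < Real.exp ((n : ℝ) ^ ν * z) := by
    filter_upwards [eventually_lt_of_limsup_lt hz1, eventually_gt_atTop 0] with n hn hn0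
    by_contra! hcon
    exact absurd (le_scaledLog hn0 hcon) (not_le.2 hn)
  filter_upwards [hα, h.eventually_le_error hT.1 ht d hε0,
    eventually_half_exp_ge (tendsto_natCast_pow_atTop h.dim_pos) (c := 1 / 4) (by norm_num) hε0,
    eventually_gt_atTop 0] with n h1 h2 h3 hn0
  have hpos : (0 : ℝ) < (n : ℝ) ^ ν := by positivity
  rw [secondRate, EReal.neg_le, ← EReal.coe_neg]
  refine le_scaledLog hn0 ?_
  rw [show d - t * d = (1 - t) * d by ring, min_self] at h2
  set X := Real.exp ((n : ℝ) ^ ν * (ψ t + (1 - t) * d - ε)) with hX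
  have hX0 : 0 < X := Real.exp_pos _
  have h4 : Real.exp ((n : ℝ) ^ ν * z) ≤ X * Real.exp (-((n : ℝ) ^ ν * ε)) := by
    rw [hX, ← Real.exp_add, Real.exp_le_exp]
    calc _ ≤ (n : ℝ) ^ ν * (ψ t + (1 - t) * d - ε - ε) := by gcongr; linarith
      _ = _ := by ring
  have h5 : X * Real.exp (-((n : ℝ) ^ ν * ε)) ≤ X * (1 / 4) := by gcongr
  have h6 : X * Real.exp (-((n : ℝ) ^ ν * ε)) ≤
      Real.exp ((n : ℝ) ^ ν * d) * errorSecond (σ n) (T n) := by linarith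
  calc _ ≤ Real.exp (-((n : ℝ) ^ ν * d)) * (X * Real.exp (-((n : ℝ) ^ ν * ε))) := by
        rw [hX, ← Real.exp_add, ← Real.exp_add, Real.exp_le_exp]
        calc _ ≤ (n : ℝ) ^ ν * (-d + (ψ t + (1 - t) * d - ε) - ε) := by gcongr; linarith
          _ = _ := by ring
    _ ≤ Real.exp (-((n : ℝ) ^ ν * d)) *
        (Real.exp ((n : ℝ) ^ ν * d) * errorSecond (σ n) (T n)) := by gcongr
    _ = _ := by rw [← mul_assoc, ← Real.exp_add, neg_add_cancel, Real.exp_zero, one_mul]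

theorem errorFirst_add_smul {ι : Type*} [Fintype ι] [DecidableEq ι] (A T : Matrix ι ι ℂ) (κ : ℝ) :
    errorFirst A (T + κ • (1 - T)) = (1 - κ) * errorFirst A T := by
  have : 1 - (T + κ • (1 - T)) = (1 - κ) • (1 - T) := by module
  rw [errorFirst, this, Matrix.mul_smul, Matrix.trace_smul, Complex.smul_re, smul_eq_mul, errorFirst]

theorem errorSecond_add_smul {ι : Type*} [Fintype ι] [DecidableEq ι] {B : Matrix ι ι ℂ}
    (hB : B.trace = 1) (T : Matrix ι ι ℂ) (κ : ℝ) :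
    errorSecond B (T + κ • (1 - T)) = errorSecond B T + κ * (1 - errorSecond B T) := by
  rw [errorSecond, Matrix.mul_add, Matrix.mul_smul, Matrix.trace_add, Matrix.trace_smul,
    Matrix.mul_sub, Matrix.mul_one, Matrix.trace_sub, hB, Complex.add_re, Complex.smul_re,
    Complex.sub_re, Complex.one_re, smul_eq_mul, errorSecond]

/-- A weighted Neyman–Pearson test is tuned so that its first error meets the constraint. It is then
mixed with the trivial test, so that the rate of the second error has the limit `r` exactly. -/
theorem hoeffding_achievable (h : OverlapAsymptotics ν ρ σ ψ) {s t r : ℝ}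
    (ht : t ∈ Set.Ico (0 : ℝ) 1) (hr : 0 ≤ r) (hrt : r < (-t * s - ψ t) / (1 - t)) :
    ∃ T, HoeffdingAdmissible ν s ρ T ∧ Tendsto (secondRate ν σ T) atTop (𝓝 (r : EReal)) := by
  have ht1 : 0 < 1 - t := by linarith [ht.2]
  -- The constraint on the first error is strict, hence a slightly larger `s'` is aimed at.
  obtain ⟨s', hs', hrs⟩ : ∃ s' > s, r < (-t * s' - ψ t) / (1 - t) := by
    have hc : Tendsto (fun s' : ℝ => (-t * s' - ψ t) / (1 - t)) (𝓝[>] s)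
        (𝓝 ((-t * s - ψ t) / (1 - t))) :=
      (Continuous.tendsto (by fun_prop) s).mono_left nhdsWithin_le_nhds
    obtain ⟨s', h1, h2⟩ := ((hc.eventually_const_lt hrt).and self_mem_nhdsWithin).exists
    exact ⟨s', h2, h1⟩
  -- This `θ` makes the exponent `θ(1 - t) + ψ(t)` of the bound for the first error equal to `-s'`.
  -- The exponent `-θt + ψ(t)` of the bound for the second error is then below `-r`.
  set θ := (-s' - ψ t) / (1 - t) with hθ
  have hθ1 : θ * (1 - t) + ψ t = -s' := by rw [hθ]; field_simp; ring
  have hθ2 : -θ * t + ψ t < -r := by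
    rw [lt_div_iff₀ ht1] at hrs
    have : (-θ * t + ψ t) * (1 - t) < -r * (1 - t) := by
      calc _ = -t * (θ * (1 - t) + ψ t) + ψ t := by ring
        _ < _ := by rw [hθ1]; linarith
    exact lt_of_mul_lt_mul_right this ht1.le
  choose T hT hT' hle using fun n : ℕ => exists_test_weighted_error_le (h.posDef_left n)
    (h.posDef_right n) (h.trace_left n) (h.trace_right n) ((n : ℝ) ^ ν * θ)
  have hN := tendsto_natCast_pow_atTop h.dim_pos
  have hα0 : ∀ n, 0 ≤ errorFirst (ρ n) (T n) := fun n =>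
    errorFirst_nonneg (h.posDef_left n).posSemidef (hT' n)
  have hβ0 : ∀ n, 0 ≤ errorSecond (σ n) (T n) := fun n =>
    errorSecond_nonneg (h.posDef_right n).posSemidef (hT n)
  -- Adding `κ (1 - T)` lifts the second error to the order `e^(-Nr)` and only lowers the first one.
  -- The assumption `0 ≤ r` keeps `κ ≤ 1`, so the result is still a test.
  set κ : ℕ → ℝ := fun n => Real.exp (-((n : ℝ) ^ ν * r)) with hκ
  have hκ0 : ∀ n, 0 < κ n := fun n => Real.exp_pos _
  have hκ1 : ∀ n, κ n ≤ 1 := fun n => Real.exp_le_one_iff.2 (by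
    have : 0 ≤ (n : ℝ) ^ ν * r := by positivity
    linarith)
  have hsmul : ∀ n (c : ℝ), 0 ≤ c → (c • (1 - T n)).PosSemidef := fun n c hc => (hT' n).smul hc
  refine ⟨fun n => T n + κ n • (1 - T n), ⟨fun n => ⟨(hT n).add (hsmul n _ (hκ0 n).le), ?_⟩, ?_⟩, ?_⟩
  · convert hsmul n (1 - κ n) (by linarith [hκ1 n]) using 1
    module
  · set m := (s + s') / 2 with hm
    have h1 : limsup (fun n => scaledLog ν n (errorFirst (ρ n) (T n + κ n • (1 - T n)))) atTop ≤
        ((-m : ℝ) : EReal) := by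
      refine limsup_le_of_le (by isBoundedDefault) ?_
      filter_upwards [(h.tendsto_overlap t).eventually_lt_const
        (show ψ t < ψ t + (s' - m) by rw [hm]; linarith), eventually_gt_atTop 0] with n hn hn0
      have hpos : (0 : ℝ) < (n : ℝ) ^ ν := by positivity
      refine scaledLog_le hn0 ?_
      rw [errorFirst_add_smul]
      have h2 := hle n t ⟨ht.1, ht.2.le⟩
      have h3 : 0 ≤ Real.exp ((n : ℝ) ^ ν * θ) * errorSecond (σ n) (T n) :=
        mul_nonneg (Real.exp_pos _).le (hβ0 n)
      have h4 : (1 - κ n) * errorFirst (ρ n) (T n) ≤ errorFirst (ρ n) (T n) := by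
        nlinarith [hα0 n, hκ0 n]
      refine (h4.trans (by linarith)).trans (Real.exp_le_exp.2 (?_ :
        (n : ℝ) ^ ν * θ * (1 - t) + logOverlap (ρ n) (σ n) t ≤ _))
      rw [one_div, inv_mul_lt_iff₀ hpos] at hn
      calc _ ≤ (n : ℝ) ^ ν * (θ * (1 - t) + ψ t + (s' - m)) := by linarith
        _ = _ := by rw [hθ1]; ring
    refine h1.trans_lt (EReal.coe_lt_coe_iff.2 ?_)
    rw [hm]; linarith
  · have hβ : ∀ᶠ n in atTop, errorSecond (σ n) (T n) ≤ κ n := by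
      filter_upwards [(h.tendsto_overlap t).eventually_lt_const
        (show ψ t < θ * t - r by linarith), eventually_gt_atTop 0] with n hn hn0
      have hpos : (0 : ℝ) < (n : ℝ) ^ ν := by positivity
      have h2 := hle n t ⟨ht.1, ht.2.le⟩
      have h3 : Real.exp ((n : ℝ) ^ ν * θ) * errorSecond (σ n) (T n) ≤
          Real.exp ((n : ℝ) ^ ν * θ) * κ n := by
        refine le_trans (by linarith [hα0 n]) (h2.trans ?_)
        rw [hκ, ← Real.exp_add, Real.exp_le_exp]
        rw [one_div, inv_mul_lt_iff₀ hpos] at hn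
        linarith
      exact le_of_mul_le_mul_left h3 (Real.exp_pos _)
    refine tendsto_order.2 ⟨fun a ha => ?_, fun a ha => ?_⟩
    · obtain ⟨b, hab, hb⟩ := EReal.lt_iff_exists_real_btwn.1 ha
      rw [EReal.coe_lt_coe_iff] at hb
      filter_upwards [hβ, eventually_half_exp_ge hN (c := 1 / 2) (by norm_num)
        (sub_pos.2 hb), eventually_gt_atTop 0] with n hn hn2 hn0
      refine hab.trans_le ?_
      rw [secondRate, EReal.le_neg, ← EReal.coe_neg]
      refine scaledLog_le hn0 ?_
      rw [errorSecond_add_smul (h.trace_right n)]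
      have h3 : errorSecond (σ n) (T n) + κ n * (1 - errorSecond (σ n) (T n)) ≤ 2 * κ n := by
        nlinarith [hβ0 n, hκ0 n]
      refine h3.trans ?_
      have h4 : κ n = Real.exp (-((n : ℝ) ^ ν * (r - b))) * Real.exp ((n : ℝ) ^ ν * -b) := by
        simp only [hκ]
        rw [← Real.exp_add]
        ring_nf
      rw [h4]
      nlinarith [Real.exp_pos ((n : ℝ) ^ ν * -b)]
    · filter_upwards [eventually_gt_atTop 0] with n hn0
      refine lt_of_le_of_lt ?_ ha
      rw [secondRate, EReal.neg_le, ← EReal.coe_neg]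
      refine le_scaledLog hn0 ?_
      rw [errorSecond_add_smul (h.trace_right n)]
      have : Real.exp ((n : ℝ) ^ ν * -r) = κ n := by simp only [hκ, mul_neg]
      rw [this]
      nlinarith [hβ0 n, hκ0 n, hκ1 n]

/-- The trivial test has first error `0`, whose logarithm is `⊥`. Its second error is `1`, so it
serves all negative target rates. -/
theorem hoeffdingAdmissible_one (ν : ℕ) (s : ℝ) (ρ : ∀ n, Matrix (J n) (J n) ℂ) :
    HoeffdingAdmissible ν s ρ (fun _ => 1) := by
  refine ⟨fun n => ⟨Matrix.PosSemidef.one, by rw [sub_self]; exact Matrix.PosSemidef.zero⟩, ?_⟩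
  have : limsup (fun n => scaledLog ν n (errorFirst (ρ n) 1)) atTop ≤ (⊥ : EReal) := by
    refine limsup_le_of_le (by isBoundedDefault) ?_
    filter_upwards [eventually_gt_atTop 0] with n hn
    rw [scaledLog_of_nonpos hn (by simp [errorFirst])]
  exact this.trans_lt (EReal.bot_lt_coe _)

theorem tendsto_secondRate_one (h : OverlapAsymptotics ν ρ σ ψ) :
    Tendsto (secondRate ν σ fun _ => 1) atTop (𝓝 ((0 : ℝ) : EReal)) := by
  refine tendsto_const_nhds.congr fun n => ?_
  rw [secondRate, errorSecond, Matrix.mul_one, h.trace_right, Complex.one_re,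
    scaledLog_of_pos one_pos, Real.log_one, mul_zero, EReal.coe_zero, neg_zero]

/-- The strict inequality leaves room for some `z < -s ≤ 0`, so the first error is eventually at
most `e^(Nz)`. -/
theorem steinAdmissible_of_hoeffdingAdmissible (hν : 0 < ν) (hρ : ∀ n, (ρ n).PosSemidef) {s : ℝ}
    (hs : 0 ≤ s) {T : ∀ n, Matrix (J n) (J n) ℂ} (hT : HoeffdingAdmissible ν s ρ T) :
    SteinAdmissible ρ T := by
  refine ⟨hT.1, ?_⟩
  obtain ⟨z, hz1, hz2⟩ := EReal.lt_iff_exists_real_btwn.1 hT.2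
  rw [EReal.coe_lt_coe_iff] at hz2
  have hα : ∀ᶠ n : ℕ in atTop, errorFirst (ρ n) (T n) ≤ Real.exp (-((n : ℝ) ^ ν * -z)) := by
    filter_upwards [eventually_lt_of_limsup_lt hz1, eventually_gt_atTop 0] with n hn hn0
    by_contra! hcon
    rw [mul_neg, neg_neg] at hcon
    exact absurd (le_scaledLog hn0 hcon.le) (not_le.2 hn)
  exact squeeze_zero' (Eventually.of_forall fun n => errorFirst_nonneg (hρ n) (hT.1 n).2) hα
    (Real.tendsto_exp_neg_atTop_nhds_zero.comp
      ((tendsto_natCast_pow_atTop hν).atTop_mul_const (by linarith)))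

end OverlapAsymptotics

end Asymptotics

/-! ### The variational problem for the Hoeffding exponent. -/

section HoeffdingFunction

/-- Since `f 1 = 0`, the quotient is the slope of the chord of `f` over `[t, 1]`. By convexity it is
at most the derivative at `1`, which it approaches as `t → 1`. -/
theorem isLUB_neg_div_of_convexOn {f : ℝ → ℝ} (hf : ConvexOn ℝ Set.univ f) (h1 : f 1 = 0) {d : ℝ}
    (hd : HasDerivAt f d 1) : IsLUB ((fun t => -f t / (1 - t)) '' Set.Ico 0 1) d := by
  constructor
  · rintro _ ⟨t, ht, rfl⟩
    have := tangent_le_of_convexOn hf hd t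
    have ht1 : 0 < 1 - t := by linarith [ht.2]
    dsimp only
    rw [div_le_iff₀ ht1]
    linarith
  · intro b hb
    have h2 : Tendsto (slope f 1) (𝓝[<] 1) (𝓝 d) :=
      (hasDerivAt_iff_tendsto_slope.1 hd).mono_left (nhdsWithin_mono _ fun y hy => ne_of_lt hy)
    refine le_of_tendsto h2 ?_
    filter_upwards [Ico_mem_nhdsLT one_pos] with t ht
    refine le_of_eq_of_le ?_ (hb ⟨t, ht, rfl⟩)
    rw [slope_def_field, h1, sub_zero, ← neg_div_neg_eq, neg_sub]

/-- The Hoeffding function attains its maximum, and the first order conditions hold there. -/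
theorem exists_hoeffding_maximizer {f : ℝ → ℝ} (hf : ConvexOn ℝ Set.univ f)
    (hdiff : Differentiable ℝ f) (h0 : f 0 = 0) (h1 : f 1 = 0) {s : ℝ} (hs : 0 < s) :
    ∃ t ∈ Set.Ico (0 : ℝ) 1, (∀ u ∈ Set.Ico (0 : ℝ) 1,
        (-u * s - f u) / (1 - u) ≤ t * deriv f t - f t) ∧
      (-t * s - f t) / (1 - t) = t * deriv f t - f t ∧ -s ≤ f t + (1 - t) * deriv f t := by
  set S := deriv f 1 with hS
  have hS0 : 0 ≤ S := by
    have := tangent_le_of_convexOn hf (hdiff 1).hasDerivAt 0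
    rw [h0, h1] at this
    linarith
  have hSs : 0 < S + s := by linarith
  set b := S / (S + s) with hb
  have hb0 : 0 ≤ b := by positivity
  have hb1 : b < 1 := by rw [hb, div_lt_one hSs]; linarith
  have hcont : ContinuousOn (fun u => (-u * s - f u) / (1 - u)) (Set.Icc 0 b) := by
    refine ContinuousOn.div (by have := hdiff.continuous; fun_prop) (by fun_prop) fun u hu => ?_
    linarith [hu.2]
  obtain ⟨t, ht, hmax⟩ := isCompact_Icc.exists_isMaxOn ⟨0, le_rfl, hb0⟩ hcont
  have ht' : t ∈ Set.Ico (0 : ℝ) 1 := ⟨ht.1, ht.2.trans_lt hb1⟩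
  have ht1 : 0 < 1 - t := by linarith [ht'.2]
  set M := (-t * s - f t) / (1 - t) with hM
  have hM0 : 0 ≤ M := by
    have h2 : (-(0 : ℝ) * s - f 0) / (1 - 0) ≤ M := hmax ⟨le_rfl, hb0⟩
    simpa [h0] using h2
  have hall : ∀ u ∈ Set.Ico (0 : ℝ) 1, (-u * s - f u) / (1 - u) ≤ M := by
    intro u hu
    have hu1 : 0 < 1 - u := by linarith [hu.2]
    rcases le_or_gt u b with hub | hub
    · exact hmax ⟨hu.1, hub⟩
    · refine le_trans ?_ hM0
      rw [div_le_iff₀ hu1, zero_mul]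
      have := tangent_le_of_convexOn hf (hdiff 1).hasDerivAt u
      rw [hb, div_lt_iff₀ hSs] at hub
      rw [h1] at this
      linarith
  -- Clearing the denominator gives a function which is nonnegative on `[0, 1)` and vanishes at `t`.
  -- Its derivative there supplies the first order conditions.
  have hk : ∀ u ∈ Set.Ico (0 : ℝ) 1, 0 ≤ M * (1 - u) + u * s + f u := fun u hu => by
    have := hall u hu
    rw [div_le_iff₀ (by linarith [hu.2])] at this
    linarith
  have hkt : M * (1 - t) + t * s + f t = 0 := by rw [hM]; field_simp; ring
  have hkd : HasDerivAt (fun u => M * (1 - u) + u * s + f u) (-M + s + deriv f t) t := by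
    refine HasDerivAt.congr_deriv ((((hasDerivAt_id t).const_sub 1).const_mul M).add
      ((hasDerivAt_id t).mul_const s) |>.add (hdiff t).hasDerivAt) ?_
    ring
  -- At an endpoint maximum `t = 0` only the right-hand difference quotients are available, and they
  -- give an inequality instead of an equation.
  rcases ht.1.eq_or_lt with hz | hz
  · have hMz : M = 0 := by rw [hM, ← hz, h0]; simp
    have hge : 0 ≤ -M + s + deriv f t := by
      have h2 : Tendsto (slope (fun u => M * (1 - u) + u * s + f u) t) (𝓝[>] t)
          (𝓝 (-M + s + deriv f t)) :=
        (hasDerivAt_iff_tendsto_slope.1 hkd).mono_left (nhdsWithin_mono _ fun y hy => ne_of_gt hy)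
      refine ge_of_tendsto h2 ?_
      filter_upwards [Ioo_mem_nhdsGT ht'.2] with u hu
      rw [slope_def_field, hkt, sub_zero]
      exact div_nonneg (hk u ⟨ht.1.trans hu.1.le, hu.2⟩) (by linarith [hu.1])
    have e : t * deriv f t - f t = M := by rw [← hz, hMz, h0]; ring
    refine ⟨t, ht', fun u hu => e ▸ hall u hu, e.symm, ?_⟩
    rw [← hz] at hge ⊢
    rw [h0]
    linarith
  · have heq : -M + s + deriv f t = 0 := by
      refine IsLocalMin.hasDerivAt_eq_zero (f := fun u => M * (1 - u) + u * s + f u) ?_ hkd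
      filter_upwards [Ioo_mem_nhds hz ht'.2] with u hu
      rw [hkt]
      exact hk u ⟨hu.1.le, hu.2⟩
    have hd : deriv f t = M - s := by linarith
    have e : t * deriv f t - f t = M := by rw [hd]; linarith
    refine ⟨t, ht', fun u hu => e ▸ hall u hu, e.symm, ?_⟩
    rw [hd]
    linarith

end HoeffdingFunction

/-! ### Mean Hoeffding bounds and assembly of the error exponents. -/

namespace OverlapAsymptotics

variable {J : ℕ → Type*} [∀ n, Fintype (J n)] [∀ n, DecidableEq (J n)]
variable {ν : ℕ} {ρ σ : ∀ n, Matrix (J n) (J n) ℂ} {ψ : ℝ → ℝ}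

/-- At `s = 0` the Hoeffding bound of each pair equals its relative entropy, by
`isLUB_neg_div_of_convexOn`. -/
theorem hasMeanHoeffding_zero (h : OverlapAsymptotics ν ρ σ ψ) :
    HasMeanHoeffding ν 0 ρ σ (deriv ψ 1) := by
  refine h.hasMeanRelEntropy.congr fun n => ?_
  have := (isLUB_neg_div_of_convexOn (convexOn_logOverlap (h.posDef_left n) (h.posDef_right n)
    (h.trace_left n) (h.trace_right n)) (logOverlap_one (h.posDef_left n) (h.posDef_right n)
    (h.trace_left n) (h.trace_right n)) (hasDerivAt_logOverlap_one (h.posDef_left n)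
    (h.posDef_right n) (h.trace_left n) (h.trace_right n))).csSup_eq
    (Set.Nonempty.image _ ⟨0, le_rfl, one_pos⟩)
  rw [hoeffdingBound, ← this]
  simp

/-- The lower bound is evaluation at `t`. For the upper bound the scaled overlap at stage `n` is
replaced by its tangents at `t` and at `1`. Their values and slopes converge, which makes the bound
uniform in `u`. -/
theorem hasMeanHoeffding_of_pos (h : OverlapAsymptotics ν ρ σ ψ) {s t M : ℝ} (hs : 0 < s)
    (ht : t ∈ Set.Ico (0 : ℝ) 1) (hM0 : 0 ≤ M) (hM : (-t * s - ψ t) / (1 - t) = M)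
    (hM' : t * deriv ψ t - ψ t = M) (hg : -s ≤ ψ t + (1 - t) * deriv ψ t) :
    HasMeanHoeffding ν s ρ σ M := by
  have hrel : ∀ n u, (u - 1) * relEntropy (ρ n) (σ n) ≤ logOverlap (ρ n) (σ n) u := fun n u => by
    have := tangent_le_of_convexOn (convexOn_logOverlap (h.posDef_left n) (h.posDef_right n)
      (h.trace_left n) (h.trace_right n)) (hasDerivAt_logOverlap_one (h.posDef_left n)
      (h.posDef_right n) (h.trace_left n) (h.trace_right n)) u
    rwa [logOverlap_one (h.posDef_left n) (h.posDef_right n) (h.trace_left n) (h.trace_right n),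
      zero_add] at this
  have hbdd : ∀ n : ℕ, BddAbove ((fun u => (-u * ((n : ℝ) ^ ν * s) - logOverlap (ρ n) (σ n) u) /
      (1 - u)) '' Set.Ico 0 1) := by
    refine fun n => ⟨relEntropy (ρ n) (σ n), ?_⟩
    rintro _ ⟨u, hu, rfl⟩
    have hu1 : 0 < 1 - u := by linarith [hu.2]
    dsimp only
    rw [div_le_iff₀ hu1]
    have h1 := hrel n u
    have h2 : 0 ≤ u * ((n : ℝ) ^ ν * s) := mul_nonneg hu.1 (by positivity)
    linarith
  have hd := h.tendsto_deriv t
  have hψ := h.tendsto_overlap t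
  set d := deriv ψ t
  set S := deriv ψ 1
  have hS0 : 0 ≤ S := h.deriv_one_nonneg
  refine tendsto_order.2 ⟨fun a ha => ?_, fun x hx => ?_⟩
  · have h1 : Tendsto (fun n : ℕ => (-t * s - 1 / (n : ℝ) ^ ν * logOverlap (ρ n) (σ n) t) / (1 - t))
        atTop (𝓝 M) := hM ▸ (hψ.const_sub _).div_const _
    filter_upwards [h1.eventually_const_lt ha, eventually_gt_atTop 0] with n hn hn0
    have hpos : (0 : ℝ) < (n : ℝ) ^ ν := by positivity
    refine hn.trans_le ?_
    rw [hoeffdingBound, one_div, le_inv_mul_iff₀ hpos]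
    refine le_of_eq_of_le ?_ (le_csSup (hbdd n) ⟨t, ht, rfl⟩)
    field_simp
  -- For `1 - u < δ` one has `(1 - u)(S + 1) ≤ u s`. The tangent at `1`, whose slope is eventually
  -- below `S + 1`, then makes the numerator nonpositive near `u = 1`.
  · set δ := s / (S + 1 + s) with hδ
    have hδ0 : 0 < δ := by positivity
    have hx' : 0 < (x - M) / 4 := by linarith
    have h1 : Tendsto (fun n : ℕ => -(1 / (n : ℝ) ^ ν * logOverlap (ρ n) (σ n) t) +
        1 / (n : ℝ) ^ ν * deriv (logOverlap (ρ n) (σ n)) t * t) atTop (𝓝 (-ψ t + d * t)) :=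
      hψ.neg.add (hd.mul_const t)
    have h2 : Tendsto (fun n : ℕ => -s - 1 / (n : ℝ) ^ ν * logOverlap (ρ n) (σ n) t -
        1 / (n : ℝ) ^ ν * deriv (logOverlap (ρ n) (σ n)) t * (1 - t)) atTop
        (𝓝 (-s - ψ t - d * (1 - t))) :=
      (hψ.const_sub _).sub (hd.mul_const _)
    filter_upwards [h1.eventually_lt_const (show -ψ t + d * t < M + (x - M) / 4 by linarith),
      h2.eventually_lt_const (show -s - ψ t - d * (1 - t) < δ * ((x - M) / 4) by
        nlinarith [mul_pos hδ0 hx']),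
      h.hasMeanRelEntropy.eventually_lt_const (show S < S + 1 by linarith),
      eventually_gt_atTop 0] with n b1 b2 b3 hn0
    have hpos : (0 : ℝ) < (n : ℝ) ^ ν := by positivity
    have htan : ∀ u, 1 / (n : ℝ) ^ ν * logOverlap (ρ n) (σ n) t +
        (u - t) * (1 / (n : ℝ) ^ ν * deriv (logOverlap (ρ n) (σ n)) t) ≤
        1 / (n : ℝ) ^ ν * logOverlap (ρ n) (σ n) u := fun u =>
      tangent_le_of_convexOn (h.convexOn_scaled n) (((differentiable_logOverlap (h.posDef_left n)
        (h.posDef_right n) (h.trace_left n) (h.trace_right n)) t).hasDerivAt.const_mul _) u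
    have hrel' : ∀ u, (u - 1) * (1 / (n : ℝ) ^ ν * relEntropy (ρ n) (σ n)) ≤
        1 / (n : ℝ) ^ ν * logOverlap (ρ n) (σ n) u := fun u => by
      rw [mul_left_comm]
      exact mul_le_mul_of_nonneg_left (hrel n u) (by positivity)
    set A := 1 / (n : ℝ) ^ ν * logOverlap (ρ n) (σ n) t
    set B := 1 / (n : ℝ) ^ ν * deriv (logOverlap (ρ n) (σ n)) t
    set D := 1 / (n : ℝ) ^ ν * relEntropy (ρ n) (σ n)
    refine lt_of_le_of_lt ?_ (show (M + x) / 2 < x by linarith)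
    rw [hoeffdingBound, one_div, inv_mul_le_iff₀ hpos]
    refine csSup_le (Set.Nonempty.image _ ⟨0, le_rfl, one_pos⟩) ?_
    rintro _ ⟨u, hu, rfl⟩
    have hu1 : 0 < 1 - u := by linarith [hu.2]
    dsimp only
    rw [div_le_iff₀ hu1]
    -- Away from `1` the tangent at `t` bounds the numerator by `(1 - u)(-A + B t) + u(-s - A - B(1
    -- - t))`. The first bracket tends to `M`. The second has nonpositive limit by `hg`, so its
    -- small excess can be divided by `1 - u ≥ δ`.
    have key : -u * s - 1 / (n : ℝ) ^ ν * logOverlap (ρ n) (σ n) u ≤ (M + x) / 2 * (1 - u) := by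
      rcases le_or_gt δ (1 - u) with hc | hc
      · have e1 : (1 - u) * (-A + B * t) ≤ (1 - u) * (M + (x - M) / 4) :=
          mul_le_mul_of_nonneg_left b1.le hu1.le
        have e2 : u * (-s - A - B * (1 - t)) ≤ (1 - u) * ((x - M) / 4) := by
          have f1 : u * (-s - A - B * (1 - t)) ≤ u * (δ * ((x - M) / 4)) :=
            mul_le_mul_of_nonneg_left b2.le hu.1
          have f2 : u * (δ * ((x - M) / 4)) ≤ 1 * (δ * ((x - M) / 4)) :=
            mul_le_mul_of_nonneg_right hu.2.le (by positivity)
          have f3 : δ * ((x - M) / 4) ≤ (1 - u) * ((x - M) / 4) :=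
            mul_le_mul_of_nonneg_right hc hx'.le
          linarith
        have := htan u
        linarith
      · have e1 := hrel' u
        have e2 : (1 - u) * D ≤ (1 - u) * (S + 1) := mul_le_mul_of_nonneg_left b3.le hu1.le
        have e3 : (1 - u) * (S + 1) ≤ u * s := by
          rw [hδ, lt_div_iff₀ (by positivity)] at hc
          linarith
        have e4 : 0 ≤ (M + x) / 2 * (1 - u) := mul_nonneg (by linarith) hu1.le
        linarith
    calc -u * ((n : ℝ) ^ ν * s) - logOverlap (ρ n) (σ n) u =
        (n : ℝ) ^ ν * (-u * s - 1 / (n : ℝ) ^ ν * logOverlap (ρ n) (σ n) u) := by field_simp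
      _ ≤ (n : ℝ) ^ ν * ((M + x) / 2 * (1 - u)) := by gcongr
      _ = _ := by ring

/-- The Chernoff, Hoeffding and Stein theorems for sequences of densities with differentiable
limiting overlap function. -/
theorem error_exponents (h : OverlapAsymptotics ν ρ σ ψ) :
    ∃ (C S : ℝ) (H : ℝ → ℝ),
      (HasMeanChernoff ν ρ σ C ∧
        (∀ s : ℝ, 0 ≤ s → HasMeanHoeffding ν s ρ σ (H s)) ∧
        HasMeanRelEntropy ν ρ σ S) ∧
      IsLeast (ψ '' Set.Icc 0 1) (-C) ∧
      (∀ s : ℝ, 0 < s →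
        IsGreatest ((fun t => (-t * s - ψ t) / (1 - t)) '' Set.Ico 0 1) (H s)) ∧
      (S = H 0 ∧ HasDerivWithinAt ψ S (Set.Iio 1) 1 ∧
        IsLUB ((fun t => -ψ t / (1 - t)) '' Set.Ico 0 1) S) ∧
      (chernoffLim ν ρ σ = (C : EReal) ∧ chernoffLiminf ν ρ σ = (C : EReal) ∧
        chernoffLimsup ν ρ σ = (C : EReal)) ∧
      (∀ s : ℝ, 0 ≤ s → hoeffdingLim ν s ρ σ = (H s : EReal) ∧
        hoeffdingLiminf ν s ρ σ = (H s : EReal) ∧ hoeffdingLimsup ν s ρ σ = (H s : EReal)) ∧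
      (steinLim ν ρ σ = (S : EReal) ∧ steinLiminf ν ρ σ = (S : EReal) ∧
        steinLimsup ν ρ σ = (S : EReal)) := by
  obtain ⟨t₀, ht₀, hd₀, hmin⟩ := h.exists_interior_minimizer
  choose! t ht hle heq hg using fun s (hs : 0 < s) =>
    exists_hoeffding_maximizer h.convexOn h.differentiable h.zero h.one hs
  have hlub := isLUB_neg_div_of_convexOn h.convexOn h.one (h.differentiable 1).hasDerivAt
  -- At `s = 0` the supremum need not be attained, and its value is the limit `ψ'(1)` of the chord
  -- slopes.
  set H : ℝ → ℝ := fun s => if 0 < s then t s * deriv ψ (t s) - ψ (t s) else deriv ψ 1 with hH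
  have hHpos : ∀ s, 0 < s → H s = t s * deriv ψ (t s) - ψ (t s) := fun s hs => if_pos hs
  have hH0 : H 0 = deriv ψ 1 := if_neg (lt_irrefl 0)
  have hgreat : ∀ s : ℝ, 0 < s →
      IsGreatest ((fun t => (-t * s - ψ t) / (1 - t)) '' Set.Ico 0 1) (H s) := fun s hs => by
    rw [hHpos s hs]
    refine ⟨⟨t s, ht s hs, heq s hs⟩, ?_⟩
    rintro _ ⟨u, hu, rfl⟩
    exact hle s hs u hu
  have hHlub : ∀ s : ℝ, 0 ≤ s →
      IsLUB ((fun t => (-t * s - ψ t) / (1 - t)) '' Set.Ico 0 1) (H s) := fun s hs => by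
    rcases hs.eq_or_lt with rfl | hs
    · rw [hH0]; simpa using hlub
    · exact (hgreat s hs).isLUB
  have hup : ∀ s : ℝ, 0 ≤ s → ∀ T, HoeffdingAdmissible ν s ρ T → ∀ x : ℝ, H s < x →
      ∀ᶠ n in atTop, secondRate ν σ T n ≤ x := fun s hs T hT x hx => by
    rcases hs.eq_or_lt with rfl | hs
    · exact h.stein_converse (steinAdmissible_of_hoeffdingAdmissible h.dim_pos
        (fun n => (h.posDef_left n).posSemidef) le_rfl hT) (hH0 ▸ hx)
    · exact h.hoeffding_converse (Set.Ico_subset_Icc_self (ht s hs)) (hg s hs) hT (hHpos s hs ▸ hx)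
  have hlow : ∀ s : ℝ, 0 ≤ s → ∀ r : ℝ, r < H s → ∃ T, HoeffdingAdmissible ν s ρ T ∧
      ∃ L : EReal, r ≤ L ∧ Tendsto (secondRate ν σ T) atTop (𝓝 L) := fun s hs r hr => by
    rcases le_or_gt 0 r with hr0 | hr0
    · obtain ⟨_, ⟨u, hu, rfl⟩, hru⟩ := (lt_isLUB_iff (hHlub s hs)).1 hr
      obtain ⟨T, hT, hlim⟩ := h.hoeffding_achievable hu hr0 hru
      exact ⟨T, hT, r, le_rfl, hlim⟩
    · exact ⟨_, hoeffdingAdmissible_one ν s ρ, _, EReal.coe_le_coe_iff.2 hr0.le,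
        h.tendsto_secondRate_one⟩
  refine ⟨-ψ t₀, deriv ψ 1, H, ⟨h.hasMeanChernoff ht₀ hd₀, fun s hs => ?_, h.hasMeanRelEntropy⟩,
    by rwa [neg_neg], hgreat, ⟨hH0.symm, (h.differentiable 1).hasDerivAt.hasDerivWithinAt, hlub⟩,
    optimal_exponents_eq (fun T hT x hx => h.chernoff_converse ht₀ hd₀ hT hx) fun r hr => ?_,
    fun s hs => optimal_exponents_eq (hup s hs) (hlow s hs),
    optimal_exponents_eq (fun T hT x hx => h.stein_converse hT hx) fun r hr => ?_⟩
  · rcases hs.eq_or_lt with rfl | hs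
    · exact hH0 ▸ h.hasMeanHoeffding_zero
    · rw [hHpos s hs]
      refine h.hasMeanHoeffding_of_pos hs (ht s hs) ?_ (heq s hs) rfl (hg s hs)
      have := hle s hs 0 ⟨le_rfl, one_pos⟩
      simpa [h.zero] using this
  · obtain ⟨T, hT, hlim⟩ := h.chernoff_achievable ht₀ hd₀
    exact ⟨T, hT, _, EReal.coe_le_coe_iff.2 hr.le, hlim⟩
  · obtain ⟨T, hT, L, hL, hlim⟩ := hlow 0 le_rfl r (hH0 ▸ hr)
    exact ⟨T, steinAdmissible_of_hoeffdingAdmissible h.dim_pos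
      (fun n => (h.posDef_left n).posSemidef) le_rfl hT, L, hL, hlim⟩

end OverlapAsymptotics

/-! ### Ordered products of anticommuting elements. -/

section OrderedProduct

variable {κ : Type*} [LinearOrder κ] {M : Type*} [Monoid M]

/-- The product of `z k` over `k ∈ S` in increasing order. -/
def orderedProd (z : κ → M) (S : Finset κ) : M := ((S.sort (· ≤ ·)).map z).prod

@[simp]
theorem orderedProd_empty (z : κ → M) : orderedProd z ∅ = 1 := by simp [orderedProd]

theorem orderedProd_insert (z : κ → M) {a : κ} {S : Finset κ} (h : ∀ b ∈ S, a < b) :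
    orderedProd z (insert a S) = z a * orderedProd z S := by
  rw [orderedProd, Finset.sort_insert (r := (· ≤ ·)) (fun b hb => (h b hb).le)
    (fun hc => lt_irrefl a (h a hc)), List.map_cons, List.prod_cons, orderedProd]

theorem mul_orderedProd {z w : κ → M} {g : M} (h : ∀ k, g * z k = w k * g) (S : Finset κ) :
    g * orderedProd z S = orderedProd w S * g := by
  induction S using Finset.induction_on_min with
  | empty => simp
  | insert a s ha ih =>
    rw [orderedProd_insert z ha, orderedProd_insert w ha, ← mul_assoc, h, mul_assoc, ih, mul_assoc]

theorem wedgeSign_of_forall_lt {a : κ} {S : Finset κ} (h : ∀ b ∈ S, a < b) : wedgeSign a S = 1 := by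
  rw [wedgeSign, Finset.filter_false_of_mem fun b hb => (h b hb).not_gt]
  simp

/-- Left multiplication of an ordered product of anticommuting elements. -/
theorem mul_orderedProd_of_anticomm {R : Type*} [Ring R] [Algebra ℂ R] {z : κ → R}
    (h : ∀ j k, z j * z k = - (z k * z j)) (h0 : ∀ k, z k * z k = 0) (k : κ) (S : Finset κ) :
    z k * orderedProd z S = if k ∈ S then 0 else wedgeSign k S • orderedProd z (insert k S) := by
  induction S using Finset.induction_on_min with
  | empty => simp [orderedProd, wedgeSign]
  | insert a s ha ih =>
    have has : a ∉ s := fun hc => lt_irrefl a (ha a hc)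
    rw [orderedProd_insert z ha]
    -- If `k` precedes the least element `a`, it is simply prepended; if `k = a`, the square
    -- vanishes; otherwise `z k` is moved past `z a`, which costs the sign that `wedgeSign` records
    -- for `a`.
    rcases lt_trichotomy k a with hka | rfl | hka
    · have hk : ∀ b ∈ insert a s, k < b := fun b hb => by
        rcases Finset.mem_insert.1 hb with rfl | hb
        · exact hka
        · exact hka.trans (ha b hb)
      rw [if_neg fun hc => lt_irrefl k (hk k hc), wedgeSign_of_forall_lt hk, one_smul,
        orderedProd_insert z hk, orderedProd_insert z ha]
    · rw [if_pos (Finset.mem_insert_self k s), ← mul_assoc, h0, zero_mul]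
    · rw [← mul_assoc, h, neg_mul, mul_assoc, ih]
      by_cases hks : k ∈ s
      · rw [if_pos hks, if_pos (Finset.mem_insert_of_mem hks), mul_zero, neg_zero]
      · have hks' : k ∉ insert a s := by
          rw [Finset.mem_insert, not_or]; exact ⟨hka.ne', hks⟩
        have hins : ∀ b ∈ insert k s, a < b := fun b hb => by
          rcases Finset.mem_insert.1 hb with rfl | hb
          · exact hka
          · exact ha b hb
        rw [if_neg hks, if_neg hks', Finset.insert_comm k a s, orderedProd_insert z hins,
          mul_smul_comm, wedgeSign_insert_of_lt has hka, neg_smul]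

end OrderedProduct

theorem eq_zero_of_eq_neg_self {M : Type*} [AddCommGroup M] [Module ℂ M] {a : M} (h : a = -a) :
    a = 0 := by
  have h2 : (2 : ℂ) • a = 0 := by rw [two_smul]; nth_rewrite 1 [h]; exact neg_add_cancel a
  exact (smul_eq_zero.1 h2).resolve_left two_ne_zero

/-! ### Creation matrices and second quantization over finitely many modes. -/

section FockMatrices

variable {κ : Type*} [LinearOrder κ] [Fintype κ]

/-- The basis vector of Fock space with occupied modes `S`. -/
def fockBasis (S : Finset κ) : Finset κ → ℂ := Pi.single S 1

/-- Matrix of the creation operator of the mode `k`. -/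
def modeCreation (k : κ) : Matrix (Finset κ) (Finset κ) ℂ :=
  Matrix.of fun S T => if k ∈ S ∧ S.erase k = T then wedgeSign k S else 0

/-- Matrix of the creation operator of `x`. -/
def creationMatrix (x : κ → ℂ) : Matrix (Finset κ) (Finset κ) ℂ := ∑ k, x k • modeCreation k

theorem ext_fockBasis {A B : Matrix (Finset κ) (Finset κ) ℂ}
    (h : ∀ T, A.mulVec (fockBasis T) = B.mulVec (fockBasis T)) : A = B := by
  ext S T
  simpa [fockBasis] using congrFun (h T) S

theorem modeCreation_mulVec (k : κ) (f : Finset κ → ℂ) (S : Finset κ) :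
    (modeCreation k).mulVec f S = if k ∈ S then wedgeSign k S * f (S.erase k) else 0 := by
  simp only [Matrix.mulVec, dotProduct, modeCreation, Matrix.of_apply, ite_and, ite_mul, zero_mul]
  split_ifs with h
  · rw [Finset.sum_ite_eq]; simp
  · simp

theorem modeAnnihilation_mulVec (k : κ) (f : Finset κ → ℂ) (S : Finset κ) :
    (modeCreation k).conjTranspose.mulVec f S =
      if k ∈ S then 0 else wedgeSign k S * f (insert k S) := by
  have key : ∀ U : Finset κ, star ((modeCreation k) U S) * f U =
      if U = insert k S then (if k ∈ S then 0 else wedgeSign k S * f (insert k S)) else 0 := by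
    intro T
    simp only [modeCreation, Matrix.of_apply]
    by_cases hT : k ∈ T ∧ T.erase k = S
    · obtain ⟨h1, rfl⟩ := hT
      rw [if_pos ⟨h1, rfl⟩, if_pos (Finset.insert_erase h1).symm, if_neg (by simp),
        Finset.insert_erase h1, wedgeSign_erase_self, Complex.star_def, wedgeSign_conj]
    · rw [if_neg hT, star_zero, zero_mul]
      split_ifs with h1 h2
      · rfl
      · exact absurd ⟨h1 ▸ Finset.mem_insert_self k S, h1 ▸ Finset.erase_insert h2⟩ hT
      · rfl
  simp only [Matrix.mulVec, dotProduct, Matrix.conjTranspose_apply, key]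
  rw [Finset.sum_ite_eq']
  simp

theorem ext_mulVec {A B : Matrix (Finset κ) (Finset κ) ℂ}
    (h : ∀ f S, A.mulVec f S = B.mulVec f S) : A = B :=
  ext_fockBasis fun _ => funext fun S => h _ S

theorem modeCreation_anticomm (j k : κ) :
    modeCreation j * modeCreation k = - (modeCreation k * modeCreation j) := by
  refine ext_mulVec fun f S => ?_
  rw [Matrix.neg_mulVec, Pi.neg_apply, ← Matrix.mulVec_mulVec, ← Matrix.mulVec_mulVec]
  simp only [modeCreation_mulVec, Finset.mem_erase]
  by_cases hjk : j = k
  · subst hjk; simp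
  by_cases hj : j ∈ S
  · by_cases hk : k ∈ S
    · rw [if_pos hj, if_pos hk, if_pos ⟨Ne.symm hjk, hk⟩, if_pos ⟨hjk, hj⟩]
      have h := wedgeSign_anticomm (S := S.erase k) (Finset.mem_erase.2 ⟨hjk, hj⟩)
        (Finset.notMem_erase k S)
      rw [Finset.insert_erase hk, wedgeSign_erase_self, Finset.erase_right_comm,
        wedgeSign_erase_self] at h
      rw [Finset.erase_right_comm]
      -- The relation `h` pairs the four signs in another way than the goal does. Multiplying it by
      -- two of them and using that signs square to one rearranges it.
      linear_combination (f ((S.erase k).erase j)) * (wedgeSign k S * wedgeSign k (S.erase j) * h -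
        wedgeSign j S * wedgeSign k (S.erase j) * wedgeSign_mul_self k S -
        wedgeSign k S * wedgeSign j (S.erase k) * wedgeSign_mul_self k (S.erase j))
    · rw [if_neg hk]; simp [hk]
  · rw [if_neg hj]; simp [hj]

theorem modeAnnihilation_mul_modeCreation (j k : κ) :
    (modeCreation j).conjTranspose * modeCreation k +
      modeCreation k * (modeCreation j).conjTranspose = if j = k then 1 else 0 := by
  refine ext_mulVec fun f S => ?_
  rw [Matrix.add_mulVec, Pi.add_apply, ← Matrix.mulVec_mulVec, ← Matrix.mulVec_mulVec]
  simp only [modeCreation_mulVec, modeAnnihilation_mulVec, Finset.mem_erase, Finset.mem_insert]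
  by_cases hjk : j = k
  · subst hjk
    rw [if_pos rfl, Matrix.one_mulVec]
    by_cases hj : j ∈ S
    · simp only [hj, if_true, ne_eq, not_true, false_and, if_false, zero_add,
        wedgeSign_erase_self, Finset.insert_erase hj]
      linear_combination f S * wedgeSign_mul_self j S
    · simp only [hj, if_false, or_false, if_true, add_zero, wedgeSign_insert_self,
        Finset.erase_insert hj]
      linear_combination f S * wedgeSign_mul_self j S
  · rw [if_neg hjk, Matrix.zero_mulVec, Pi.zero_apply]
    by_cases hj : j ∈ S
    · simp [hj, hjk]
    · by_cases hk : k ∈ S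
      · have h := wedgeSign_anticomm (S := S) hk hj
        simp only [hj, hk, if_true, if_false, or_true, and_false, Ne.symm hjk,
          Finset.erase_insert_of_ne hjk]
        linear_combination (f (insert j (S.erase k))) * h
      · simp [hj, hk, Ne.symm hjk]

theorem creationMatrix_single (k : κ) : creationMatrix (Pi.single k 1) = modeCreation k := by
  simp [creationMatrix, Pi.single_apply]

theorem creationMatrix_anticomm (x y : κ → ℂ) :
    creationMatrix x * creationMatrix y = - (creationMatrix y * creationMatrix x) := by
  simp only [creationMatrix, Finset.sum_mul, Finset.mul_sum, ← Finset.sum_neg_distrib]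
  rw [Finset.sum_comm]
  refine Finset.sum_congr rfl fun k _ => Finset.sum_congr rfl fun j _ => ?_
  rw [smul_mul_smul_comm, smul_mul_smul_comm, modeCreation_anticomm, smul_neg, mul_comm]

theorem creationMatrix_mul_self (x : κ → ℂ) : creationMatrix x * creationMatrix x = 0 :=
  eq_zero_of_eq_neg_self (creationMatrix_anticomm x x)

/-- The canonical anticommutation relations. -/
theorem annihilationMatrix_mul_creationMatrix (x y : κ → ℂ) :
    (creationMatrix x).conjTranspose * creationMatrix y =
      (star x ⬝ᵥ y) • 1 - creationMatrix y * (creationMatrix x).conjTranspose := by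
  rw [eq_sub_iff_add_eq]
  simp only [creationMatrix, Matrix.conjTranspose_sum, Matrix.conjTranspose_smul, Finset.sum_mul,
    Finset.mul_sum]
  rw [Finset.sum_comm, ← Finset.sum_add_distrib]
  simp only [← Finset.sum_add_distrib, smul_mul_smul_comm]
  have : ∀ j k : κ, (star (x j) * y k) • ((modeCreation j).conjTranspose * modeCreation k) +
      (y k * star (x j)) • (modeCreation k * (modeCreation j).conjTranspose) =
      if j = k then (star (x j) * y j) • (1 : Matrix (Finset κ) (Finset κ) ℂ) else 0 := by
    intro j k
    rw [mul_comm (y k), ← smul_add, modeAnnihilation_mul_modeCreation]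
    split_ifs with h
    · rw [h]
    · rw [smul_zero]
  simp only [this, Finset.sum_ite_eq, Finset.mem_univ, if_true, ← Finset.sum_smul]
  rfl

theorem modeCreation_mulVec_fockBasis (k : κ) (T : Finset κ) :
    (modeCreation k).mulVec (fockBasis T) =
      if k ∈ T then 0 else wedgeSign k T • fockBasis (insert k T) := by
  funext S
  rw [modeCreation_mulVec]
  by_cases hT : k ∈ T
  · rw [if_pos hT]
    split_ifs with hS
    · rw [fockBasis, Pi.single_eq_of_ne (fun h => Finset.notMem_erase k S (by rw [h]; exact hT)), mul_zero]; rfl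
    · rfl
  · rw [if_neg hT, Pi.smul_apply, smul_eq_mul, fockBasis, fockBasis]
    by_cases hS : S = insert k T
    · subst hS
      rw [if_pos (Finset.mem_insert_self k T), Finset.erase_insert hT, Pi.single_eq_same,
        Pi.single_eq_same, wedgeSign_insert_self]
    · rw [Pi.single_eq_of_ne hS, mul_zero]
      split_ifs with hk
      · rw [Pi.single_eq_of_ne (fun h => hS (by rw [← h, Finset.insert_erase hk])), mul_zero]
      · rfl

theorem fockBasis_insert {a : κ} {S : Finset κ} (h : ∀ b ∈ S, a < b) :
    fockBasis (insert a S) = (modeCreation a).mulVec (fockBasis S) := by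
  rw [modeCreation_mulVec_fockBasis, if_neg fun hc => lt_irrefl a (h a hc),
    wedgeSign_of_forall_lt h, one_smul]

/-- The vacuum is cyclic: a matrix is determined by its action on the vacuum and its commutation
relations with the creation operators. -/
theorem eq_of_vacuum_of_intertwine {A B : Matrix (Finset κ) (Finset κ) ℂ}
    {Y : κ → Matrix (Finset κ) (Finset κ) ℂ}
    (h0 : A.mulVec (fockBasis ∅) = B.mulVec (fockBasis ∅))
    (hA : ∀ k, A * modeCreation k = Y k * A) (hB : ∀ k, B * modeCreation k = Y k * B) : A = B := by
  refine ext_fockBasis fun T => ?_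
  induction T using Finset.induction_on_min with
  | empty => exact h0
  | insert a s ha ih =>
    rw [fockBasis_insert ha, Matrix.mulVec_mulVec, Matrix.mulVec_mulVec, hA, hB,
      ← Matrix.mulVec_mulVec, ← Matrix.mulVec_mulVec, ih]

/-- The second quantization of a matrix `X`. -/
noncomputable def secondQuantization (X : Matrix κ κ ℂ) : Matrix (Finset κ) (Finset κ) ℂ :=
  Matrix.of fun S T => (orderedProd (fun k => creationMatrix (X.mulVec (Pi.single k 1))) T).mulVec
    (fockBasis ∅) S

theorem secondQuantization_mulVec_fockBasis (X : Matrix κ κ ℂ) (T : Finset κ) :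
    (secondQuantization X).mulVec (fockBasis T) =
      (orderedProd (fun k => creationMatrix (X.mulVec (Pi.single k 1))) T).mulVec (fockBasis ∅) := by
  funext S
  conv_lhs => rw [fockBasis]
  rw [Matrix.mulVec_single_one]
  rfl

theorem secondQuantization_vacuum (X : Matrix κ κ ℂ) :
    (secondQuantization X).mulVec (fockBasis ∅) = fockBasis ∅ := by
  rw [secondQuantization_mulVec_fockBasis, orderedProd_empty, Matrix.one_mulVec]

/-- Inserting the mode `k` into an ordered product costs the same sign before and after `X` is
applied, since the creation matrices of arbitrary vectors anticommute and square to zero. -/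
theorem secondQuantization_mul_modeCreation (X : Matrix κ κ ℂ) (k : κ) :
    secondQuantization X * modeCreation k =
      creationMatrix (X.mulVec (Pi.single k 1)) * secondQuantization X := by
  refine ext_fockBasis fun T => ?_
  have key := congrArg (fun A => A.mulVec (fockBasis ∅)) (mul_orderedProd_of_anticomm
    (z := fun k => creationMatrix (X.mulVec (Pi.single k 1)))
    (fun _ _ => creationMatrix_anticomm _ _) (fun _ => creationMatrix_mul_self _) k T)
  rw [← Matrix.mulVec_mulVec, ← secondQuantization_mulVec_fockBasis] at key
  rw [← Matrix.mulVec_mulVec, ← Matrix.mulVec_mulVec, key, modeCreation_mulVec_fockBasis]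
  split_ifs with h
  · simp
  · rw [Matrix.mulVec_smul, secondQuantization_mulVec_fockBasis, Matrix.smul_mulVec]

theorem creationMatrix_mulVec (X : Matrix κ κ ℂ) (y : κ → ℂ) :
    creationMatrix (X.mulVec y) = ∑ k, y k • creationMatrix (X.mulVec (Pi.single k 1)) := by
  simp only [creationMatrix, Finset.smul_sum, smul_smul]
  rw [Finset.sum_comm]
  refine Finset.sum_congr rfl fun j _ => ?_
  rw [← Finset.sum_smul]
  congr 1
  refine Finset.sum_congr rfl fun k _ => ?_
  rw [Matrix.mulVec_single_one, Matrix.col_apply, mul_comm]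

theorem secondQuantization_mul_creationMatrix (X : Matrix κ κ ℂ) (y : κ → ℂ) :
    secondQuantization X * creationMatrix y = creationMatrix (X.mulVec y) * secondQuantization X := by
  rw [creationMatrix_mulVec, creationMatrix, Finset.mul_sum, Finset.sum_mul]
  refine Finset.sum_congr rfl fun k _ => ?_
  rw [mul_smul_comm, secondQuantization_mul_modeCreation, smul_mul_assoc]

theorem secondQuantization_mul (X Y : Matrix κ κ ℂ) :
    secondQuantization (X * Y) = secondQuantization X * secondQuantization Y := by
  refine eq_of_vacuum_of_intertwine
    (Y := fun k => creationMatrix ((X * Y).mulVec (Pi.single k 1))) ?_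
    (secondQuantization_mul_modeCreation _) fun k => ?_
  · rw [← Matrix.mulVec_mulVec]; simp only [secondQuantization_vacuum]
  · rw [mul_assoc, secondQuantization_mul_modeCreation, ← mul_assoc,
      secondQuantization_mul_creationMatrix, Matrix.mulVec_mulVec, mul_assoc]

theorem secondQuantization_diagonal (d : κ → ℂ) :
    secondQuantization (Matrix.diagonal d) = Matrix.diagonal fun S => ∏ k ∈ S, d k := by
  refine eq_of_vacuum_of_intertwine (secondQuantization_vacuum _ |>.trans ?_)
    (secondQuantization_mul_modeCreation _) fun k => ?_
  · funext S
    rw [Matrix.mulVec_diagonal, fockBasis]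
    by_cases hS : S = ∅
    · subst hS; simp
    · rw [Pi.single_eq_of_ne hS, mul_zero]
  · have : (Matrix.diagonal d).mulVec (Pi.single k 1) = d k • (Pi.single k 1 : κ → ℂ) := by
      rw [Matrix.diagonal_mulVec_single, mul_one, ← Pi.single_smul, smul_eq_mul, mul_one]
    have h2 : creationMatrix (d k • (Pi.single k 1 : κ → ℂ)) = d k • modeCreation k := by
      rw [← creationMatrix_single, creationMatrix, creationMatrix, Finset.smul_sum]
      exact Finset.sum_congr rfl fun j _ => by rw [Pi.smul_apply, smul_assoc]
    rw [this, h2]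
    ext S T
    rw [Matrix.diagonal_mul, Matrix.mul_diagonal, Matrix.smul_apply, modeCreation,
      Matrix.of_apply, smul_eq_mul]
    split_ifs with h
    · obtain ⟨h1, rfl⟩ := h
      rw [← Finset.mul_prod_erase S d h1]
      ring
    · simp

theorem secondQuantization_one : secondQuantization (1 : Matrix κ κ ℂ) = 1 := by
  rw [← Matrix.diagonal_one, secondQuantization_diagonal]
  simp

theorem annihilation_vacuum (y : κ → ℂ) :
    (creationMatrix y).conjTranspose.mulVec (fockBasis ∅) = 0 := by
  simp only [creationMatrix, Matrix.conjTranspose_sum, Matrix.conjTranspose_smul,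
    Matrix.sum_mulVec, Matrix.smul_mulVec]
  refine Finset.sum_eq_zero fun k _ => ?_
  rw [show (modeCreation k).conjTranspose.mulVec (fockBasis ∅) = 0 from ?_, smul_zero]
  funext S
  rw [modeAnnihilation_mulVec]
  split_ifs
  · rfl
  · rw [fockBasis, Pi.single_eq_of_ne (Finset.insert_ne_empty k S), mul_zero]; rfl

/-- The difference of the two sides kills the vacuum. By the anticommutation relations it
intertwines the creation matrices up to a sign, and so does the zero matrix; cyclicity of the vacuum
then gives equality. -/
theorem secondQuantization_mul_annihilation (X : Matrix κ κ ℂ) (y : κ → ℂ) :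
    secondQuantization X * (creationMatrix (X.conjTranspose.mulVec y)).conjTranspose =
      (creationMatrix y).conjTranspose * secondQuantization X := by
  rw [← sub_eq_zero]
  refine eq_of_vacuum_of_intertwine
    (Y := fun k => - creationMatrix (X.mulVec (Pi.single k 1))) ?_ (fun k => ?_) fun k => by simp
  · rw [Matrix.sub_mulVec, ← Matrix.mulVec_mulVec, ← Matrix.mulVec_mulVec, annihilation_vacuum,
      secondQuantization_vacuum, annihilation_vacuum]
    simp
  · have hdot : star (X.conjTranspose.mulVec y) ⬝ᵥ (Pi.single k 1) =
        star y ⬝ᵥ X.mulVec (Pi.single k 1) := by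
      rw [Matrix.star_mulVec, Matrix.conjTranspose_conjTranspose, Matrix.dotProduct_mulVec]
    rw [← creationMatrix_single k, sub_mul, mul_assoc, annihilationMatrix_mul_creationMatrix, hdot,
      mul_assoc, secondQuantization_mul_creationMatrix, ← mul_assoc (creationMatrix y).conjTranspose,
      annihilationMatrix_mul_creationMatrix, mul_sub, sub_mul, ← mul_assoc (secondQuantization X),
      secondQuantization_mul_creationMatrix]
    simp only [Matrix.mul_smul, Matrix.smul_mul, Matrix.mul_one, Matrix.one_mul]
    noncomm_ring

/-- For nonempty `S`, the image of the basis vector at `S` lies in the range of a creation matrix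
and has no vacuum component. -/
theorem secondQuantization_conjTranspose_vacuum (X : Matrix κ κ ℂ) :
    (secondQuantization X).conjTranspose.mulVec (fockBasis ∅) = fockBasis ∅ := by
  have hcol : ∀ (A : Matrix (Finset κ) (Finset κ) ℂ) (S T : Finset κ),
      A.mulVec (fockBasis T) S = A S T := fun A S T => by
    rw [fockBasis, Matrix.mulVec_single_one, Matrix.col_apply]
  funext S
  rw [hcol, Matrix.conjTranspose_apply, ← hcol (secondQuantization X)]
  induction S using Finset.induction_on_min with
  | empty =>
    rw [secondQuantization_vacuum]
    simp [fockBasis]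
  | insert a s ha ih =>
    rw [fockBasis_insert ha, Matrix.mulVec_mulVec, secondQuantization_mul_modeCreation,
      ← Matrix.mulVec_mulVec, creationMatrix, Matrix.sum_mulVec, Finset.sum_apply]
    simp only [Matrix.smul_mulVec, Pi.smul_apply, modeCreation_mulVec, Finset.notMem_empty,
      if_false, smul_zero, Finset.sum_const_zero, star_zero]
    rw [fockBasis, Pi.single_eq_of_ne (Finset.insert_ne_empty a s)]

/-- The adjoint of `secondQuantization_mul_annihilation` is the intertwining relation that
characterizes the second quantization of `X.conjTranspose`. -/
theorem secondQuantization_conjTranspose (X : Matrix κ κ ℂ) :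
    (secondQuantization X).conjTranspose = secondQuantization X.conjTranspose := by
  refine eq_of_vacuum_of_intertwine ((secondQuantization_conjTranspose_vacuum X).trans
    (secondQuantization_vacuum X.conjTranspose).symm) (fun k => ?_)
    (secondQuantization_mul_modeCreation X.conjTranspose)
  have h := congrArg Matrix.conjTranspose
    (secondQuantization_mul_annihilation X (Pi.single k 1))
  rw [Matrix.conjTranspose_mul, Matrix.conjTranspose_mul, Matrix.conjTranspose_conjTranspose,
    Matrix.conjTranspose_conjTranspose, creationMatrix_single] at h
  exact h.symm

end FockMatrices

/-! ### Densities are determined by normally ordered correlations. -/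

section DensityUniqueness

variable {κ : Type*} [LinearOrder κ] [Fintype κ]

/-- The product of the creation operators of the modes in `S`. -/
noncomputable def modeProd (S : Finset κ) : Matrix (Finset κ) (Finset κ) ℂ :=
  orderedProd modeCreation S

/-- The signs need not be computed: later arguments use only where they vanish, that they have
modulus one elsewhere, and their value at `∅`. -/
theorem exists_sign_modeProd (S : Finset κ) : ∃ ε : Finset κ → ℂ,
    (∀ V, (modeProd S).mulVec (fockBasis V) = ε V • fockBasis (S ∪ V)) ∧
    (∀ V, ¬ Disjoint S V → ε V = 0) ∧ (∀ V, Disjoint S V → star (ε V) * ε V = 1) ∧ ε ∅ = 1 := by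
  induction S using Finset.induction_on_min with
  | empty => exact ⟨fun _ => 1, by simp [modeProd], by simp, by simp, rfl⟩
  | insert a s ha ih =>
    obtain ⟨ε, h1, h2, h3, h4⟩ := ih
    refine ⟨fun V => if a ∈ s ∪ V then 0 else ε V * wedgeSign a (s ∪ V), fun V => ?_, fun V hV => ?_,
      fun V hV => ?_, ?_⟩
    · rw [modeProd, orderedProd_insert _ ha, ← Matrix.mulVec_mulVec, ← modeProd, h1,
        Matrix.mulVec_smul, modeCreation_mulVec_fockBasis, Finset.insert_union]
      beta_reduce
      by_cases h : a ∈ s ∪ V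
      · rw [if_pos h, if_pos h, smul_zero, zero_smul]
      · rw [if_neg h, if_neg h, smul_smul]
    · beta_reduce
      by_cases h : a ∈ s ∪ V
      · rw [if_pos h]
      · rw [if_neg h, h2 V, zero_mul]
        rw [Finset.mem_union, not_or] at h
        rw [Finset.disjoint_insert_left] at hV
        exact fun hc => hV ⟨h.2, hc⟩
    · rw [Finset.disjoint_insert_left] at hV
      have has : a ∉ s := fun hc => lt_irrefl a (ha a hc)
      have h : a ∉ s ∪ V := by rw [Finset.mem_union, not_or]; exact ⟨has, hV.1⟩
      have hw : star (wedgeSign a (s ∪ V)) = wedgeSign a (s ∪ V) := wedgeSign_conj _ _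
      beta_reduce
      rw [if_neg h, star_mul, hw]
      linear_combination wedgeSign a (s ∪ V) * wedgeSign a (s ∪ V) * h3 V hV.2 +
        wedgeSign_mul_self a (s ∪ V)
    · have has : a ∉ s := fun hc => lt_irrefl a (ha a hc)
      beta_reduce
      rw [Finset.union_empty, if_neg has, h4, wedgeSign_of_forall_lt ha, one_mul]

theorem mulVec_fockBasis_apply (A : Matrix (Finset κ) (Finset κ) ℂ) (S T : Finset κ) :
    A.mulVec (fockBasis T) S = A S T := by
  rw [fockBasis, Matrix.mulVec_single_one, Matrix.col_apply]

theorem trace_mul_modeProd {ε : Finset κ → Finset κ → ℂ}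
    (h : ∀ S V, (modeProd S).mulVec (fockBasis V) = ε S V • fockBasis (S ∪ V))
    (D : Matrix (Finset κ) (Finset κ) ℂ) (S T : Finset κ) :
    (D * (modeProd S * (modeProd T).conjTranspose)).trace =
      ∑ V, star (ε T V) * ε S V * D (T ∪ V) (S ∪ V) := by
  rw [← mul_assoc, Matrix.trace_mul_comm, Matrix.trace]
  refine Finset.sum_congr rfl fun V _ => ?_
  have hent : ∀ S U V, modeProd S U V = if U = S ∪ V then ε S V else 0 := fun S U V => by
    rw [← mulVec_fockBasis_apply (modeProd S), h, Pi.smul_apply, fockBasis, Pi.single_apply, smul_eq_mul,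
      mul_ite, mul_one, mul_zero]
  rw [Matrix.diag, Matrix.mul_apply]
  simp only [Matrix.conjTranspose_apply, Matrix.mul_apply, hent, mul_ite, mul_zero,
    Finset.sum_ite_eq', Finset.mem_univ, if_true]
  rw [Finset.sum_eq_single (T ∪ V)]
  · rw [if_pos rfl]; ring
  · intro U _ hU
    rw [if_neg hU, star_zero, zero_mul]
  · intro hc; exact absurd (Finset.mem_univ _) hc

/-- A matrix on Fock space is determined by its expectations of normally ordered monomials. -/
theorem eq_zero_of_trace_mul_modeProd {D : Matrix (Finset κ) (Finset κ) ℂ}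
    (hD : ∀ S T, (D * (modeProd S * (modeProd T).conjTranspose)).trace = 0) : D = 0 := by
  choose ε h1 h2 h3 h4 using exists_sign_modeProd (κ := κ)
  -- The system of equations is triangular. The expectation for `S, T` is a signed sum of the
  -- entries `D (T ∪ V) (S ∪ V)`. The term `V = ∅` is `D T S`; every other nonzero term has a larger
  -- row index, which the induction has already treated.
  have key : ∀ n : ℕ, ∀ T : Finset κ, Fintype.card κ - T.card = n → ∀ S, D T S = 0 := by
    intro n
    induction n using Nat.strong_induction_on with
    | _ n ih =>
      intro T hT S
      have := hD S T
      rw [trace_mul_modeProd h1, Finset.sum_eq_single ∅] at this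
      · simpa [h4] using this
      · intro V _ hV
        by_cases hdis : Disjoint T V
        · have hlt : T.card < (T ∪ V).card := by
            rw [Finset.card_union_of_disjoint hdis]
            have := Finset.card_pos.2 (Finset.nonempty_iff_ne_empty.2 hV)
            omega
          have hle := Finset.card_le_univ (T ∪ V)
          rw [ih _ (by omega) (T ∪ V) rfl, mul_zero]
        · rw [h2 T V hdis, star_zero, zero_mul, zero_mul]
      · intro hc; exact absurd (Finset.mem_univ _) hc
  ext T S
  exact key _ T rfl S

theorem eq_of_trace_mul_modeProd {D E : Matrix (Finset κ) (Finset κ) ℂ}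
    (h : ∀ S T, (D * (modeProd S * (modeProd T).conjTranspose)).trace =
      (E * (modeProd S * (modeProd T).conjTranspose)).trace) : D = E := by
  rw [← sub_eq_zero]
  refine eq_zero_of_trace_mul_modeProd fun S T => ?_
  rw [sub_mul, Matrix.trace_sub, h, sub_self]

/-- The probability of the configuration `S` of independent modes with occupation
probabilities `l`. -/
def occupationWeight (l : κ → ℝ) (S : Finset κ) : ℝ := (∏ k ∈ S, l k) * ∏ k ∈ Sᶜ, (1 - l k)

/-- Only sets `V` disjoint from `S` and `T` contribute, and for `S ≠ T` the entry met there is off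
the diagonal. For `S = T` the remaining modes sum to `∏ (l k + (1 - l k)) = 1`. -/
theorem trace_diagonal_occupationWeight (l : κ → ℝ) (S T : Finset κ) :
    (Matrix.diagonal (fun S => (occupationWeight l S : ℂ)) *
      (modeProd S * (modeProd T).conjTranspose)).trace =
      if S = T then ((∏ k ∈ S, l k : ℝ) : ℂ) else 0 := by
  choose ε h1 h2 h3 h4 using exists_sign_modeProd (κ := κ)
  rw [trace_mul_modeProd h1]
  split_ifs with hST
  · subst hST
    have e1 : ∀ V, star (ε S V) * ε S V *
        Matrix.diagonal (fun S => (occupationWeight l S : ℂ)) (S ∪ V) (S ∪ V) =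
        if V ∈ Sᶜ.powerset then (((∏ k ∈ S, l k) *
          ((∏ k ∈ V, l k) * ∏ k ∈ Sᶜ \ V, (1 - l k)) : ℝ) : ℂ) else 0 := fun V => by
      rw [Matrix.diagonal_apply_eq]
      split_ifs with hV
      · rw [Finset.mem_powerset] at hV
        have hd : Disjoint S V := by
          rw [Finset.disjoint_left]
          exact fun x hx hx' => (Finset.mem_compl.1 (hV hx')) hx
        rw [h3 S V hd, one_mul, occupationWeight, Finset.prod_union hd, Finset.compl_union,
          ← Finset.sdiff_eq_inter_compl, mul_assoc]
      · rw [Finset.mem_powerset] at hV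
        rw [h2 S V fun hd => hV fun x hx => Finset.mem_compl.2 fun hc =>
          (Finset.disjoint_left.1 hd hc) hx]
        simp
    rw [Finset.sum_congr rfl fun V _ => e1 V, ← Finset.sum_filter, Finset.filter_univ_mem,
      ← Complex.ofReal_sum, ← Finset.mul_sum, ← Finset.prod_add]
    simp
  · refine Finset.sum_eq_zero fun V _ => ?_
    by_cases hd : Disjoint S V ∧ Disjoint T V
    · rw [Matrix.diagonal_apply_ne, mul_zero]
      intro hc
      apply hST
      have hs : (S ∪ V) \ V = S := by
        rw [Finset.union_sdiff_right, Finset.sdiff_eq_self_of_disjoint hd.1]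
      have ht : (T ∪ V) \ V = T := by
        rw [Finset.union_sdiff_right, Finset.sdiff_eq_self_of_disjoint hd.2]
      rw [← hs, ← ht, hc]
    · rw [not_and_or] at hd
      rcases hd with hd | hd
      · rw [h2 S V hd, mul_zero, zero_mul]
      · rw [h2 T V hd, star_zero, zero_mul, zero_mul]

theorem secondQuantization_mem_unitary {U : Matrix κ κ ℂ} (hU : U * U.conjTranspose = 1) :
    secondQuantization U * (secondQuantization U).conjTranspose = 1 := by
  rw [secondQuantization_conjTranspose, ← secondQuantization_mul, hU, secondQuantization_one]

/-- A density whose normally ordered correlations in the modes `U` are those of independent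
modes with occupation probabilities `l`. -/
theorem density_eq_of_correlations {D : Matrix (Finset κ) (Finset κ) ℂ} {U : Matrix κ κ ℂ}
    (hU : U * U.conjTranspose = 1) {l : κ → ℝ}
    (hD : ∀ S T, (D * (orderedProd (fun k => creationMatrix (U.mulVec (Pi.single k 1))) S *
      (orderedProd (fun k => creationMatrix (U.mulVec (Pi.single k 1))) T).conjTranspose)).trace =
      if S = T then ((∏ k ∈ S, l k : ℝ) : ℂ) else 0) :
    D = secondQuantization U * Matrix.diagonal (fun S => (occupationWeight l S : ℂ)) *
      (secondQuantization U).conjTranspose := by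
  set G := secondQuantization U with hG
  have hGG : G * G.conjTranspose = 1 := secondQuantization_mem_unitary hU
  have hGG' : G.conjTranspose * G = 1 := mul_eq_one_comm.1 hGG
  have hint : ∀ S, G * modeProd S =
      orderedProd (fun k => creationMatrix (U.mulVec (Pi.single k 1))) S * G := fun S =>
    mul_orderedProd (secondQuantization_mul_modeCreation U) S
  -- Conjugation by the second quantization of `U` turns correlations in the modes `U` into
  -- correlations in the standard modes, where the diagonal density has the same values.
  have key : G.conjTranspose * D * G = Matrix.diagonal (fun S => (occupationWeight l S : ℂ)) := by
    refine eq_of_trace_mul_modeProd fun S T => ?_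
    rw [trace_diagonal_occupationWeight, ← hD S T]
    set A := orderedProd (fun k => creationMatrix (U.mulVec (Pi.single k 1))) S
    set B := orderedProd (fun k => creationMatrix (U.mulVec (Pi.single k 1))) T
    have e1 : modeProd S = G.conjTranspose * A * G := by
      rw [mul_assoc, ← hint, ← mul_assoc, hGG', one_mul]
    have e2 : modeProd T = G.conjTranspose * B * G := by
      rw [mul_assoc, ← hint, ← mul_assoc, hGG', one_mul]
    have e3 : G.conjTranspose * D * G * (modeProd S * (modeProd T).conjTranspose) =
        G.conjTranspose * (D * (A * B.conjTranspose)) * G := by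
      rw [e1, e2]
      simp only [Matrix.conjTranspose_mul, Matrix.conjTranspose_conjTranspose]
      calc _ = G.conjTranspose * D * (G * G.conjTranspose) * A * (G * G.conjTranspose) *
            B.conjTranspose * G := by noncomm_ring
        _ = _ := by rw [hGG]; noncomm_ring
    rw [e3, Matrix.trace_mul_comm, ← mul_assoc, hGG, one_mul]
  rw [← key]
  calc D = (G * G.conjTranspose) * D * (G * G.conjTranspose) := by rw [hGG]; simp
    _ = _ := by noncomm_ring

end DensityUniqueness

/-! ### Functional calculus through diagonalizations. -/

section FunctionalCalculus

theorem isHermitian_conj_diagonal {ι ι' : Type*} [Fintype ι'] [DecidableEq ι'] (G : Matrix ι ι' ℂ)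
    (d : ι' → ℝ) :
    (G * Matrix.diagonal (fun i => (d i : ℂ)) * G.conjTranspose).IsHermitian := by
  refine Matrix.isHermitian_mul_mul_conjTranspose G ?_
  rw [Matrix.IsHermitian, Matrix.diagonal_conjTranspose]
  congr 1
  funext i
  simp

variable {ι : Type*} [Fintype ι] [DecidableEq ι]

/-- Functional calculus of a Hermitian matrix on a family of eigenvectors. -/
theorem cfc_mul_of_mul_eq {ι' : Type*} [Fintype ι'] [DecidableEq ι'] {A : Matrix ι ι ℂ}
    (hA : A.IsHermitian) {X : Matrix ι ι' ℂ} {d : ι' → ℝ}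
    (h : A * X = X * Matrix.diagonal (fun i => (d i : ℂ))) (f : ℝ → ℝ) :
    cfc f A * X = X * Matrix.diagonal (fun i => (f (d i) : ℂ)) := by
  set U : Matrix ι ι ℂ := (hA.eigenvectorUnitary : Matrix ι ι ℂ) with hU
  have hU1 : U * star U = 1 := Unitary.mul_star_self_of_mem hA.eigenvectorUnitary.2
  have hU2 : star U * U = 1 := Unitary.star_mul_self_of_mem hA.eigenvectorUnitary.2
  have hspec : A = U * Matrix.diagonal (fun i => (hA.eigenvalues i : ℂ)) * star U := by
    conv_lhs => rw [hA.spectral_theorem, Unitary.conjStarAlgAut_apply]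
    rfl
  have hcfc : cfc f A = U * Matrix.diagonal (fun i => (f (hA.eigenvalues i) : ℂ)) * star U := by
    rw [hA.cfc_eq, Matrix.IsHermitian.cfc, Unitary.conjStarAlgAut_apply]
    rfl
  have hW : Matrix.diagonal (fun i => (hA.eigenvalues i : ℂ)) * (star U * X) =
      star U * X * Matrix.diagonal (fun i => (d i : ℂ)) := by
    rw [Matrix.mul_assoc, ← h]
    conv_rhs => rw [hspec]
    simp only [← Matrix.mul_assoc]
    rw [hU2, Matrix.one_mul]
  -- Entrywise, `hW` says that an entry of `star U * X` vanishes unless the two eigenvalues agree.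
  -- The same dichotomy settles the identity for `f`.
  have hW' : Matrix.diagonal (fun i => (f (hA.eigenvalues i) : ℂ)) * (star U * X) =
      star U * X * Matrix.diagonal (fun i => (f (d i) : ℂ)) := by
    ext i j
    have hij := congrFun (congrFun hW i) j
    rw [Matrix.diagonal_mul, Matrix.mul_diagonal] at hij ⊢
    by_cases h0 : (star U * X) i j = 0
    · rw [h0, mul_zero, zero_mul]
    · rw [mul_comm] at hij
      rw [Complex.ofReal_injective (mul_left_cancel₀ h0 hij), mul_comm]
  rw [hcfc, Matrix.mul_assoc, Matrix.mul_assoc, hW', ← Matrix.mul_assoc, ← Matrix.mul_assoc, hU1,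
    Matrix.one_mul]

/-- Functional calculus of a diagonalized matrix; the matrix of eigenvectors may be indexed by
different types. -/
theorem cfc_conj_diagonal {ι' : Type*} [Fintype ι'] [DecidableEq ι'] {G : Matrix ι ι' ℂ}
    (hG : G * G.conjTranspose = 1) (hG' : G.conjTranspose * G = 1) (d : ι' → ℝ) (f : ℝ → ℝ) :
    cfc f (G * Matrix.diagonal (fun i => (d i : ℂ)) * G.conjTranspose) =
      G * Matrix.diagonal (fun i => (f (d i) : ℂ)) * G.conjTranspose := by
  have h := cfc_mul_of_mul_eq (isHermitian_conj_diagonal G d) (X := G) (d := d)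
    (by rw [Matrix.mul_assoc, hG', Matrix.mul_one]) f
  rw [← h, Matrix.mul_assoc (cfc _ _) G, hG, Matrix.mul_one]

theorem cfc_eq_conj_diagonal {A : Matrix ι ι ℂ} (hA : A.IsHermitian) (f : ℝ → ℝ) :
    cfc f A = (hA.eigenvectorUnitary : Matrix ι ι ℂ) *
      Matrix.diagonal (fun i => (f (hA.eigenvalues i) : ℂ)) *
      (hA.eigenvectorUnitary : Matrix ι ι ℂ).conjTranspose := by
  rw [hA.cfc_eq, Matrix.IsHermitian.cfc, Unitary.conjStarAlgAut_apply]
  rfl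

theorem eq_conj_diagonal {A : Matrix ι ι ℂ} (hA : A.IsHermitian) :
    A = (hA.eigenvectorUnitary : Matrix ι ι ℂ) *
      Matrix.diagonal (fun i => (hA.eigenvalues i : ℂ)) *
      (hA.eigenvectorUnitary : Matrix ι ι ℂ).conjTranspose := by
  conv_lhs => rw [hA.spectral_theorem, Unitary.conjStarAlgAut_apply]
  rfl

theorem eigenvectorUnitary_mul_conjTranspose {A : Matrix ι ι ℂ} (hA : A.IsHermitian) :
    (hA.eigenvectorUnitary : Matrix ι ι ℂ) * (hA.eigenvectorUnitary : Matrix ι ι ℂ).conjTranspose =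
      1 := Unitary.mul_star_self_of_mem hA.eigenvectorUnitary.2

theorem trace_cfc {A : Matrix ι ι ℂ} (hA : A.IsHermitian) (f : ℝ → ℝ) :
    (cfc f A).trace = ((∑ i, f (hA.eigenvalues i) : ℝ) : ℂ) := by
  rw [cfc_eq_conj_diagonal hA, Matrix.trace_mul_comm, ← Matrix.mul_assoc,
    mul_eq_one_comm.1 (eigenvectorUnitary_mul_conjTranspose hA), Matrix.one_mul,
    Matrix.trace_diagonal]
  push_cast
  rfl

end FunctionalCalculus

/-! ### Powers and overlaps of quasi-free densities. -/

section QuasiFreeDensity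

variable {κ : Type*} [LinearOrder κ] [Fintype κ]

/-- The quasi-free density with one-particle matrix `Q`. -/
noncomputable def quasiFreeDensity {Q : Matrix κ κ ℂ} (hQ : Q.IsHermitian) :
    Matrix (Finset κ) (Finset κ) ℂ :=
  secondQuantization (hQ.eigenvectorUnitary : Matrix κ κ ℂ) *
    Matrix.diagonal (fun S => (occupationWeight hQ.eigenvalues S : ℂ)) *
    (secondQuantization (hQ.eigenvectorUnitary : Matrix κ κ ℂ)).conjTranspose

theorem occupationWeight_pos {l : κ → ℝ} (hl : ∀ k, l k ∈ Set.Ioo (0 : ℝ) 1) (S : Finset κ) :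
    0 < occupationWeight l S :=
  mul_pos (Finset.prod_pos fun k _ => (hl k).1)
    (Finset.prod_pos fun k _ => by linarith [(hl k).2])

/-- Taking out the vacuum probability `∏ (1 - l k)` leaves a product of the odds over the occupied
modes, which is the diagonal of a second quantization. -/
theorem occupationWeight_rpow {l : κ → ℝ} (hl : ∀ k, l k ∈ Set.Ioo (0 : ℝ) 1) (t : ℝ)
    (S : Finset κ) : occupationWeight l S ^ t =
      Real.exp (t * ∑ k, Real.log (1 - l k)) * ∏ k ∈ S, (l k / (1 - l k)) ^ t := by
  have h1 : ∀ k, 0 < 1 - l k := fun k => by linarith [(hl k).2]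
  have h2 : occupationWeight l S = (∏ k, (1 - l k)) * ∏ k ∈ S, l k / (1 - l k) := by
    rw [occupationWeight, ← Finset.prod_mul_prod_compl S, Finset.prod_div_distrib]
    have : ∏ k ∈ S, (1 - l k) ≠ 0 := Finset.prod_ne_zero_iff.2 fun k _ => (h1 k).ne'
    field_simp
  rw [h2, Real.mul_rpow (Finset.prod_nonneg fun k _ => (h1 k).le)
    (Finset.prod_nonneg fun k _ => div_nonneg (hl k).1.le (h1 k).le),
    Real.finsetProd_rpow _ _ fun k _ => div_nonneg (hl k).1.le (h1 k).le]
  congr 1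
  rw [Real.rpow_def_of_pos (Finset.prod_pos fun k _ => h1 k), Real.log_prod fun k _ => (h1 k).ne',
    mul_comm]

theorem mpow_quasiFreeDensity {Q : Matrix κ κ ℂ} (hQ : Q.IsHermitian)
    (hl : ∀ k, hQ.eigenvalues k ∈ Set.Ioo (0 : ℝ) 1) (t : ℝ) :
    mpow (quasiFreeDensity hQ) t =
      (Real.exp (t * (cfc (fun x : ℝ => Real.log (1 - x)) Q).trace.re) : ℂ) •
        secondQuantization (cfc (fun x : ℝ => (x / (1 - x)) ^ t) Q) := by
  have hU := eigenvectorUnitary_mul_conjTranspose hQ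
  set U : Matrix κ κ ℂ := (hQ.eigenvectorUnitary : Matrix κ κ ℂ) with hUdef
  have hG := secondQuantization_mem_unitary hU
  rw [mpow, quasiFreeDensity, cfc_conj_diagonal hG (mul_eq_one_comm.1 hG), trace_cfc hQ,
    Complex.ofReal_re, cfc_eq_conj_diagonal hQ (fun x : ℝ => (x / (1 - x)) ^ t),
    secondQuantization_mul, secondQuantization_mul,
    ← secondQuantization_conjTranspose, secondQuantization_diagonal, ← Matrix.smul_mul, ← Matrix.mul_smul, ← Matrix.diagonal_smul]
  congr 3
  funext S
  rw [if_neg (occupationWeight_pos hl S).ne', occupationWeight_rpow hl, Pi.smul_apply, smul_eq_mul]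
  push_cast
  rfl

/-- In an eigenbasis the trace is the sum over all subsets of products of eigenvalues, that is `∏ (1
+ w i)`. The absolute value is harmless for `W ≥ 0` and makes the function continuous on all of `ℝ`,
as `hasSymbol_overlap` needs. -/
theorem trace_secondQuantization_of_posSemidef {W : Matrix κ κ ℂ} (hW : W.PosSemidef) :
    (secondQuantization W).trace =
      (Real.exp (cfc (fun x : ℝ => Real.log (1 + |x|)) W).trace.re : ℂ) := by
  have hU := eigenvectorUnitary_mul_conjTranspose hW.1
  rw [trace_cfc hW.1, Complex.ofReal_re]
  conv_lhs => rw [eq_conj_diagonal hW.1]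
  rw [secondQuantization_mul, Matrix.trace_mul_comm, ← secondQuantization_mul, ← Matrix.mul_assoc,
    mul_eq_one_comm.1 hU, Matrix.one_mul, secondQuantization_diagonal, Matrix.trace_diagonal,
    Real.exp_sum]
  have : ∀ i, Real.exp (Real.log (1 + |hW.1.eigenvalues i|)) = 1 + hW.1.eigenvalues i := fun i => by
    rw [abs_of_nonneg (hW.eigenvalues_nonneg i), Real.exp_log]
    linarith [hW.eigenvalues_nonneg i]
  simp only [this]
  rw [Finset.prod_one_add, Finset.powerset_univ]
  push_cast
  rfl

/-- The overlap of two quasi-free densities. -/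
theorem logOverlap_quasiFreeDensity {Q R : Matrix κ κ ℂ} (hQ : Q.IsHermitian) (hR : R.IsHermitian)
    (hl : ∀ k, hQ.eigenvalues k ∈ Set.Ioo (0 : ℝ) 1)
    (hm : ∀ k, hR.eigenvalues k ∈ Set.Ioo (0 : ℝ) 1) (t : ℝ) :
    logOverlap (quasiFreeDensity hQ) (quasiFreeDensity hR) t =
      t * (cfc (fun x : ℝ => Real.log (1 - x)) Q).trace.re +
      (1 - t) * (cfc (fun x : ℝ => Real.log (1 - x)) R).trace.re +
      (cfc (fun x : ℝ => Real.log (1 + |x|))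
        (cfc (fun x : ℝ => (x / (1 - x)) ^ (t / 2)) Q * cfc (fun x : ℝ => (x / (1 - x)) ^ (1 - t)) R *
          cfc (fun x : ℝ => (x / (1 - x)) ^ (t / 2)) Q)).trace.re := by
  set X := cfc (fun x : ℝ => (x / (1 - x)) ^ (t / 2)) Q with hX
  set Y := cfc (fun x : ℝ => (x / (1 - x)) ^ (1 - t)) R with hY
  have hXX : cfc (fun x : ℝ => (x / (1 - x)) ^ t) Q = X * X := by
    rw [hX, ← cfc_mul _ _ Q ((Matrix.finite_real_spectrum (A := Q)).continuousOn _)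
      ((Matrix.finite_real_spectrum (A := Q)).continuousOn _)]
    refine cfc_congr fun x hx => ?_
    obtain ⟨i, rfl⟩ := hQ.spectrum_real_eq_range_eigenvalues ▸ hx
    have : 0 < hQ.eigenvalues i / (1 - hQ.eigenvalues i) :=
      div_pos (hl i).1 (by linarith [(hl i).2])
    rw [← Real.rpow_add this, add_halves]
  have hXh : X.conjTranspose = X := (cfc_predicate (p := IsSelfAdjoint) _ Q : IsSelfAdjoint X)
  have hYpos : Y.PosSemidef := by
    rw [hY, cfc_eq_conj_diagonal hR]
    refine Matrix.PosSemidef.mul_mul_conjTranspose_same (Matrix.PosSemidef.diagonal fun i => ?_) _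
    exact Complex.zero_le_real.2 (Real.rpow_nonneg
      (div_nonneg (hm i).1.le (by linarith [(hm i).2])) _)
  -- Halving the power of the odds of `Q` and cycling the trace replaces the product of two positive
  -- matrices, which need not be Hermitian, by a positive semidefinite one.
  have hW : (X * Y * X).PosSemidef := by
    have := hYpos.mul_mul_conjTranspose_same X
    rwa [hXh] at this
  rw [logOverlap, mpow_quasiFreeDensity hQ hl, mpow_quasiFreeDensity hR hm, smul_mul_smul_comm,
    Matrix.trace_smul, hXX, ← secondQuantization_mul, Matrix.mul_assoc, secondQuantization_mul,
    Matrix.trace_mul_comm, ← secondQuantization_mul, trace_secondQuantization_of_posSemidef hW,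
    smul_eq_mul, ← Complex.ofReal_mul, ← Complex.ofReal_mul, Complex.ofReal_re, ← Real.exp_add,
    ← Real.exp_add, Real.log_exp]

theorem posDef_quasiFreeDensity {Q : Matrix κ κ ℂ} (hQ : Q.IsHermitian)
    (hl : ∀ k, hQ.eigenvalues k ∈ Set.Ioo (0 : ℝ) 1) : (quasiFreeDensity hQ).PosDef := by
  have hG := secondQuantization_mem_unitary (eigenvectorUnitary_mul_conjTranspose hQ)
  rw [quasiFreeDensity]
  refine Matrix.PosDef.mul_mul_conjTranspose_same ?_ ?_
  · exact Matrix.PosDef.diagonal fun S => Complex.zero_lt_real.2 (occupationWeight_pos hl S)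
  · exact Matrix.vecMul_injective_of_isUnit (IsUnit.of_mul_eq_one _ hG)

end QuasiFreeDensity

/-! ### Fock operators restricted to finitely many sites. -/

section LocalOperators

/-- The set of sites of a subset of `u`. -/
def siteSet {κ : Type*} {u : Finset κ} (S : Finset ↥u) : Finset κ := S.map (Function.Embedding.subtype _)

theorem siteSet_subset {κ : Type*} {u : Finset κ} (S : Finset ↥u) : siteSet S ⊆ u := by
  intro k hk
  obtain ⟨j, _, rfl⟩ := Finset.mem_map.1 hk
  exact j.2

theorem siteSet_injective {κ : Type*} {u : Finset κ} : Function.Injective (siteSet (u := u)) :=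
  Finset.map_injective _

variable {κ : Type*} [LinearOrder κ]

/-- Equality of sites is decided by the order. -/
abbrev decidableEqSites (u : Finset κ) : DecidableEq ↥u := LinearOrder.toDecidableEq

attribute [local instance] decidableEqSites

/-- The unit vector of the site `k`. -/
noncomputable def siteVec (k : κ) : OneParticle κ := lp.single 2 k 1

/-- The basis vector of the Fock space with occupied sites `S`. -/
noncomputable def occVec (S : Finset κ) : FockSpace κ := lp.single 2 S 1

theorem inner_siteVec (k : κ) (x : OneParticle κ) : ⟪siteVec k, x⟫_ℂ = x k := by
  rw [siteVec, lp.inner_single_left]; simp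

theorem inner_occVec (S : Finset κ) (f : FockSpace κ) : ⟪occVec S, f⟫_ℂ = f S := by
  rw [occVec, lp.inner_single_left]; simp

theorem siteVec_apply (k j : κ) : siteVec k j = if j = k then 1 else 0 := by
  rw [siteVec, lp.single_apply, Pi.single_apply]

theorem occVec_apply (S T : Finset κ) : occVec S T = if T = S then 1 else 0 := by
  rw [occVec, lp.single_apply, Pi.single_apply]

theorem creation_apply (x : OneParticle κ) (f : FockSpace κ) (S : Finset κ) :
    creation x f S = wedgeFun x f S := rfl

/-- `A` leaves the Fock space of the sites `u` invariant. -/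
def PreservesFock (u : Finset κ) (A : FockSpace κ →L[ℂ] FockSpace κ) : Prop :=
  ∀ T ⊆ u, ∀ S, ¬ S ⊆ u → A (occVec T) S = 0

theorem exists_siteSet_eq {u : Finset κ} {T : Finset κ} (h : T ⊆ u) :
    ∃ S : Finset ↥u, siteSet S = T := by
  refine ⟨T.subtype (· ∈ u), ?_⟩
  rw [siteSet, Finset.subtype_map, Finset.filter_true_of_mem fun k hk => h hk]

/-- The matrix of `A` on the Fock space of the sites `u`. -/
noncomputable def fockMatrix (u : Finset κ) (A : FockSpace κ →L[ℂ] FockSpace κ) :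
    Matrix (Finset ↥u) (Finset ↥u) ℂ :=
  Matrix.of fun S T => A (occVec (siteSet T)) (siteSet S)

theorem fockMatrix_one (u : Finset κ) : fockMatrix u 1 = 1 := by
  ext S T
  rw [fockMatrix, Matrix.of_apply, one_apply_eq_self, occVec_apply, Matrix.one_apply]
  simp only [siteSet_injective.eq_iff]

theorem preservesFock_one (u : Finset κ) : PreservesFock u 1 := fun T hT S hS => by
  rw [one_apply_eq_self, occVec_apply, if_neg]
  rintro rfl
  exact hS hT

theorem PreservesFock.apply_occVec {u : Finset κ} {B : FockSpace κ →L[ℂ] FockSpace κ}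
    (hB : PreservesFock u B) {T : Finset κ} (hT : T ⊆ u) :
    B (occVec T) = ∑ V : Finset ↥u, B (occVec T) (siteSet V) • occVec (siteSet V) := by
  ext S
  rw [lp.coeFn_sum, Finset.sum_apply]
  simp only [lp.coeFn_smul, Pi.smul_apply, occVec_apply, smul_eq_mul, mul_ite, mul_one, mul_zero]
  by_cases hS : S ⊆ u
  · obtain ⟨V, rfl⟩ := exists_siteSet_eq hS
    simp [siteSet_injective.eq_iff]
  · rw [hB T hT S hS, Finset.sum_eq_zero]
    intro V _
    rw [if_neg]
    rintro rfl
    exact hS (siteSet_subset V)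

/-- Only the right factor has to preserve the local Fock space: the matrix of `A` is then evaluated
on vectors of that space alone. -/
theorem fockMatrix_mul {u : Finset κ} (A : FockSpace κ →L[ℂ] FockSpace κ)
    {B : FockSpace κ →L[ℂ] FockSpace κ} (hB : PreservesFock u B) :
    fockMatrix u (A * B) = fockMatrix u A * fockMatrix u B := by
  ext S T
  rw [Matrix.mul_apply, fockMatrix, Matrix.of_apply, mul_apply_eq_comp,
    hB.apply_occVec (siteSet_subset T), map_sum, lp.coeFn_sum, Finset.sum_apply]
  refine Finset.sum_congr rfl fun V _ => ?_
  rw [map_smul, lp.coeFn_smul, Pi.smul_apply, smul_eq_mul, mul_comm]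
  rfl

theorem PreservesFock.mul {u : Finset κ} {A B : FockSpace κ →L[ℂ] FockSpace κ}
    (hA : PreservesFock u A) (hB : PreservesFock u B) : PreservesFock u (A * B) := by
  intro T hT S hS
  rw [mul_apply_eq_comp, hB.apply_occVec hT, map_sum, lp.coeFn_sum, Finset.sum_apply]
  refine Finset.sum_eq_zero fun V _ => ?_
  rw [map_smul, lp.coeFn_smul, Pi.smul_apply, hA _ (siteSet_subset V) S hS, smul_zero]

theorem PreservesFock.list_prod {u : Finset κ} {l : List (FockSpace κ →L[ℂ] FockSpace κ)}
    (h : ∀ A ∈ l, PreservesFock u A) :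
    PreservesFock u l.prod ∧ fockMatrix u l.prod = (l.map (fockMatrix u)).prod := by
  induction l with
  | nil => exact ⟨preservesFock_one u, fockMatrix_one u⟩
  | cons A l ih =>
    have := ih fun B hB => h B (List.mem_cons_of_mem _ hB)
    rw [List.prod_cons, List.map_cons, List.prod_cons, ← this.2]
    exact ⟨(h A List.mem_cons_self).mul this.1, fockMatrix_mul A this.1⟩

theorem preservesFock_creation {u : Finset κ} {x : OneParticle κ} (hx : ∀ k ∉ u, x k = 0) :
    PreservesFock u (creation x) := by
  intro T hT S hS
  rw [creation_apply, wedgeFun]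
  refine Finset.sum_eq_zero fun k hk => ?_
  rw [occVec_apply]
  split_ifs with h
  · rw [hx k, zero_mul, zero_mul]
    intro hku
    refine hS ?_
    rw [← Finset.insert_erase hk, h]
    exact Finset.insert_subset hku hT
  · rw [mul_zero]

theorem annihilation_occVec_apply (x : OneParticle κ) (S T : Finset κ) :
    annihilation x (occVec T) S = conj (creation x (occVec S) T) := by
  rw [← inner_occVec, annihilation, ContinuousLinearMap.adjoint_inner_right, ← inner_conj_symm,
    inner_occVec]

/-- Removing a particle never leaves the sites `u`, hence no condition on the support of `x`, in
contrast to creation. -/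
theorem preservesFock_annihilation (u : Finset κ) (x : OneParticle κ) :
    PreservesFock u (annihilation x) := by
  intro T hT S hS
  rw [annihilation_occVec_apply, creation_apply, wedgeFun, Finset.sum_eq_zero, map_zero]
  intro k _
  rw [occVec_apply, if_neg, mul_zero]
  rintro rfl
  exact hS ((Finset.erase_subset _ _).trans hT)

theorem fockMatrix_annihilation (u : Finset κ) (x : OneParticle κ) :
    fockMatrix u (annihilation x) = (fockMatrix u (creation x)).conjTranspose := by
  ext S T
  exact annihilation_occVec_apply x _ _

theorem wedgeSign_siteSet {u : Finset κ} (k : ↥u) (S : Finset ↥u) :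
    wedgeSign (k : κ) (siteSet S) = wedgeSign k S := by
  rw [wedgeSign, wedgeSign, siteSet, Finset.filter_map, Finset.card_map]
  rfl

theorem siteSet_erase {u : Finset κ} (k : ↥u) (S : Finset ↥u) :
    (siteSet S).erase k = siteSet (S.erase k) := by
  rw [siteSet, siteSet, Finset.map_erase]; rfl

theorem fockMatrix_creation (u : Finset κ) (x : OneParticle κ) :
    fockMatrix u (creation x) = creationMatrix (fun k : ↥u => x k) := by
  ext S T
  rw [fockMatrix, Matrix.of_apply, creation_apply, wedgeFun, creationMatrix, Matrix.sum_apply,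
    ← Finset.sum_subset (Finset.subset_univ S)]
  · rw [siteSet, Finset.sum_map]
    refine Finset.sum_congr rfl fun k hk => ?_
    rw [Matrix.smul_apply, modeCreation, Matrix.of_apply, ← siteSet, occVec_apply]
    simp only [hk, true_and, Function.Embedding.subtype_apply, wedgeSign_siteSet, siteSet_erase,
      siteSet_injective.eq_iff, smul_eq_mul, mul_ite, mul_one, mul_zero]
  · intro k _ hk
    rw [Matrix.smul_apply, modeCreation, Matrix.of_apply, if_neg fun h => hk h.1, smul_zero]

/-- Extension by zero of a function on the sites `u`. -/
noncomputable def extendVec {u : Finset κ} (v : ↥u → ℂ) : OneParticle κ := ∑ k, v k • siteVec (k : κ)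

theorem extendVec_apply {u : Finset κ} (v : ↥u → ℂ) (k : ↥u) : extendVec v k = v k := by
  rw [extendVec, lp.coeFn_sum, Finset.sum_apply]
  simp [siteVec_apply]

theorem extendVec_apply_of_notMem {u : Finset κ} (v : ↥u → ℂ) {k : κ} (hk : k ∉ u) :
    extendVec v k = 0 := by
  rw [extendVec, lp.coeFn_sum, Finset.sum_apply]
  refine Finset.sum_eq_zero fun j _ => ?_
  rw [lp.coeFn_smul, Pi.smul_apply, siteVec_apply, if_neg, smul_zero]
  rintro rfl
  exact hk j.2

/-- The compression of an operator to the sites `u`. -/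
noncomputable def compression (u : Finset κ) (Q : OneParticle κ →L[ℂ] OneParticle κ) :
    Matrix ↥u ↥u ℂ := Matrix.of fun k l => Q (siteVec (l : κ)) k

theorem inner_extendVec {u : Finset κ} (Q : OneParticle κ →L[ℂ] OneParticle κ) (v w : ↥u → ℂ) :
    ⟪extendVec v, Q (extendVec w)⟫_ℂ = star v ⬝ᵥ (compression u Q).mulVec w := by
  rw [extendVec, extendVec, map_sum, sum_inner, dotProduct]
  refine Finset.sum_congr rfl fun k _ => ?_
  rw [inner_smul_left, inner_siteVec, lp.coeFn_sum, Finset.sum_apply, Matrix.mulVec, dotProduct]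
  congr 1
  refine Finset.sum_congr rfl fun l _ => ?_
  rw [map_smul, lp.coeFn_smul, Pi.smul_apply, smul_eq_mul, mul_comm]
  rfl

theorem fockMatrix_carMonomial {u : Finset κ} {m n : ℕ} (x : Fin m → ↥u → ℂ) (y : Fin n → ↥u → ℂ) :
    fockMatrix u (carMonomial (fun i => extendVec (x i)) (fun i => extendVec (y i)) :
        FockSpace κ →L[ℂ] FockSpace κ) =
      (List.ofFn fun i => creationMatrix (x i)).prod *
        (List.ofFn fun i => creationMatrix (y i)).prod.conjTranspose := by
  have hc : (carMonomial (fun i => extendVec (x i)) (fun i => extendVec (y i)) :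
      FockSpace κ →L[ℂ] FockSpace κ) = (List.ofFn fun i => creation (extendVec (x i))).prod *
      (List.ofFn fun i => annihilation (extendVec (y i))).reverse.prod := by
    rw [carMonomial, MulMemClass.coe_mul, SubmonoidClass.coe_list_prod,
      SubmonoidClass.coe_list_prod, List.map_reverse, List.map_ofFn, List.map_ofFn]
    congr 3
    funext i
    exact ContinuousLinearMap.adjoint_adjoint _
  have h1 := PreservesFock.list_prod (u := u)
    (l := List.ofFn fun i => creation (extendVec (x i))) fun A hA => by
      obtain ⟨i, rfl⟩ := List.mem_ofFn.1 hA
      exact preservesFock_creation fun k hk => extendVec_apply_of_notMem _ hk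
  have h2 := PreservesFock.list_prod (u := u)
    (l := (List.ofFn fun i => annihilation (extendVec (y i))).reverse) fun A hA => by
      obtain ⟨i, rfl⟩ := List.mem_ofFn.1 (List.mem_reverse.1 hA)
      exact preservesFock_annihilation u _
  rw [hc, fockMatrix_mul _ h2.1, h1.2, h2.2, Matrix.conjTranspose_list_prod, List.map_reverse,
    List.map_ofFn, List.map_ofFn, List.map_ofFn]
  have hx : ∀ v : ↥u → ℂ, fockMatrix u (creation (extendVec v)) = creationMatrix v := fun v => by
    rw [fockMatrix_creation]
    congr 1
    funext k
    exact extendVec_apply v k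
  have e1 : (fockMatrix u ∘ fun i => creation (extendVec (x i))) = fun i => creationMatrix (x i) :=
    funext fun i => hx _
  have e2 : (fockMatrix u ∘ fun i => annihilation (extendVec (y i))) =
      Matrix.conjTranspose ∘ fun i => creationMatrix (y i) :=
    funext fun i => by
      rw [Function.comp_apply, Function.comp_apply, fockMatrix_annihilation, hx]
  rw [e1, e2]

theorem carMonomial_mem {W : Set (OneParticle κ)} {m n : ℕ} {x : Fin m → OneParticle κ}
    {y : Fin n → OneParticle κ} (hx : ∀ i, x i ∈ W) (hy : ∀ i, y i ∈ W) :
    (carMonomial x y : FockSpace κ →L[ℂ] FockSpace κ) ∈ carAlgebra W := by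
  have h : ∀ z ∈ W, annihilation z ∈ carAlgebra W := fun z hz =>
    StarSubalgebra.le_topologicalClosure _ (StarAlgebra.subset_adjoin ℂ _ ⟨z, hz, rfl⟩)
  rw [carMonomial, MulMemClass.coe_mul, SubmonoidClass.coe_list_prod,
      SubmonoidClass.coe_list_prod]
  refine mul_mem (list_prod_mem fun A hA => ?_) (list_prod_mem fun A hA => ?_)
  · obtain ⟨B, hB, rfl⟩ := List.mem_map.1 hA
    obtain ⟨i, rfl⟩ := List.mem_ofFn.1 hB
    exact star_mem (h _ (hx i))
  · obtain ⟨B, hB, rfl⟩ := List.mem_map.1 hA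
    obtain ⟨i, rfl⟩ := List.mem_ofFn.1 (List.mem_reverse.1 hB)
    exact h _ (hy i)

end LocalOperators

/-! ### The local density of a quasi-free state. -/

theorem ofFn_orderEmbOfFin_prod {κ M : Type*} [LinearOrder κ] [Monoid M] (z : κ → M) {m : ℕ}
    (S : Finset κ) (h : S.card = m) :
    (List.ofFn fun i => z (S.orderEmbOfFin h i)).prod = orderedProd z S := by
  subst h
  rw [orderedProd]
  congr 1
  refine List.ext_getElem (by simp) fun i h1 h2 => ?_
  simp [Finset.orderEmbOfFin_apply]

section LocalDensity

variable {κ : Type*} [LinearOrder κ]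

attribute [local instance] decidableEqSites

/-- In the eigenmodes of the compressed symbol the two-point matrix is diagonal. The determinant
formula then yields the correlations of independent modes, which determine the density by
`density_eq_of_correlations`. -/
theorem density_eq_quasiFreeDensity {ω : AlgState (carAlgebra (Set.univ : Set (OneParticle κ)))}
    {Q : OneParticle κ →L[ℂ] OneParticle κ} (hω : IsQuasiFree ω Q) {u : Finset κ}
    (hQ : (compression u Q).IsHermitian) {W : Set (OneParticle κ)}
    (hW : ∀ v : ↥u → ℂ, extendVec v ∈ W) {D : Matrix (Finset ↥u) (Finset ↥u) ℂ}
    (hD : ∀ A : carAlgebra (Set.univ : Set (OneParticle κ)),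
      (A : FockSpace κ →L[ℂ] FockSpace κ) ∈ carAlgebra W →
      ω.toLin A = (D * fockMatrix u A).trace) : D = quasiFreeDensity hQ := by
  have hU := eigenvectorUnitary_mul_conjTranspose hQ
  refine density_eq_of_correlations hU fun S T => ?_
  set U : Matrix ↥u ↥u ℂ := (hQ.eigenvectorUnitary : Matrix ↥u ↥u ℂ) with hUdef
  have hdiag : ∀ j k, ⟪extendVec (U.mulVec (Pi.single j 1)),
      Q (extendVec (U.mulVec (Pi.single k 1)))⟫_ℂ = if j = k then (hQ.eigenvalues k : ℂ) else 0 := by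
    intro j k
    have hd : U.conjTranspose * compression u Q * U =
        Matrix.diagonal fun i => (hQ.eigenvalues i : ℂ) := by
      calc _ = U.conjTranspose *
            (U * Matrix.diagonal (fun i => (hQ.eigenvalues i : ℂ)) * U.conjTranspose) * U :=
            congrArg (fun A => U.conjTranspose * A * U) (eq_conj_diagonal hQ)
        _ = (U.conjTranspose * U) * Matrix.diagonal (fun i => (hQ.eigenvalues i : ℂ)) *
            (U.conjTranspose * U) := by noncomm_ring
        _ = _ := by rw [mul_eq_one_comm.1 hU]; simp
    have := congrFun (congrFun hd j) k
    rw [Matrix.diagonal_apply] at this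
    rw [inner_extendVec]
    have e : (U.conjTranspose * compression u Q * U) j k = star (U.mulVec (Pi.single j 1)) ⬝ᵥ
        (compression u Q).mulVec (U.mulVec (Pi.single k 1)) := by
      rw [Matrix.mulVec_single_one, Matrix.mulVec_single_one, Matrix.mul_assoc, Matrix.mul_apply]
      refine Finset.sum_congr rfl fun i _ => ?_
      congr 1
    rw [← e, this]
    by_cases hjk : j = k
    · subst hjk; simp
    · simp [hjk]
  -- The lengths are kept free so that, when the cardinalities agree, both sets can be enumerated by
  -- the same `Fin S.card`, as the determinant formula requires.
  have hval : ∀ (m n : ℕ) (hm : S.card = m) (hn : T.card = n),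
      (D * (orderedProd (fun k => creationMatrix (U.mulVec (Pi.single k 1))) S *
        (orderedProd (fun k => creationMatrix (U.mulVec (Pi.single k 1))) T).conjTranspose)).trace =
      ω.toLin (carMonomial (fun i => extendVec (U.mulVec (Pi.single (S.orderEmbOfFin hm i) 1)))
        (fun i => extendVec (U.mulVec (Pi.single (T.orderEmbOfFin hn i) 1)))) := by
    intro m n hm hn
    rw [hD _ (carMonomial_mem (fun _ => hW _) fun _ => hW _), fockMatrix_carMonomial,
      ofFn_orderEmbOfFin_prod (fun k => creationMatrix (U.mulVec (Pi.single k 1))),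
      ofFn_orderEmbOfFin_prod (fun k => creationMatrix (U.mulVec (Pi.single k 1)))]
  by_cases hcard : S.card = T.card
  · rw [hval _ _ rfl hcard.symm, hω.1]
    split_ifs with hST
    · subst hST
      have : (Matrix.of fun i j => ⟪extendVec (U.mulVec (Pi.single (S.orderEmbOfFin rfl i) 1)),
          Q (extendVec (U.mulVec (Pi.single (S.orderEmbOfFin rfl j) 1)))⟫_ℂ) =
          Matrix.diagonal fun i => (hQ.eigenvalues (S.orderEmbOfFin rfl i) : ℂ) := by
        ext i j
        rw [Matrix.of_apply, hdiag, Matrix.diagonal_apply]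
        by_cases hij : i = j
        · subst hij; simp
        · rw [if_neg hij, if_neg fun hc => hij ((S.orderEmbOfFin rfl).injective hc)]
      rw [this, Matrix.det_diagonal]
      conv_rhs => rw [← Finset.map_orderEmbOfFin_univ S rfl]
      rw [Finset.prod_map]
      push_cast
      rfl
    -- A mode of `T` outside `S` is orthogonal, with respect to the compressed symbol, to all modes
    -- of `S` and produces a zero row of the determinant.
    · obtain ⟨k, hkT, hkS⟩ : ∃ k ∈ T, k ∉ S := by
        by_contra hc
        push Not at hc
        exact hST (Finset.eq_of_subset_of_card_le hc hcard.le).symm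
      obtain ⟨i, rfl⟩ : ∃ i, T.orderEmbOfFin hcard.symm i = k := by
        have : k ∈ Set.range (T.orderEmbOfFin hcard.symm) := by
          rw [Finset.range_orderEmbOfFin]; exact hkT
        exact this
      refine Matrix.det_eq_zero_of_row_eq_zero i fun j => ?_
      rw [Matrix.of_apply, hdiag, if_neg]
      intro hc
      exact hkS (hc ▸ Finset.orderEmbOfFin_mem S rfl j)
  · rw [hval _ _ rfl rfl, hω.2 _ _ _ _ hcard, if_neg fun h => hcard (by rw [h])]

end LocalDensity

/-! ### The Hilbert–Schmidt norm. -/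

section HilbertSchmidt

open scoped Matrix.Norms.L2Operator

variable {ι : Type*} [Fintype ι]

/-- The Hilbert–Schmidt norm. -/
noncomputable def hsNorm (M : Matrix ι ι ℂ) : ℝ :=
  ‖(WithLp.toLp 2 (fun p : ι × ι => M p.1 p.2) : EuclideanSpace ℂ (ι × ι))‖

theorem hsNorm_nonneg (M : Matrix ι ι ℂ) : 0 ≤ hsNorm M := norm_nonneg _

theorem hsNorm_add_le (M N : Matrix ι ι ℂ) : hsNorm (M + N) ≤ hsNorm M + hsNorm N :=
  norm_add_le (WithLp.toLp 2 (fun p : ι × ι => M p.1 p.2) : EuclideanSpace ℂ (ι × ι))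
    (WithLp.toLp 2 (fun p : ι × ι => N p.1 p.2))

theorem hsNorm_smul (c : ℂ) (M : Matrix ι ι ℂ) : hsNorm (c • M) = ‖c‖ * hsNorm M :=
  norm_smul c (WithLp.toLp 2 (fun p : ι × ι => M p.1 p.2) : EuclideanSpace ℂ (ι × ι))

theorem hsNorm_zero : hsNorm (0 : Matrix ι ι ℂ) = 0 :=
  norm_zero (E := EuclideanSpace ℂ (ι × ι))

theorem hsNorm_sq (M : Matrix ι ι ℂ) : hsNorm M ^ 2 = ∑ j, ∑ i, ‖M i j‖ ^ 2 := by
  rw [hsNorm, EuclideanSpace.norm_sq_eq, Fintype.sum_prod_type_right]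

theorem hsNorm_conjTranspose (M : Matrix ι ι ℂ) : hsNorm M.conjTranspose = hsNorm M := by
  rw [← sq_eq_sq₀ (hsNorm_nonneg _) (hsNorm_nonneg _), hsNorm_sq, hsNorm_sq, Finset.sum_comm]
  simp

/-- The Cauchy–Schwarz inequality on the diagonal. -/
theorem norm_trace_le (M : Matrix ι ι ℂ) : ‖M.trace‖ ≤ √(Fintype.card ι) * hsNorm M := by
  refine (norm_sum_le _ _).trans ?_
  rw [← sq_le_sq₀ (Finset.sum_nonneg fun _ _ => norm_nonneg _)
    (mul_nonneg (Real.sqrt_nonneg _) (hsNorm_nonneg _)), mul_pow, Real.sq_sqrt (by positivity),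
    hsNorm_sq]
  refine sq_sum_le_card_mul_sum_sq.trans ?_
  rw [Finset.card_univ]
  gcongr with i
  exact Finset.single_le_sum (f := fun j => ‖M j i‖ ^ 2) (fun _ _ => by positivity)
    (Finset.mem_univ i)

variable [DecidableEq ι]

theorem sum_norm_mulVec_sq_le (M : Matrix ι ι ℂ) (v : ι → ℂ) :
    ∑ i, ‖M.mulVec v i‖ ^ 2 ≤ ‖M‖ ^ 2 * ∑ i, ‖v i‖ ^ 2 := by
  have := Matrix.l2_opNorm_mulVec M (WithLp.toLp 2 v)
  have h2 := pow_le_pow_left₀ (norm_nonneg _) this 2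
  rwa [mul_pow, EuclideanSpace.norm_sq_eq, EuclideanSpace.norm_sq_eq] at h2

theorem hsNorm_mul_le (M N : Matrix ι ι ℂ) : hsNorm (M * N) ≤ ‖M‖ * hsNorm N := by
  rw [← sq_le_sq₀ (hsNorm_nonneg _) (mul_nonneg (norm_nonneg _) (hsNorm_nonneg _)), mul_pow,
    hsNorm_sq, hsNorm_sq, Finset.mul_sum]
  exact Finset.sum_le_sum fun j _ => sum_norm_mulVec_sq_le M (fun i => N i j)

theorem hsNorm_mul_le' (M N : Matrix ι ι ℂ) : hsNorm (M * N) ≤ hsNorm M * ‖N‖ := by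
  rw [← hsNorm_conjTranspose, Matrix.conjTranspose_mul, ← hsNorm_conjTranspose M, mul_comm,
    ← Matrix.l2_opNorm_conjTranspose N]
  exact hsNorm_mul_le _ _

theorem hsNorm_one : hsNorm (1 : Matrix ι ι ℂ) = √(Fintype.card ι) := by
  rw [← sq_eq_sq₀ (hsNorm_nonneg _) (Real.sqrt_nonneg _), hsNorm_sq, Real.sq_sqrt (by positivity)]
  simp [Matrix.one_apply, apply_ite, ite_pow]

theorem hsNorm_le (M : Matrix ι ι ℂ) : hsNorm M ≤ ‖M‖ * √(Fintype.card ι) := by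
  have := hsNorm_mul_le M 1
  rwa [mul_one, hsNorm_one] at this

theorem l2_opNorm_le_of_sum_sq_le {M : Matrix ι ι ℂ} {C : ℝ} (hC : 0 ≤ C)
    (h : ∀ v : ι → ℂ, ∑ i, ‖M.mulVec v i‖ ^ 2 ≤ C ^ 2 * ∑ i, ‖v i‖ ^ 2) : ‖M‖ ≤ C := by
  rw [Matrix.l2_opNorm_def]
  refine ContinuousLinearMap.opNorm_le_bound _ hC fun v => ?_
  rw [← sq_le_sq₀ (norm_nonneg _) (mul_nonneg hC (norm_nonneg _)), mul_pow,
    EuclideanSpace.norm_sq_eq, EuclideanSpace.norm_sq_eq]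
  exact h v

end HilbertSchmidt

/-! ### Compressions to finitely many sites. -/

section Compression

open scoped Matrix.Norms.L2Operator

theorem sum_norm_sq_le {κ : Type*} (u : Finset κ) (x : OneParticle κ) : ∑ k : ↥u, ‖x k‖ ^ 2 ≤ ‖x‖ ^ 2 := by
  have h := lp.sum_rpow_le_norm_rpow (by simp : 0 < (2 : ℝ≥0∞).toReal) x u
  simp only [ENNReal.toReal_ofNat, Real.rpow_ofNat] at h
  rwa [Finset.sum_coe_sort u fun k => ‖x k‖ ^ 2]

variable {κ : Type*} [LinearOrder κ]

attribute [local instance] decidableEqSites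

theorem compression_one (u : Finset κ) :
    compression u (1 : OneParticle κ →L[ℂ] OneParticle κ) = 1 := by
  ext k l
  rw [compression, Matrix.of_apply, one_apply_eq_self, siteVec_apply, Matrix.one_apply]
  simp only [Subtype.coe_inj]

theorem norm_extendVec_sq {u : Finset κ} (v : ↥u → ℂ) : ‖extendVec v‖ ^ 2 = ∑ k, ‖v k‖ ^ 2 := by
  have h := inner_extendVec (1 : OneParticle κ →L[ℂ] OneParticle κ) v v
  rw [one_apply_eq_self, inner_self_eq_norm_sq_to_K] at h
  rw [compression_one, Matrix.one_mulVec] at h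
  have h2 : (star v ⬝ᵥ v) = ((∑ k, ‖v k‖ ^ 2 : ℝ) : ℂ) := by
    rw [dotProduct]
    push_cast
    refine Finset.sum_congr rfl fun k _ => ?_
    rw [Pi.star_apply]
    exact Complex.conj_mul' _
  rw [h2] at h
  refine Complex.ofReal_injective ?_
  rw [← h]
  push_cast
  rfl

theorem compression_mulVec {u : Finset κ} (A : OneParticle κ →L[ℂ] OneParticle κ) (v : ↥u → ℂ)
    (k : ↥u) : (compression u A).mulVec v k = A (extendVec v) k := by
  rw [extendVec, map_sum, lp.coeFn_sum, Finset.sum_apply, Matrix.mulVec, dotProduct]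
  refine Finset.sum_congr rfl fun l _ => ?_
  rw [map_smul, lp.coeFn_smul, Pi.smul_apply, smul_eq_mul, mul_comm]
  rfl

theorem norm_compression_le (u : Finset κ) (A : OneParticle κ →L[ℂ] OneParticle κ) :
    ‖compression u A‖ ≤ ‖A‖ := by
  refine l2_opNorm_le_of_sum_sq_le (norm_nonneg _) fun v => ?_
  simp only [compression_mulVec]
  refine (sum_norm_sq_le u _).trans ?_
  rw [← norm_extendVec_sq, ← mul_pow]
  exact pow_le_pow_left₀ (norm_nonneg _) (A.le_opNorm _) 2

theorem compression_add (u : Finset κ) (A B : OneParticle κ →L[ℂ] OneParticle κ) :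
    compression u (A + B) = compression u A + compression u B := rfl

theorem compression_sub (u : Finset κ) (A B : OneParticle κ →L[ℂ] OneParticle κ) :
    compression u (A - B) = compression u A - compression u B := rfl

theorem compression_smul (u : Finset κ) (c : ℂ) (A : OneParticle κ →L[ℂ] OneParticle κ) :
    compression u (c • A) = c • compression u A := rfl

theorem norm_sub_extendVec_sq (u : Finset κ) (x : OneParticle κ) :
    ‖x - extendVec (fun k : ↥u => x k)‖ ^ 2 = ‖x‖ ^ 2 - ∑ k : ↥u, ‖x k‖ ^ 2 := by
  have h1 : ⟪extendVec (fun k : ↥u => x k), x⟫_ℂ = ((∑ k : ↥u, ‖x k‖ ^ 2 : ℝ) : ℂ) := by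
    rw [extendVec, sum_inner]
    push_cast
    refine Finset.sum_congr rfl fun k _ => ?_
    rw [inner_smul_left, inner_siteVec]
    exact Complex.conj_mul' _
  rw [norm_sub_sq (𝕜 := ℂ), norm_extendVec_sq, ← inner_conj_symm, h1]
  simp only [Complex.conj_ofReal, RCLike.re_to_complex, Complex.ofReal_re]
  ring

/-- The compression is multiplicative up to the part of `B` that leaves `u`. -/
theorem hsNorm_compression_mul_sub_le (u : Finset κ) (A B : OneParticle κ →L[ℂ] OneParticle κ) :
    hsNorm (compression u (A * B) - compression u A * compression u B) ^ 2 ≤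
      ‖A‖ ^ 2 * ∑ l : ↥u, (‖B (siteVec (l : κ))‖ ^ 2 - ∑ k : ↥u, ‖B (siteVec (l : κ)) k‖ ^ 2) := by
  rw [hsNorm_sq, Finset.mul_sum]
  refine Finset.sum_le_sum fun l _ => ?_
  set x := B (siteVec (l : κ)) with hx
  rw [← norm_sub_extendVec_sq u x]
  -- With the projection `P` onto `u`, this is `PABP - PAPBP = PA(1 - P)BP`, read off column by
  -- column.
  have h : ∀ k : ↥u, (compression u (A * B) - compression u A * compression u B) k l =
      A (x - extendVec (fun k : ↥u => x k)) k := fun k => by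
    rw [Matrix.sub_apply, map_sub, lp.coeFn_sub, Pi.sub_apply, ← compression_mulVec]
    rfl
  simp only [h]
  refine (sum_norm_sq_le u _).trans ?_
  rw [← mul_pow]
  exact pow_le_pow_left₀ (norm_nonneg _) (A.le_opNorm _) 2

theorem isHermitian_compression {u : Finset κ} {A : OneParticle κ →L[ℂ] OneParticle κ}
    (hA : IsSelfAdjoint A) : (compression u A).IsHermitian := by
  ext k l
  rw [Matrix.conjTranspose_apply, compression, Matrix.of_apply, Matrix.of_apply, ← inner_siteVec,
    ← inner_siteVec]
  have := ContinuousLinearMap.isSelfAdjoint_iff_isSymmetric.1 hA (siteVec (k : κ)) (siteVec (l : κ))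
  rw [← ContinuousLinearMap.coe_coe A, ← this]
  exact inner_conj_symm _ _

theorem posSemidef_compression {u : Finset κ} {A : OneParticle κ →L[ℂ] OneParticle κ}
    (hA : A.IsPositive) : (compression u A).PosSemidef := by
  refine Matrix.PosSemidef.of_dotProduct_mulVec_nonneg (isHermitian_compression hA.isSelfAdjoint)
    fun v => ?_
  rw [← inner_extendVec]
  exact hA.inner_nonneg_right _

/-- Bounds on the quadratic form pass to compressions and are the same as bounds on the spectrum. -/
theorem spectrum_compression_subset {u : Finset κ} {A : OneParticle κ →L[ℂ] OneParticle κ}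
    {a b : ℝ} (h1 : (A - (a : ℂ) • 1).IsPositive) (h2 : ((b : ℂ) • 1 - A).IsPositive) :
    spectrum ℝ (compression u A) ⊆ Set.Icc a b := by
  have hsa : IsSelfAdjoint A := by
    have := h1.isSelfAdjoint.add (IsSelfAdjoint.smul (Complex.conj_ofReal a)
      (IsSelfAdjoint.one (OneParticle κ →L[ℂ] OneParticle κ)))
    rwa [sub_add_cancel] at this
  have hh : IsSelfAdjoint (compression u A) := isHermitian_compression hsa
  open scoped MatrixOrder in
  have e1 := (algebraMap_le_iff_le_spectrum (r := a) (a := compression u A) hh).1 (by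
    rw [Matrix.le_iff]
    have := posSemidef_compression (u := u) h1
    rwa [compression_sub, compression_smul, compression_one, Complex.coe_smul,
      ← Algebra.algebraMap_eq_smul_one] at this)
  open scoped MatrixOrder in
  have e2 := (le_algebraMap_iff_spectrum_le (r := b) (a := compression u A) hh).1 (by
    rw [Matrix.le_iff]
    have := posSemidef_compression (u := u) h2
    rwa [compression_sub, compression_smul, compression_one, Complex.coe_smul,
      ← Algebra.algebraMap_eq_smul_one] at this)
  exact fun x hx => ⟨e1 x hx, e2 x hx⟩

end Compression

/-! ### Shift-invariant operators as multiplication operators. -/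

section Multiplication

variable {ν : ℕ}

theorem latticeFourier_siteVec (k : Site ν) : latticeFourier ν (siteVec k) = planeWaveLp k := by
  rw [latticeFourier, siteVec, OrthogonalFamily.linearIsometry_apply_single]
  exact one_smul ℂ _

theorem planeWave_sub (k l : Site ν) (x : Fin ν → ℝ) :
    planeWave (k - l) x = planeWave k x * conj (planeWave l x) := by
  rw [planeWave, planeWave, planeWave, ← Complex.exp_conj, ← Complex.exp_add, map_mul,
    Complex.conj_I, Complex.conj_ofReal, neg_mul, ← sub_eq_add_neg, ← mul_sub, ← Complex.ofReal_sub,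
    ← Finset.sum_sub_distrib]
  congr 3
  refine Finset.sum_congr rfl fun i _ => ?_
  rw [ofLex_sub, Pi.sub_apply]
  push_cast
  ring

/-- The Fourier coefficient of `a` at `-m`. -/
noncomputable def symbolCoeff (a : (Fin ν → ℝ) → ℝ) (m : Site ν) : ℂ :=
  ∫ x, (a x : ℂ) * planeWave (-m) x ∂momentumMeasure ν

variable {A B : OneParticle (Site ν) →L[ℂ] OneParticle (Site ν)} {a b : (Fin ν → ℝ) → ℝ}

theorem CARLattice.IsMultiplication.inner_eq (hA : IsMultiplication A a)
    (f g : OneParticle (Site ν)) :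
    ⟪f, A g⟫_ℂ = ∫ x, (a x : ℂ) * (latticeFourier ν g x * conj (latticeFourier ν f x))
      ∂momentumMeasure ν := by
  rw [← (latticeFourier ν).inner_map_map, L2.inner_def]
  refine integral_congr_ae ?_
  filter_upwards [hA g] with x hx
  rw [hx, RCLike.inner_apply, mul_assoc]

theorem CARLattice.IsMultiplication.siteVec_apply (hA : IsMultiplication A a) (k l : Site ν) :
    A (siteVec l) k = symbolCoeff a (k - l) := by
  rw [← inner_siteVec, hA.inner_eq, symbolCoeff, latticeFourier_siteVec, latticeFourier_siteVec]
  refine integral_congr_ae ?_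
  filter_upwards [(memLp_planeWave k).coeFn_toLp, (memLp_planeWave l).coeFn_toLp] with x hk hl
  rw [planeWaveLp, planeWaveLp, hk, hl, neg_sub, planeWave_sub]

/-- Column `l` of `A` is a translate of the coefficient sequence, so its norm does not depend on
`l`. This square summability drives the asymptotic multiplicativity of compressions. -/
theorem CARLattice.IsMultiplication.hasSum_symbolCoeff (hA : IsMultiplication A a) (l : Site ν) :
    HasSum (fun m => ‖symbolCoeff a m‖ ^ 2) (‖A (siteVec l)‖ ^ 2) := by
  have h := lp.hasSum_norm (by simp : 0 < (2 : ℝ≥0∞).toReal) (A (siteVec l))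
  simp only [ENNReal.toReal_ofNat, Real.rpow_ofNat, hA.siteVec_apply] at h
  exact (Equiv.subRight l).hasSum_iff.1 h

theorem CARLattice.IsMultiplication.add (hA : IsMultiplication A a) (hB : IsMultiplication B b) :
    IsMultiplication (A + B) (fun x => a x + b x) := fun f => by
  rw [add_apply, map_add]
  filter_upwards [hA f, hB f, Lp.coeFn_add (latticeFourier ν (A f)) (latticeFourier ν (B f))]
    with x h1 h2 h3
  rw [h3, Pi.add_apply, h1, h2]
  push_cast
  ring

theorem CARLattice.IsMultiplication.smul (hA : IsMultiplication A a) (c : ℝ) :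
    IsMultiplication ((c : ℂ) • A) (fun x => c * a x) := fun f => by
  rw [smul_apply, map_smul]
  filter_upwards [hA f, Lp.coeFn_smul (c : ℂ) (latticeFourier ν (A f))] with x h1 h2
  rw [h2, Pi.smul_apply, h1, smul_eq_mul]
  push_cast
  ring

theorem isMultiplication_one :
    IsMultiplication (1 : OneParticle (Site ν) →L[ℂ] OneParticle (Site ν)) (fun _ => 1) :=
  fun f => by simp

theorem CARLattice.IsMultiplication.mul (hA : IsMultiplication A a) (hB : IsMultiplication B b) :
    IsMultiplication (A * B) (fun x => a x * b x) := fun f => by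
  rw [mul_apply_eq_comp]
  filter_upwards [hA (B f), hB f] with x h1 h2
  rw [h1, h2]
  push_cast
  ring

theorem CARLattice.IsMultiplication.aeval (hA : IsMultiplication A a) (p : Polynomial ℝ) :
    IsMultiplication (Polynomial.aeval A p) (fun x => p.eval (a x)) := by
  induction p using Polynomial.induction_on' with
  | add p q hp hq =>
    simp only [map_add, Polynomial.eval_add]
    exact hp.add hq
  | monomial n c =>
    have hpow : IsMultiplication (A ^ n) (fun x => a x ^ n) := by
      induction n with
      | zero => simpa using isMultiplication_one
      | succ n ih => simpa only [pow_succ] using ih.mul hA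
    have := hpow.smul c
    rw [Complex.coe_smul] at this
    simp only [Polynomial.aeval_monomial, Polynomial.eval_monomial,
      Algebra.algebraMap_eq_smul_one, smul_mul_assoc, one_mul]
    exact this

theorem CARLattice.IsMultiplication.isPositive (hA : IsMultiplication A a)
    (ha : ∀ᵐ x ∂momentumMeasure ν, 0 ≤ a x) : A.IsPositive := by
  rw [ContinuousLinearMap.isPositive_def]
  refine ⟨fun f g => ?_, fun f => ?_⟩
  · rw [ContinuousLinearMap.coe_coe, hA.inner_eq, ← inner_conj_symm, hA.inner_eq, ← integral_conj]
    refine integral_congr_ae (Eventually.of_forall fun x => ?_)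
    simp only [map_mul, Complex.conj_ofReal, Complex.conj_conj]
    ring
  · rw [ContinuousLinearMap.reApplyInnerSelf_apply, ← inner_conj_symm, hA.inner_eq]
    have : ∀ x, (a x : ℂ) * (latticeFourier ν f x * conj (latticeFourier ν f x)) =
        ((a x * ‖latticeFourier ν f x‖ ^ 2 : ℝ) : ℂ) := fun x => by
      rw [Complex.mul_conj']
      push_cast
      rfl
    simp only [this]
    rw [integral_complex_ofReal, Complex.conj_ofReal, RCLike.re_to_complex, Complex.ofReal_re]
    refine integral_nonneg_of_ae ?_
    filter_upwards [ha] with x hx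
    positivity

theorem CARLattice.IsMultiplication.isPositive_sub (hA : IsMultiplication A a) {c : ℝ}
    (ha : ∀ᵐ x ∂momentumMeasure ν, c ≤ a x) : (A - (c : ℂ) • 1).IsPositive := by
  have h := hA.add (isMultiplication_one.smul (-c))
  rw [Complex.ofReal_neg, neg_smul, ← sub_eq_add_neg] at h
  refine h.isPositive ?_
  filter_upwards [ha] with x hx
  linarith

theorem CARLattice.IsMultiplication.isPositive_sub' (hA : IsMultiplication A a) {c : ℝ}
    (ha : ∀ᵐ x ∂momentumMeasure ν, a x ≤ c) : ((c : ℂ) • 1 - A).IsPositive := by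
  have h := (isMultiplication_one.smul c).add (hA.smul (-1))
  rw [Complex.ofReal_neg, neg_smul, ← sub_eq_add_neg, Complex.ofReal_one, one_smul] at h
  refine h.isPositive ?_
  filter_upwards [ha] with x hx
  linarith

theorem spectrum_subset_of_isPositive {H : Type*} [NormedAddCommGroup H] [InnerProductSpace ℂ H]
    [CompleteSpace H] {A : H →L[ℂ] H} {c d : ℝ} (h1 : (A - (c : ℂ) • 1).IsPositive)
    (h2 : ((d : ℂ) • 1 - A).IsPositive) : IsSelfAdjoint A ∧ spectrum ℝ A ⊆ Set.Icc c d := by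
  have hsa : IsSelfAdjoint A := by
    have := h1.isSelfAdjoint.add (IsSelfAdjoint.smul (Complex.conj_ofReal c)
      (IsSelfAdjoint.one (H →L[ℂ] H)))
    rwa [sub_add_cancel] at this
  rw [Complex.coe_smul, ← Algebra.algebraMap_eq_smul_one] at h1 h2
  have e1 := (algebraMap_le_iff_le_spectrum (r := c) (a := A) hsa).1 h1
  have e2 := (le_algebraMap_iff_spectrum_le (r := d) (a := A) hsa).1 h2
  exact ⟨hsa, fun x hx => ⟨e1 x hx, e2 x hx⟩⟩

noncomputable instance instContinuousFunctionalCalculusOneParticle {κ : Type*} :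
    IsometricContinuousFunctionalCalculus ℝ (OneParticle κ →L[ℂ] OneParticle κ) IsSelfAdjoint :=
  IsSelfAdjoint.instIsometricContinuousFunctionalCalculus

theorem eLpNorm_latticeFourier (f : OneParticle (Site ν)) :
    eLpNorm (latticeFourier ν f) 2 (momentumMeasure ν) = ENNReal.ofReal ‖f‖ := by
  rw [← (latticeFourier ν).norm_map f, Lp.norm_def, ENNReal.ofReal_toReal (Lp.eLpNorm_ne_top _)]

/-- Multiplication operators are closed under norm limits with uniformly convergent symbols. The
comparison uses `eLpNorm`, because membership of the product `a · F f` in `L²` is not assumed. -/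
theorem isMultiplication_of_forall_near (ha : AEMeasurable a (momentumMeasure ν))
    (h : ∀ ε > 0, ∃ B b, IsMultiplication B b ∧ ‖A - B‖ ≤ ε ∧
      ∀ᵐ x ∂momentumMeasure ν, |b x - a x| ≤ ε) : IsMultiplication A a := by
  intro f
  set g : (Fin ν → ℝ) → ℂ := fun x => (a x : ℂ) * latticeFourier ν f x with hg
  have hgm : AEStronglyMeasurable g (momentumMeasure ν) :=
    (Complex.measurable_ofReal.comp_aemeasurable ha).aestronglyMeasurable.mul
      (Lp.aestronglyMeasurable _)
  have hle : ∀ ε > 0, eLpNorm (latticeFourier ν (A f) - g : (Fin ν → ℝ) → ℂ) 2 (momentumMeasure ν) ≤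
      ENNReal.ofReal (ε * (2 * ‖f‖)) := by
    intro ε hε
    obtain ⟨B, b, hB, hAB, hab⟩ := h ε hε
    have e1 : eLpNorm (latticeFourier ν (A f) - latticeFourier ν (B f) : (Fin ν → ℝ) → ℂ) 2
        (momentumMeasure ν) ≤ ENNReal.ofReal (ε * ‖f‖) := by
      rw [← eLpNorm_congr_ae (Lp.coeFn_sub _ _), ← map_sub, eLpNorm_latticeFourier]
      refine ENNReal.ofReal_le_ofReal ?_
      rw [← sub_apply]
      exact (ContinuousLinearMap.le_opNorm _ _).trans
        (mul_le_mul_of_nonneg_right hAB (norm_nonneg _))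
    have e2 : eLpNorm (latticeFourier ν (B f) - g : (Fin ν → ℝ) → ℂ) 2 (momentumMeasure ν) ≤
        ENNReal.ofReal (ε * ‖f‖) := by
      rw [ENNReal.ofReal_mul hε.le, ← eLpNorm_latticeFourier]
      refine eLpNorm_le_mul_eLpNorm_of_ae_le_mul ?_ 2
      filter_upwards [hB f, hab] with x h1 h2
      rw [Pi.sub_apply, h1, hg, ← sub_mul, norm_mul, ← Complex.ofReal_sub, Complex.norm_real]
      exact mul_le_mul_of_nonneg_right h2 (norm_nonneg _)
    have e3 : (latticeFourier ν (A f) - g : (Fin ν → ℝ) → ℂ) =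
        (latticeFourier ν (A f) - latticeFourier ν (B f)) + (latticeFourier ν (B f) - g) := by
      abel
    rw [e3]
    refine (eLpNorm_add_le ((Lp.aestronglyMeasurable _).sub (Lp.aestronglyMeasurable _))
      ((Lp.aestronglyMeasurable _).sub hgm) (by norm_num)).trans ((add_le_add e1 e2).trans ?_)
    rw [← ENNReal.ofReal_add (by positivity) (by positivity)]
    exact ENNReal.ofReal_le_ofReal (by linarith)
  have h0 : eLpNorm (latticeFourier ν (A f) - g : (Fin ν → ℝ) → ℂ) 2 (momentumMeasure ν) = 0 := by
    refine le_antisymm (ENNReal.le_of_forall_pos_le_add fun δ hδ _ => ?_) zero_le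
    -- The added `1` keeps the denominator positive when `f = 0`.
    have hp : 0 < (δ : ℝ) / (2 * ‖f‖ + 1) := by positivity
    refine (hle _ hp).trans ?_
    rw [zero_add]
    refine ENNReal.ofReal_le_of_le_toReal ?_
    rw [ENNReal.coe_toReal, div_mul_eq_mul_div, div_le_iff₀ (by positivity)]
    have : 0 ≤ (δ : ℝ) := δ.2
    nlinarith
  rw [eLpNorm_eq_zero_iff ((Lp.aestronglyMeasurable _).sub hgm) (by norm_num)] at h0
  filter_upwards [h0] with x hx
  exact sub_eq_zero.1 hx

/-- For polynomials the claim is algebraic; Weierstrass approximation on an interval containing the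
spectrum and almost all values of `a` gives the general case. -/
theorem CARLattice.IsMultiplication.cfc (hA : IsMultiplication A a) (hsa : IsSelfAdjoint A)
    (ham : AEMeasurable a (momentumMeasure ν)) {c d : ℝ} (hs : spectrum ℝ A ⊆ Set.Icc c d)
    (ha : ∀ᵐ x ∂momentumMeasure ν, a x ∈ Set.Icc c d) {f : ℝ → ℝ} (hf : Measurable f)
    (hfc : ContinuousOn f (Set.Icc c d)) : IsMultiplication (cfc f A) (fun x => f (a x)) := by
  refine isMultiplication_of_forall_near (hf.comp_aemeasurable ham) fun ε hε => ?_
  obtain ⟨p, hp⟩ := exists_polynomial_near_of_continuousOn c d f hfc ε hε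
  refine ⟨_, _, hA.aeval p, ?_, ?_⟩
  · rw [← cfc_polynomial p A, ← cfc_sub _ _ A (hfc.mono hs)]
    refine norm_cfc_le hε.le fun x hx => ?_
    rw [Real.norm_eq_abs, abs_sub_comm]
    exact (hp x (hs hx)).le
  · filter_upwards [ha] with x hx
    exact (hp _ hx).le

end Multiplication

/-! ### Counting shifts in large boxes. -/

section Box

variable {ν : ℕ}

theorem mem_box {n : ℕ} {k : Site ν} : k ∈ box ν n ↔ ∀ i, 0 ≤ ofLex k i ∧ ofLex k i < n := by
  rw [box, Finset.mem_map]
  constructor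
  · rintro ⟨f, hf, rfl⟩ i
    exact Finset.mem_Ico.1 (Fintype.mem_piFinset.1 hf i)
  · exact fun h => ⟨ofLex k, Fintype.mem_piFinset.2 fun i => Finset.mem_Ico.2 (h i), rfl⟩

theorem card_box (n : ℕ) : (box ν n).card = n ^ ν := by
  rw [box, Finset.card_map, Fintype.card_piFinset]
  simp

theorem tendsto_card_shift (m : ℤ) : Tendsto (fun n : ℕ =>
    (((Finset.Ico (0 : ℤ) n).filter fun j => 0 ≤ j + m ∧ j + m < n).card : ℝ) / n) atTop (𝓝 1) := by
  have h1 : Tendsto (fun n : ℕ => 1 - (2 * |m| : ℝ) / n) atTop (𝓝 1) := by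
    simpa using tendsto_const_nhds.sub (tendsto_const_div_atTop_nhds_zero_nat (2 * |m| : ℝ))
  refine tendsto_of_tendsto_of_tendsto_of_le_of_le' h1 tendsto_const_nhds ?_ ?_
  · filter_upwards [eventually_gt_atTop 0] with n hn
    have hn' : (0 : ℝ) < n := Nat.cast_pos.2 hn
    rw [le_div_iff₀ hn', sub_mul, div_mul_cancel₀ _ hn'.ne', one_mul]
    have hsub : Finset.Ico |m| (n - |m|) ⊆
        (Finset.Ico (0 : ℤ) n).filter fun j => 0 ≤ j + m ∧ j + m < n := by
      intro j hj
      rw [Finset.mem_Ico] at hj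
      have := neg_abs_le m
      have := le_abs_self m
      have := abs_nonneg m
      rw [Finset.mem_filter, Finset.mem_Ico]
      omega
    have hc := Finset.card_le_card hsub
    rw [Int.card_Ico] at hc
    -- When `n < 2|m|` the inner interval is empty and the left side is negative, so no largeness of
    -- `n` is required.
    have h3 : (n : ℤ) - |m| - |m| ≤ (((Finset.Ico (0 : ℤ) n).filter
        fun j => 0 ≤ j + m ∧ j + m < n).card : ℤ) :=
      (Int.self_le_toNat _).trans (by exact_mod_cast hc)
    have h4 : ((n : ℝ)) - |(m : ℝ)| - |(m : ℝ)| ≤ (((Finset.Ico (0 : ℤ) n).filter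
        fun j => 0 ≤ j + m ∧ j + m < n).card : ℝ) := by exact_mod_cast h3
    rw [Int.cast_abs]
    linarith
  · filter_upwards [eventually_gt_atTop 0] with n hn
    have hn' : (0 : ℝ) < n := Nat.cast_pos.2 hn
    rw [div_le_one hn']
    have := Finset.card_filter_le (Finset.Ico (0 : ℤ) n) fun j => 0 ≤ j + m ∧ j + m < n
    rw [Int.card_Ico, sub_zero, Int.toNat_natCast] at this
    exact_mod_cast this

theorem tendsto_card_box_shift (m : Site ν) : Tendsto (fun n : ℕ =>
    (((box ν n).filter fun l => l + m ∈ box ν n).card : ℝ) / (n : ℝ) ^ ν) atTop (𝓝 1) := by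
  have h : ∀ n : ℕ, (((box ν n).filter fun l => l + m ∈ box ν n).card : ℝ) / (n : ℝ) ^ ν =
      ∏ i, (((Finset.Ico (0 : ℤ) n).filter fun j => 0 ≤ j + ofLex m i ∧ j + ofLex m i < n).card : ℝ) /
        n := fun n => by
    have e : (box ν n).filter (fun l => l + m ∈ box ν n) = (Fintype.piFinset fun i =>
        (Finset.Ico (0 : ℤ) n).filter fun j => 0 ≤ j + ofLex m i ∧ j + ofLex m i < n).map
        toLex.toEmbedding := by
      ext l
      rw [Finset.mem_filter, mem_box, mem_box, Finset.mem_map]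
      constructor
      · rintro ⟨h1, h2⟩
        refine ⟨ofLex l, Fintype.mem_piFinset.2 fun i => ?_, rfl⟩
        exact Finset.mem_filter.2 ⟨Finset.mem_Ico.2 (h1 i), h2 i⟩
      · rintro ⟨f, hf, rfl⟩
        have := fun i => Finset.mem_filter.1 (Fintype.mem_piFinset.1 hf i)
        exact ⟨fun i => Finset.mem_Ico.1 (this i).1, fun i => (this i).2⟩
    rw [e, Finset.card_map, Fintype.card_piFinset, Finset.prod_div_distrib, Finset.prod_const,
      Finset.card_univ, Fintype.card_fin]
    push_cast
    rfl
  simp only [h]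
  have := tendsto_finsetProd (f := fun i (n : ℕ) => (((Finset.Ico (0 : ℤ) n).filter
    fun j => 0 ≤ j + ofLex m i ∧ j + ofLex m i < n).card : ℝ) / n) Finset.univ
    fun i _ => tendsto_card_shift (ofLex m i)
  simpa using this

/-- Averages of a summable kernel over large boxes. -/
theorem tendsto_box_average {g : Site ν → ℝ} (hg : Summable g) (h0 : ∀ m, 0 ≤ g m) :
    Tendsto (fun n : ℕ => (∑ l ∈ box ν n, ∑ k ∈ box ν n, g (k - l)) / (n : ℝ) ^ ν) atTop
      (𝓝 (∑' m, g m)) := by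
  -- Regrouping the pairs by their difference `m` weights `g m` with the fraction of sites whose
  -- shift by `m` stays in the box. This fraction is at most `1` and tends to `1`, so dominated
  -- convergence applies.
  have key : ∀ n : ℕ, (∑ l ∈ box ν n, ∑ k ∈ box ν n, g (k - l)) / (n : ℝ) ^ ν =
      ∑' m, g m * ((((box ν n).filter fun l => l + m ∈ box ν n).card : ℝ) / (n : ℝ) ^ ν) := by
    intro n
    have e1 : ∀ l, ∑ k ∈ box ν n, g (k - l) = ∑' m, if l + m ∈ box ν n then g m else 0 := fun l => by
      rw [← (Equiv.subRight l).tsum_eq fun m => if l + m ∈ box ν n then g m else 0]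
      simp only [Equiv.subRight_apply, add_sub_cancel]
      rw [tsum_eq_sum (s := box ν n) fun k hk => if_neg hk]
      exact Finset.sum_congr rfl fun k hk => (if_pos hk).symm
    have hs : ∀ l, Summable fun m => if l + m ∈ box ν n then g m else 0 := fun l =>
      Summable.of_nonneg_of_le (fun m => by split_ifs <;> simp [h0])
        (fun m => by split_ifs <;> simp [h0]) hg
    simp only [e1]
    rw [← Summable.tsum_finsetSum fun l _ => hs l, ← tsum_div_const]
    refine tsum_congr fun m => ?_
    rw [← Finset.sum_filter, Finset.sum_const, nsmul_eq_mul]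
    ring
  simp only [key]
  refine tendsto_tsum_of_dominated_convergence hg (fun m => ?_) (Eventually.of_forall fun n m => ?_)
  · simpa using (tendsto_card_box_shift m).const_mul (g m)
  · rw [Real.norm_of_nonneg (mul_nonneg (h0 m) (by positivity))]
    refine mul_le_of_le_one_right (h0 m) (div_le_one_of_le₀ ?_ (by positivity))
    have := Finset.card_filter_le (box ν n) fun l => l + m ∈ box ν n
    rw [card_box] at this
    exact_mod_cast this

end Box

/-! ### Asymptotic symbol calculus and the Szegő limit theorem. -/

section Szego

open scoped Matrix.Norms.L2Operator

attribute [local instance] decidableEqSites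

variable {ν : ℕ}

/-- The Hilbert–Schmidt norm is small compared with the square root of the volume of the box. -/
def Negligible (E : ∀ n, Matrix ↥(box ν n) ↥(box ν n) ℂ) : Prop :=
  Tendsto (fun n : ℕ => hsNorm (E n) / √((n : ℝ) ^ ν)) atTop (𝓝 0)

variable {E E' M M' : ∀ n, Matrix ↥(box ν n) ↥(box ν n) ℂ}
  {A B : OneParticle (Site ν) →L[ℂ] OneParticle (Site ν)} {a b : (Fin ν → ℝ) → ℝ}

theorem Negligible.of_le {C : ℝ} (hE : Negligible E) (h : ∀ n, hsNorm (E' n) ≤ C * hsNorm (E n)) :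
    Negligible E' := by
  refine squeeze_zero (fun n => div_nonneg (hsNorm_nonneg _) (Real.sqrt_nonneg _)) (fun n => ?_)
    (by simpa using hE.const_mul C)
  rw [← mul_div_assoc]
  exact div_le_div_of_nonneg_right (h n) (Real.sqrt_nonneg _)

theorem Negligible.add (hE : Negligible E) (hE' : Negligible E') :
    Negligible fun n => E n + E' n := by
  refine squeeze_zero (fun n => div_nonneg (hsNorm_nonneg _) (Real.sqrt_nonneg _)) (fun n => ?_)
    (by simpa using Tendsto.add hE hE')
  rw [← add_div]
  exact div_le_div_of_nonneg_right (hsNorm_add_le _ _) (Real.sqrt_nonneg _)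

theorem Negligible.mul_left {C : ℝ} (hE : Negligible E) (hM : ∀ n, ‖M n‖ ≤ C) :
    Negligible fun n => M n * E n :=
  hE.of_le fun n => (hsNorm_mul_le _ _).trans
    (mul_le_mul_of_nonneg_right (hM n) (hsNorm_nonneg _))

theorem Negligible.mul_right {C : ℝ} (hE : Negligible E) (hM : ∀ n, ‖M n‖ ≤ C) :
    Negligible fun n => E n * M n :=
  hE.of_le fun n => (hsNorm_mul_le' _ _).trans (by
    rw [mul_comm]
    exact mul_le_mul_of_nonneg_right (hM n) (hsNorm_nonneg _))

/-- Compressions of shift-invariant operators are asymptotically multiplicative. -/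
theorem negligible_compression_mul_sub (A : OneParticle (Site ν) →L[ℂ] OneParticle (Site ν))
    (hB : IsMultiplication B b) : Negligible fun n =>
      compression (box ν n) (A * B) - compression (box ν n) A * compression (box ν n) B := by
  set g : Site ν → ℝ := fun m => ‖symbolCoeff b m‖ ^ 2 with hg
  have hsum := hB.hasSum_symbolCoeff (0 : Site ν)
  -- This bounds the squared Hilbert–Schmidt error per site: the squared norm of a column of `B`
  -- minus the average part of it that stays in the box.
  have hlim : Tendsto (fun n : ℕ => ‖A‖ ^ 2 * (∑' m, g m -
      (∑ l ∈ box ν n, ∑ k ∈ box ν n, g (k - l)) / (n : ℝ) ^ ν)) atTop (𝓝 0) := by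
    simpa [hg] using (((tendsto_box_average hsum.summable fun m => by positivity).const_sub
      (∑' m, g m)).const_mul (‖A‖ ^ 2))
  have hsqrt := hlim.sqrt
  rw [Real.sqrt_zero] at hsqrt
  refine squeeze_zero' (Eventually.of_forall fun n =>
    div_nonneg (hsNorm_nonneg _) (Real.sqrt_nonneg _)) ?_ hsqrt
  filter_upwards [eventually_gt_atTop 0] with n hn
  have hN : (0 : ℝ) < (n : ℝ) ^ ν := by positivity
  refine Real.le_sqrt_of_sq_le ?_
  rw [div_pow, Real.sq_sqrt hN.le, div_le_iff₀ hN]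
  refine (hsNorm_compression_mul_sub_le _ _ _).trans (le_of_eq ?_)
  have e1 : ∀ l : ↥(box ν n), ‖B (siteVec (l : Site ν))‖ ^ 2 = ∑' m, g m := fun l =>
    (hB.hasSum_symbolCoeff (l : Site ν)).tsum_eq.symm
  simp only [e1, hB.siteVec_apply, Finset.sum_sub_distrib, Finset.sum_const, Finset.card_univ,
    Fintype.card_coe, card_box, nsmul_eq_mul]
  rw [Finset.sum_coe_sort (box ν n) fun l : Site ν => ∑ k : ↥(box ν n), ‖symbolCoeff b (k - l)‖ ^ 2]
  simp only [fun l : Site ν => Finset.sum_coe_sort (box ν n) fun k => ‖symbolCoeff b (k - l)‖ ^ 2]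
  rw [mul_assoc, sub_mul, div_mul_cancel₀ _ hN.ne']
  push_cast
  ring

/-- The matrices `M n` are uniformly bounded and asymptotic to the compressions of the operator
`A`, which is multiplication by the bounded function `a` in the Fourier picture. -/
structure HasSymbol (M : ∀ n, Matrix ↥(box ν n) ↥(box ν n) ℂ)
    (A : OneParticle (Site ν) →L[ℂ] OneParticle (Site ν)) (a : (Fin ν → ℝ) → ℝ) : Prop where
  bounded : ∃ C, ∀ n, ‖M n‖ ≤ C
  isMultiplication : IsMultiplication A a
  aemeasurable : AEMeasurable a (momentumMeasure ν)
  symbol_bounded : ∃ C, ∀ᵐ x ∂momentumMeasure ν, |a x| ≤ C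
  negligible : Negligible fun n => M n - compression (box ν n) A

theorem hasSymbol_compression (hA : IsMultiplication A a)
    (ha : AEMeasurable a (momentumMeasure ν)) (hb : ∃ C, ∀ᵐ x ∂momentumMeasure ν, |a x| ≤ C) :
    HasSymbol (fun n => compression (box ν n) A) A a where
  bounded := ⟨‖A‖, fun n => norm_compression_le _ _⟩
  isMultiplication := hA
  aemeasurable := ha
  symbol_bounded := hb
  negligible := by simp [Negligible, hsNorm_zero]

theorem HasSymbol.add (hM : HasSymbol M A a) (hM' : HasSymbol M' B b) :
    HasSymbol (fun n => M n + M' n) (A + B) (fun x => a x + b x) where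
  bounded := by
    obtain ⟨C, hC⟩ := hM.bounded
    obtain ⟨C', hC'⟩ := hM'.bounded
    exact ⟨C + C', fun n => (norm_add_le _ _).trans (add_le_add (hC n) (hC' n))⟩
  isMultiplication := hM.isMultiplication.add hM'.isMultiplication
  aemeasurable := hM.aemeasurable.add hM'.aemeasurable
  symbol_bounded := by
    obtain ⟨C, hC⟩ := hM.symbol_bounded
    obtain ⟨C', hC'⟩ := hM'.symbol_bounded
    refine ⟨C + C', ?_⟩
    filter_upwards [hC, hC'] with x h1 h2
    exact (abs_add_le _ _).trans (add_le_add h1 h2)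
  negligible := by
    convert hM.negligible.add hM'.negligible using 2
    rw [compression_add]
    abel

theorem HasSymbol.smul (hM : HasSymbol M A a) (c : ℝ) :
    HasSymbol (fun n => (c : ℂ) • M n) ((c : ℂ) • A) (fun x => c * a x) where
  bounded := by
    obtain ⟨C, hC⟩ := hM.bounded
    exact ⟨‖(c : ℂ)‖ * C, fun n => (norm_smul_le _ _).trans
      (mul_le_mul_of_nonneg_left (hC n) (norm_nonneg _))⟩
  isMultiplication := hM.isMultiplication.smul c
  aemeasurable := hM.aemeasurable.const_mul c
  symbol_bounded := by
    obtain ⟨C, hC⟩ := hM.symbol_bounded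
    refine ⟨|c| * C, ?_⟩
    filter_upwards [hC] with x h1
    rw [abs_mul]
    exact mul_le_mul_of_nonneg_left h1 (abs_nonneg _)
  negligible := by
    refine hM.negligible.of_le (C := ‖(c : ℂ)‖) fun n => ?_
    rw [compression_smul, ← smul_sub, hsNorm_smul]

/-- With `C` denoting compression, `M M' - C(AB) = (M - C(A)) M' + C(A) (M' - C(B)) + (C(A) C(B) -
C(AB))`, and each term is negligible. -/
theorem HasSymbol.mul (hM : HasSymbol M A a) (hM' : HasSymbol M' B b) :
    HasSymbol (fun n => M n * M' n) (A * B) (fun x => a x * b x) where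
  bounded := by
    obtain ⟨C, hC⟩ := hM.bounded
    obtain ⟨C', hC'⟩ := hM'.bounded
    exact ⟨C * C', fun n => (norm_mul_le _ _).trans
      (mul_le_mul (hC n) (hC' n) (norm_nonneg _) ((norm_nonneg _).trans (hC n)))⟩
  isMultiplication := hM.isMultiplication.mul hM'.isMultiplication
  aemeasurable := hM.aemeasurable.mul hM'.aemeasurable
  symbol_bounded := by
    obtain ⟨C, hC⟩ := hM.symbol_bounded
    obtain ⟨C', hC'⟩ := hM'.symbol_bounded
    refine ⟨C * C', ?_⟩
    filter_upwards [hC, hC'] with x h1 h2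
    rw [abs_mul]
    exact mul_le_mul h1 h2 (abs_nonneg _) ((abs_nonneg _).trans h1)
  negligible := by
    obtain ⟨C', hC'⟩ := hM'.bounded
    have h1 := hM.negligible.mul_right hC'
    have h2 := hM'.negligible.mul_left (M := fun n => compression (box ν n) A)
      fun n => norm_compression_le _ A
    have h3 := (negligible_compression_mul_sub A hM'.isMultiplication).of_le
      (E' := fun n => compression (box ν n) A * compression (box ν n) B -
        compression (box ν n) (A * B)) (C := 1) fun n => by
      rw [← neg_sub, ← neg_one_smul ℂ, hsNorm_smul, norm_neg, norm_one]
    convert (h1.add h2).add h3 using 2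
    noncomm_ring

theorem hasSymbol_one : HasSymbol (ν := ν) (fun _ => 1) 1 (fun _ => 1) := by
  have h := hasSymbol_compression (ν := ν) isMultiplication_one aemeasurable_const
    ⟨1, Eventually.of_forall fun x => by simp⟩
  simpa only [compression_one] using h

theorem HasSymbol.aeval (hM : HasSymbol M A a) (p : Polynomial ℝ) :
    HasSymbol (fun n => Polynomial.aeval (M n) p) (Polynomial.aeval A p)
      (fun x => p.eval (a x)) := by
  induction p using Polynomial.induction_on' with
  | add p q hp hq =>
    simp only [map_add, Polynomial.eval_add]
    exact hp.add hq
  | monomial n c =>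
    have hpow : HasSymbol (fun k => M k ^ n) (A ^ n) (fun x => a x ^ n) := by
      induction n with
      | zero => simpa using hasSymbol_one
      | succ n ih => simpa only [pow_succ] using ih.mul hM
    have := hpow.smul c
    simp only [Complex.coe_smul] at this
    simp only [Polynomial.aeval_monomial, Polynomial.eval_monomial,
      Algebra.algebraMap_eq_smul_one, smul_mul_assoc, one_mul]
    exact this

/-- Continuity of `f` is asked only on an interval containing all the spectra, which admits the
logarithms and powers that are singular at `0` or `1`. -/
theorem HasSymbol.cfc (hM : HasSymbol M A a) (hMh : ∀ n, (M n).IsHermitian)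
    (hA : IsSelfAdjoint A) {c d : ℝ} (hMs : ∀ n, spectrum ℝ (M n) ⊆ Set.Icc c d)
    (hAs : spectrum ℝ A ⊆ Set.Icc c d) (ha : ∀ᵐ x ∂momentumMeasure ν, a x ∈ Set.Icc c d)
    {f : ℝ → ℝ} (hf : Measurable f) (hfc : ContinuousOn f (Set.Icc c d)) :
    HasSymbol (fun n => _root_.cfc f (M n)) (_root_.cfc f A) (fun x => f (a x)) := by
  obtain ⟨K, hK⟩ := isCompact_Icc.exists_bound_of_continuousOn hfc
  refine ⟨⟨max K 0, fun n => norm_cfc_le (le_max_right _ _) fun x hx =>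
      (hK x (hMs n hx)).trans (le_max_left _ _)⟩,
    hM.isMultiplication.cfc hA hM.aemeasurable hAs ha hf hfc, hf.comp_aemeasurable hM.aemeasurable,
    ⟨K, ha.mono fun x hx => hK _ hx⟩, ?_⟩
  rw [Negligible, Metric.tendsto_nhds]
  intro δ hδ
  -- Three errors of `δ / 4` arise: replacing `f` by `p` on the matrices, the symbol calculus for
  -- `p`, and replacing `p` by `f` on the operator. Uniform errors cost at most their size times the
  -- square root of the volume in Hilbert–Schmidt norm.
  obtain ⟨p, hp⟩ := exists_polynomial_near_of_continuousOn c d f hfc (δ / 4) (by positivity)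
  have hneg := (hM.aeval p).negligible
  rw [Negligible, Metric.tendsto_nhds] at hneg
  filter_upwards [hneg (δ / 4) (by positivity), eventually_gt_atTop 0] with n hn hn0
  have hN : (0 : ℝ) < √((n : ℝ) ^ ν) := by positivity
  rw [Real.dist_0_eq_abs, abs_of_nonneg (div_nonneg (hsNorm_nonneg _) hN.le), div_lt_iff₀ hN] at hn ⊢
  have hcard : √(Fintype.card ↥(box ν n) : ℝ) = √((n : ℝ) ^ ν) := by
    rw [Fintype.card_coe, card_box, Nat.cast_pow]
  have e1 : hsNorm (_root_.cfc f (M n) - Polynomial.aeval (M n) p) ≤ δ / 4 * √((n : ℝ) ^ ν) := by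
    rw [← hcard]
    refine (hsNorm_le _).trans (mul_le_mul_of_nonneg_right ?_ (Real.sqrt_nonneg _))
    have hsa : IsSelfAdjoint (M n) := hMh n
    rw [← cfc_polynomial p (M n) hsa, ← cfc_sub _ _ (M n) (hfc.mono (hMs n))]
    refine norm_cfc_le (by positivity) fun x hx => ?_
    rw [Real.norm_eq_abs, abs_sub_comm]
    exact (hp x (hMs n hx)).le
  have e2 : hsNorm (compression (box ν n) (Polynomial.aeval A p - _root_.cfc f A)) ≤
      δ / 4 * √((n : ℝ) ^ ν) := by
    rw [← hcard]
    refine (hsNorm_le _).trans (mul_le_mul_of_nonneg_right ((norm_compression_le _ _).trans ?_)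
      (Real.sqrt_nonneg _))
    rw [← cfc_polynomial p A hA, ← cfc_sub _ _ A (by fun_prop) (hfc.mono hAs)]
    refine norm_cfc_le (by positivity) fun x hx => ?_
    rw [Real.norm_eq_abs]
    exact (hp x (hAs hx)).le
  have e3 : _root_.cfc f (M n) - compression (box ν n) (_root_.cfc f A) =
      (_root_.cfc f (M n) - Polynomial.aeval (M n) p) +
      ((Polynomial.aeval (M n) p - compression (box ν n) (Polynomial.aeval A p)) +
      compression (box ν n) (Polynomial.aeval A p - _root_.cfc f A)) := by
    rw [compression_sub]
    abel
  rw [e3]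
  have h1 := hsNorm_add_le (_root_.cfc f (M n) - Polynomial.aeval (M n) p)
    ((Polynomial.aeval (M n) p - compression (box ν n) (Polynomial.aeval A p)) +
      compression (box ν n) (Polynomial.aeval A p - _root_.cfc f A))
  have h2 := hsNorm_add_le (Polynomial.aeval (M n) p - compression (box ν n) (Polynomial.aeval A p))
    (compression (box ν n) (Polynomial.aeval A p - _root_.cfc f A))
  nlinarith

theorem spectrum_subset_Icc_norm {𝒜 : Type*} [CStarAlgebra 𝒜] (x : 𝒜) {K : ℝ} (hK : ‖x‖ ≤ K) :
    spectrum ℝ x ⊆ Set.Icc (-K) K := by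
  rcases subsingleton_or_nontrivial 𝒜 with h | h
  · rw [spectrum.of_subsingleton]
    exact Set.empty_subset _
  · intro y hy
    have := (spectrum.norm_le_norm_of_mem hy).trans hK
    exact abs_le.1 this

/-- A symmetric interval beyond all the norms and the bound of the symbol contains every spectrum.
The version is meant for products such as `X Y X`, whose spectra are not located more closely. -/
theorem HasSymbol.cfc_of_continuous (hM : HasSymbol M A a) (hMh : ∀ n, (M n).IsHermitian)
    (hA : IsSelfAdjoint A) {f : ℝ → ℝ} (hf : Continuous f) :
    HasSymbol (fun n => _root_.cfc f (M n)) (_root_.cfc f A) (fun x => f (a x)) := by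
  obtain ⟨C, hC⟩ := hM.bounded
  obtain ⟨C', hC'⟩ := hM.symbol_bounded
  refine hM.cfc hMh hA (c := -max (max C C') ‖A‖) (d := max (max C C') ‖A‖)
    (fun n => spectrum_subset_Icc_norm _ ((hC n).trans ?_)) (spectrum_subset_Icc_norm A ?_)
    (hC'.mono fun x hx => abs_le.1 (hx.trans ?_)) hf.measurable hf.continuousOn
  · exact (le_max_left _ _).trans (le_max_left _ _)
  · exact le_max_right _ _
  · exact (le_max_right _ _).trans (le_max_left _ _)

/-- The first Szegő limit theorem, for the trace. -/
theorem HasSymbol.tendsto_trace (hM : HasSymbol M A a) :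
    Tendsto (fun n : ℕ => 1 / (n : ℝ) ^ ν * (M n).trace.re) atTop
      (𝓝 (∫ x, a x ∂momentumMeasure ν)) := by
  have h0 : symbolCoeff a 0 = ((∫ x, a x ∂momentumMeasure ν : ℝ) : ℂ) := by
    rw [symbolCoeff, ← integral_complex_ofReal]
    congr 1
    funext x
    rw [show -(0 : Site ν) = 0 - 0 by abel, planeWave_sub, Complex.mul_conj', norm_planeWave]
    simp
  -- The diagonal of a compression is constant, so its trace per site is exactly the mean of the
  -- symbol. Only the negligible difference remains, and `norm_trace_le` controls its trace.
  have h1 : ∀ n : ℕ, 0 < n → 1 / (n : ℝ) ^ ν * (M n).trace.re =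
      1 / (n : ℝ) ^ ν * (M n - compression (box ν n) A).trace.re +
        ∫ x, a x ∂momentumMeasure ν := by
    intro n hn
    have hN : (0 : ℝ) < (n : ℝ) ^ ν := by positivity
    have : (compression (box ν n) A).trace.re = (n : ℝ) ^ ν * ∫ x, a x ∂momentumMeasure ν := by
      rw [Matrix.trace]
      simp only [Matrix.diag, compression, Matrix.of_apply, hM.isMultiplication.siteVec_apply,
        sub_self, h0, Finset.sum_const, Finset.card_univ, Fintype.card_coe, card_box, nsmul_eq_mul]
      rw [Complex.re_mul_ofReal]
      norm_cast
    rw [Matrix.trace_sub, Complex.sub_re, this]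
    field_simp
    ring
  have h2 : Tendsto (fun n : ℕ => 1 / (n : ℝ) ^ ν * (M n - compression (box ν n) A).trace.re) atTop
      (𝓝 0) := by
    refine squeeze_zero_norm' ?_ hM.negligible
    filter_upwards [eventually_gt_atTop 0] with n hn
    have hN : (0 : ℝ) < (n : ℝ) ^ ν := by positivity
    have h3 := (Complex.abs_re_le_norm _).trans (norm_trace_le (M n - compression (box ν n) A))
    rw [Fintype.card_coe, card_box, Nat.cast_pow] at h3
    rw [norm_mul, Real.norm_of_nonneg (by positivity), Real.norm_eq_abs, div_mul_eq_mul_div, one_mul,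
      div_le_div_iff₀ hN (by positivity)]
    calc _ ≤ √((n : ℝ) ^ ν) * hsNorm (M n - compression (box ν n) A) * √((n : ℝ) ^ ν) :=
          mul_le_mul_of_nonneg_right h3 (Real.sqrt_nonneg _)
      _ = _ := by
        rw [mul_right_comm, Real.mul_self_sqrt hN.le, mul_comm]
  have h4 := h2.add_const (∫ x, a x ∂momentumMeasure ν)
  rw [zero_add] at h4
  refine h4.congr' ?_
  filter_upwards [eventually_gt_atTop 0] with n hn
  exact (h1 n hn).symm

end Szego

/-! ### Invariance under reindexing. -/

section Reindex

variable {ι ι' : Type*} [Fintype ι] [DecidableEq ι] [Fintype ι'] [DecidableEq ι']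

/-- Reindexing only the rows of the eigenvector matrix diagonalizes the reindexed matrix; this is
why `cfc_conj_diagonal` allows two index types. -/
theorem cfc_submatrix {A : Matrix ι ι ℂ} (hA : A.IsHermitian) (e : ι' ≃ ι) (f : ℝ → ℝ) :
    cfc f (A.submatrix e e) = (cfc f A).submatrix e e := by
  set U : Matrix ι ι ℂ := (hA.eigenvectorUnitary : Matrix ι ι ℂ) with hU
  have hUU := eigenvectorUnitary_mul_conjTranspose hA
  have hsub : ∀ d : ι → ℂ, (U * Matrix.diagonal d * U.conjTranspose).submatrix e e =
      U.submatrix e id * Matrix.diagonal d * (U.submatrix e id).conjTranspose := fun d => rfl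
  have h1 : U.submatrix e id * (U.submatrix e id).conjTranspose = 1 := by
    have : U.submatrix e id * (U.submatrix e id).conjTranspose =
        (U * U.conjTranspose).submatrix e e := rfl
    rw [this, hUU, Matrix.submatrix_one_equiv]
  have h2 : (U.submatrix e id).conjTranspose * U.submatrix e id = 1 := by
    rw [Matrix.conjTranspose_submatrix, Matrix.submatrix_mul_equiv, mul_eq_one_comm.1 hUU,
      Matrix.submatrix_id_id]
  conv_lhs => rw [eq_conj_diagonal hA]
  rw [hsub, cfc_conj_diagonal h1 h2, cfc_eq_conj_diagonal hA, hsub]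

theorem trace_submatrix_equiv {ι ι' : Type*} [Fintype ι] [Fintype ι'] (A : Matrix ι ι ℂ)
    (e : ι' ≃ ι) : (A.submatrix e e).trace = A.trace :=
  e.sum_comp fun i => A i i

theorem logOverlap_submatrix {D E : Matrix ι ι ℂ} (hD : D.IsHermitian) (hE : E.IsHermitian)
    (e : ι' ≃ ι) (t : ℝ) :
    logOverlap (D.submatrix e e) (E.submatrix e e) t = logOverlap D E t := by
  rw [logOverlap, logOverlap, mpow, mpow, cfc_submatrix hD, cfc_submatrix hE,
    Matrix.submatrix_mul_equiv, trace_submatrix_equiv, mpow, mpow]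

end Reindex

/-! ### The densities of the boxes. -/

section BoxDensity

attribute [local instance] decidableEqSites

variable {ν : ℕ}

/-- Sets of sites of the box as elements of the index type of its Fock space. -/
noncomputable def siteSetEquiv (ν n : ℕ) : Finset ↥(box ν n) ≃ LocalIndex ν n :=
  Equiv.ofBijective (fun S => ⟨siteSet S, Finset.mem_powerset.2 (siteSet_subset S)⟩)
    ⟨fun S T h => siteSet_injective (congrArg Subtype.val h), fun T => by
      obtain ⟨S, hS⟩ := exists_siteSet_eq (Finset.mem_powerset.1 T.2)
      exact ⟨S, Subtype.ext hS⟩⟩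

/-- The two sides can differ only in the decidability instance inside `lp.single`. -/
theorem siteVec_eq_single (k : Site ν) : siteVec k = lp.single 2 k (1 : ℂ) := by
  rw [siteVec]
  congr!

theorem occVec_eq_single (S : Finset (Site ν)) : occVec S = lp.single 2 S (1 : ℂ) := by
  rw [occVec]
  congr!

theorem localMatrix_submatrix (n : ℕ) (A : FockSpace (Site ν) →L[ℂ] FockSpace (Site ν)) :
    (localMatrix n A).submatrix (siteSetEquiv ν n) (siteSetEquiv ν n) = fockMatrix (box ν n) A := by
  ext S T
  rw [Matrix.submatrix_apply, localMatrix, Matrix.of_apply, fockMatrix, Matrix.of_apply,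
    ← inner_occVec, occVec_eq_single, occVec_eq_single]
  rfl

theorem CARLattice.IsLocalDensity.eq_quasiFreeDensity
    {ω : AlgState (carAlgebra (Set.univ : Set (OneParticle (Site ν))))}
    {Q : OneParticle (Site ν) →L[ℂ] OneParticle (Site ν)} (hω : IsQuasiFree ω Q) {n : ℕ}
    {D : Matrix (LocalIndex ν n) (LocalIndex ν n) ℂ} (hD : IsLocalDensity ω n D)
    (hQ : (compression (box ν n) Q).IsHermitian) :
    D = (quasiFreeDensity hQ).submatrix (siteSetEquiv ν n).symm (siteSetEquiv ν n).symm ∧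
      D.trace = 1 := by
  have h : ∀ A : carAlgebra (Set.univ : Set (OneParticle (Site ν))),
      (A : FockSpace (Site ν) →L[ℂ] FockSpace (Site ν)) ∈
        carAlgebra (localSpace ν n : Set (OneParticle (Site ν))) →
      ω.toLin A = (D.submatrix (siteSetEquiv ν n) (siteSetEquiv ν n) *
        fockMatrix (box ν n) A).trace := fun A hA => by
    rw [hD A hA, ← localMatrix_submatrix, Matrix.submatrix_mul_equiv, trace_submatrix_equiv]
  have h1 := density_eq_quasiFreeDensity hω hQ (fun v => ?_) h
  · refine ⟨by rw [← h1]; simp, ?_⟩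
    have h2 := h 1 (one_mem _)
    rw [ω.map_one, OneMemClass.coe_one, fockMatrix_one, mul_one, trace_submatrix_equiv] at h2
    exact h2.symm
  · refine Submodule.sum_mem _ fun k _ => Submodule.smul_mem _ _ (Submodule.subset_span ?_)
    exact ⟨k, k.2, (siteVec_eq_single _).symm⟩

end BoxDensity

/-! ### Convergence of the scaled overlap and differentiability of its limit. -/

section OverlapLimit

attribute [local instance] decidableEqSites

variable {ν : ℕ}

theorem ae_momentumMeasure {p : (Fin ν → ℝ) → Prop} (h : ∀ x ∈ brillouin ν, p x) :
    ∀ᵐ x ∂momentumMeasure ν, p x := by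
  refine Measure.ae_smul_measure ?_ _
  exact (ae_restrict_mem (MeasurableSet.univ_pi fun _ => measurableSet_Ico)).mono h

theorem integral_momentumMeasure (f : (Fin ν → ℝ) → ℝ) :
    ∫ x, f x ∂momentumMeasure ν = 1 / (2 * Real.pi) ^ ν * ∫ x in brillouin ν, f x := by
  rw [momentumMeasure, integral_smul_measure, ENNReal.toReal_ofReal (by positivity), smul_eq_mul]

theorem HasSymbol.integrable {M : ∀ n, Matrix ↥(box ν n) ↥(box ν n) ℂ}
    {A : OneParticle (Site ν) →L[ℂ] OneParticle (Site ν)} {a : (Fin ν → ℝ) → ℝ}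
    (h : HasSymbol M A a) : Integrable a (momentumMeasure ν) := by
  obtain ⟨C, hC⟩ := h.symbol_bounded
  exact Integrable.of_bound h.aemeasurable.aestronglyMeasurable C hC

/-- Taking out `(1 - q)^t (1 - r)^(1-t)` leaves a function of the odds. The right side is the scalar
form of `logOverlap_quasiFreeDensity`, with the same order of factors and the same absolute value.
-/
theorem log_overlap_eq {q r : ℝ} (hq : q ∈ Set.Ioo (0 : ℝ) 1) (hr : r ∈ Set.Ioo (0 : ℝ) 1) (t : ℝ) :
    Real.log (q ^ t * r ^ (1 - t) + (1 - q) ^ t * (1 - r) ^ (1 - t)) =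
      t * Real.log (1 - q) + (1 - t) * Real.log (1 - r) +
      Real.log (1 + |(q / (1 - q)) ^ (t / 2) * (r / (1 - r)) ^ (1 - t) * (q / (1 - q)) ^ (t / 2)|) := by
  have h1 : 0 < 1 - q := by linarith [hq.2]
  have h2 : 0 < 1 - r := by linarith [hr.2]
  have h3 : 0 < q / (1 - q) := div_pos hq.1 h1
  have h4 : 0 < r / (1 - r) := div_pos hr.1 h2
  have h5 : 0 < (1 - q) ^ t := Real.rpow_pos_of_pos h1 _
  have h6 : 0 < (1 - r) ^ (1 - t) := Real.rpow_pos_of_pos h2 _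
  rw [mul_right_comm, ← Real.rpow_add h3, add_halves, abs_of_nonneg (by positivity),
    ← Real.log_rpow h1, ← Real.log_rpow h2, ← Real.log_mul h5.ne' h6.ne',
    ← Real.log_mul (by positivity) (by positivity), Real.div_rpow hq.1.le h1.le,
    Real.div_rpow hr.1.le h2.le]
  congr 1
  field_simp
  ring

variable {q r : (Fin ν → ℝ) → ℝ} {Q R : OneParticle (Site ν) →L[ℂ] OneParticle (Site ν)} {η : ℝ}

theorem compression_spectrum (hη : η ∈ Set.Ioo (0 : ℝ) (1 / 2)) (hQ : IsMultiplication Q q)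
    (hq : ∀ᵐ x ∂momentumMeasure ν, q x ∈ Set.Icc η (1 - η)) (n : ℕ) :
    ∃ h : (compression (box ν n) Q).IsHermitian, ∀ k, h.eigenvalues k ∈ Set.Ioo (0 : ℝ) 1 := by
  have hs := spectrum_compression_subset (u := box ν n) (hQ.isPositive_sub (hq.mono fun x hx => hx.1))
    (hQ.isPositive_sub' (hq.mono fun x hx => hx.2))
  have hsa := (spectrum_subset_of_isPositive (hQ.isPositive_sub (hq.mono fun x hx => hx.1))
    (hQ.isPositive_sub' (hq.mono fun x hx => hx.2))).1
  refine ⟨isHermitian_compression hsa, fun k => ?_⟩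
  have := hs ((isHermitian_compression hsa).spectrum_real_eq_range_eigenvalues ▸ Set.mem_range_self k)
  exact ⟨hη.1.trans_le this.1, this.2.trans_lt (by linarith [hη.1])⟩

theorem hasSymbol_cfc_compression (hQ : IsMultiplication Q q)
    (hqm : AEMeasurable q (momentumMeasure ν)) {c d : ℝ}
    (hq : ∀ᵐ x ∂momentumMeasure ν, q x ∈ Set.Icc c d) {f : ℝ → ℝ} (hf : Measurable f)
    (hfc : ContinuousOn f (Set.Icc c d)) :
    HasSymbol (fun n => cfc f (compression (box ν n) Q)) (cfc f Q) (fun x => f (q x)) := by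
  have h1 := hQ.isPositive_sub (hq.mono fun x hx => hx.1)
  have h2 := hQ.isPositive_sub' (hq.mono fun x hx => hx.2)
  have hsa := spectrum_subset_of_isPositive h1 h2
  refine (hasSymbol_compression hQ hqm ⟨max |c| |d|, hq.mono fun x hx =>
    abs_le_max_abs_abs hx.1 hx.2⟩).cfc (fun n => isHermitian_compression hsa.1) hsa.1
    (fun n => spectrum_compression_subset h1 h2) hsa.2 hq hf hfc

theorem continuousOn_odds_rpow (hη : η ∈ Set.Ioo (0 : ℝ) (1 / 2)) (t : ℝ) :
    ContinuousOn (fun x : ℝ => (x / (1 - x)) ^ t) (Set.Icc η (1 - η)) := by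
  have h : ∀ x ∈ Set.Icc η (1 - η), 0 < x ∧ 0 < 1 - x := fun x hx =>
    ⟨hη.1.trans_le hx.1, by linarith [hx.2, hη.1]⟩
  refine ContinuousOn.rpow_const (continuousOn_id.div (continuousOn_const.sub continuousOn_id)
    fun x hx => (h x hx).2.ne') fun x hx => Or.inl (div_pos (h x hx).1 (h x hx).2).ne'

theorem continuousOn_log_one_sub (hη : η ∈ Set.Ioo (0 : ℝ) (1 / 2)) :
    ContinuousOn (fun x : ℝ => Real.log (1 - x)) (Set.Icc η (1 - η)) :=
  (continuousOn_const.sub continuousOn_id).log fun x hx => by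
    have : 0 < 1 - x := by linarith [hx.2, hη.1]
    exact this.ne'

theorem hasSymbol_overlap (hη : η ∈ Set.Ioo (0 : ℝ) (1 / 2)) (hQ : IsMultiplication Q q)
    (hR : IsMultiplication R r) (hqm : AEMeasurable q (momentumMeasure ν))
    (hrm : AEMeasurable r (momentumMeasure ν))
    (hq : ∀ᵐ x ∂momentumMeasure ν, q x ∈ Set.Icc η (1 - η))
    (hr : ∀ᵐ x ∂momentumMeasure ν, r x ∈ Set.Icc η (1 - η)) (t : ℝ) :
    ∃ W, HasSymbol (fun n => cfc (fun x : ℝ => Real.log (1 + |x|))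
      (cfc (fun x : ℝ => (x / (1 - x)) ^ (t / 2)) (compression (box ν n) Q) *
        cfc (fun x : ℝ => (x / (1 - x)) ^ (1 - t)) (compression (box ν n) R) *
        cfc (fun x : ℝ => (x / (1 - x)) ^ (t / 2)) (compression (box ν n) Q))) W
      (fun x => Real.log (1 + |(q x / (1 - q x)) ^ (t / 2) * (r x / (1 - r x)) ^ (1 - t) *
        (q x / (1 - q x)) ^ (t / 2)|)) := by
  have hX := hasSymbol_cfc_compression hQ hqm hq (by fun_prop) (continuousOn_odds_rpow hη (t / 2))
  have hY := hasSymbol_cfc_compression hR hrm hr (by fun_prop) (continuousOn_odds_rpow hη (1 - t))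
  refine ⟨_, ((hX.mul hY).mul hX).cfc_of_continuous (fun n => ?_) ?_ ?_⟩
  · exact IsSelfAdjoint.conjugate_self (R := Matrix ↥(box ν n) ↥(box ν n) ℂ)
      (cfc_predicate _ _) (cfc_predicate _ _)
  · exact IsSelfAdjoint.conjugate_self (cfc_predicate _ _) (cfc_predicate _ _)
  · exact (continuous_const.add continuous_abs).log fun x =>
      (add_pos_of_pos_of_nonneg one_pos (abs_nonneg x)).ne'

/-- The overlap is a sum of three traces of matrices with symbols. The Szegő theorem turns them into
integrals, which `log_overlap_eq` recombines into the integrand of `psi`. -/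
theorem tendsto_logOverlap (hη : η ∈ Set.Ioo (0 : ℝ) (1 / 2)) (hQ : IsMultiplication Q q)
    (hR : IsMultiplication R r) (hqm : AEMeasurable q (momentumMeasure ν))
    (hrm : AEMeasurable r (momentumMeasure ν))
    (hq : ∀ᵐ x ∂momentumMeasure ν, q x ∈ Set.Icc η (1 - η))
    (hr : ∀ᵐ x ∂momentumMeasure ν, r x ∈ Set.Icc η (1 - η))
    (hQh : ∀ n, (compression (box ν n) Q).IsHermitian)
    (hRh : ∀ n, (compression (box ν n) R).IsHermitian) (t : ℝ) :
    Integrable (fun x => Real.log (q x ^ t * r x ^ (1 - t) + (1 - q x) ^ t * (1 - r x) ^ (1 - t)))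
      (momentumMeasure ν) ∧
    Tendsto (fun n : ℕ => 1 / (n : ℝ) ^ ν *
      logOverlap (quasiFreeDensity (hQh n)) (quasiFreeDensity (hRh n)) t) atTop (𝓝 (psi q r t)) := by
  obtain ⟨W, hW⟩ := hasSymbol_overlap hη hQ hR hqm hrm hq hr t
  have hX := hasSymbol_cfc_compression hQ hqm hq (by fun_prop) (continuousOn_log_one_sub hη)
  have hY := hasSymbol_cfc_compression hR hrm hr (by fun_prop) (continuousOn_log_one_sub hη)
  have hmem : ∀ x ∈ Set.Icc η (1 - η), x ∈ Set.Ioo (0 : ℝ) 1 := fun x hx =>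
    ⟨hη.1.trans_le hx.1, hx.2.trans_lt (by linarith [hη.1])⟩
  have hae : (fun x => t * Real.log (1 - q x) + (1 - t) * Real.log (1 - r x) +
      Real.log (1 + |(q x / (1 - q x)) ^ (t / 2) * (r x / (1 - r x)) ^ (1 - t) *
        (q x / (1 - q x)) ^ (t / 2)|)) =ᵐ[momentumMeasure ν]
      fun x => Real.log (q x ^ t * r x ^ (1 - t) + (1 - q x) ^ t * (1 - r x) ^ (1 - t)) := by
    filter_upwards [hq, hr] with x h1 h2
    exact (log_overlap_eq (hmem _ h1) (hmem _ h2) t).symm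
  have hi1 := hX.integrable.const_mul t
  have hi2 := hY.integrable.const_mul (1 - t)
  have hi12 : Integrable (fun x => t * Real.log (1 - q x) + (1 - t) * Real.log (1 - r x))
      (momentumMeasure ν) := hi1.add hi2
  refine ⟨(hi12.add hW.integrable).congr hae, ?_⟩
  rw [psi, ← integral_momentumMeasure, ← integral_congr_ae hae,
    integral_add hi12 hW.integrable, integral_add hi1 hi2, integral_const_mul,
    integral_const_mul]
  refine (((hX.tendsto_trace.const_mul t).add (hY.tendsto_trace.const_mul (1 - t))).add
    hW.tendsto_trace).congr fun n => ?_
  obtain ⟨_, hl⟩ := compression_spectrum hη hQ hq n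
  obtain ⟨_, hm⟩ := compression_spectrum hη hR hr n
  rw [logOverlap_quasiFreeDensity (hQh n) (hRh n) hl hm]
  ring

/-- Logarithmic derivative of a sum of two geometric interpolations. -/
theorem hasDerivAt_log_add_rpow {a b c d : ℝ} (ha : 0 < a) (hb : 0 < b) (hc : 0 < c) (hd : 0 < d)
    (t : ℝ) : HasDerivAt (fun t => Real.log (a ^ t * b ^ (1 - t) + c ^ t * d ^ (1 - t)))
      ((a ^ t * b ^ (1 - t) * (Real.log a - Real.log b) +
        c ^ t * d ^ (1 - t) * (Real.log c - Real.log d)) /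
        (a ^ t * b ^ (1 - t) + c ^ t * d ^ (1 - t))) t := by
  have h : ∀ {a b : ℝ}, 0 < a → 0 < b → HasDerivAt (fun t => a ^ t * b ^ (1 - t))
      (a ^ t * b ^ (1 - t) * (Real.log a - Real.log b)) t := by
    intro a b ha hb
    have h1 := (hasDerivAt_id t).const_rpow ha
    have h2 := ((hasDerivAt_const t (1 : ℝ)).sub (hasDerivAt_id t)).const_rpow hb
    refine (h1.mul h2).congr_deriv ?_
    simp only [id_eq, Pi.sub_apply]
    ring
  exact ((h ha hb).add (h hc hd)).log (add_pos
    (mul_pos (Real.rpow_pos_of_pos ha _) (Real.rpow_pos_of_pos hb _))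
    (mul_pos (Real.rpow_pos_of_pos hc _) (Real.rpow_pos_of_pos hd _))).ne'

theorem abs_log_sub_log_le (hη : 0 < η) {a b : ℝ} (ha : a ∈ Set.Icc η (1 - η))
    (hb : b ∈ Set.Icc η (1 - η)) : |Real.log a - Real.log b| ≤ |Real.log η| := by
  have h : ∀ a ∈ Set.Icc η (1 - η), Real.log η ≤ Real.log a ∧ Real.log a ≤ 0 := fun a ha =>
    ⟨Real.log_le_log hη ha.1, Real.log_nonpos (hη.le.trans ha.1) (by linarith [ha.2])⟩
  have h1 := h a ha
  have h2 := h b hb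
  rw [abs_of_nonpos (h1.1.trans h1.2), abs_le]
  constructor <;> linarith

/-- The `t`-derivative of the integrand is a weighted mean of `log q - log r` and `log (1 - q) - log
(1 - r)`. Hence it is bounded by `|log η|` uniformly in `t`, and differentiation under the integral
is allowed. -/
theorem differentiable_psi (hη : η ∈ Set.Ioo (0 : ℝ) (1 / 2))
    (hqm : AEMeasurable q (momentumMeasure ν)) (hrm : AEMeasurable r (momentumMeasure ν))
    (hq : ∀ᵐ x ∂momentumMeasure ν, q x ∈ Set.Icc η (1 - η))
    (hr : ∀ᵐ x ∂momentumMeasure ν, r x ∈ Set.Icc η (1 - η))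
    (hint : ∀ t : ℝ, Integrable (fun x =>
      Real.log (q x ^ t * r x ^ (1 - t) + (1 - q x) ^ t * (1 - r x) ^ (1 - t))) (momentumMeasure ν)) :
    Differentiable ℝ (psi q r) := by
  have hpsi : psi q r = fun t => ∫ x, Real.log (q x ^ t * r x ^ (1 - t) +
      (1 - q x) ^ t * (1 - r x) ^ (1 - t)) ∂momentumMeasure ν := by
    funext t
    rw [psi, integral_momentumMeasure]
  intro t
  rw [hpsi]
  have hm : ∀ t : ℝ, AEMeasurable (fun x => q x ^ t * r x ^ (1 - t)) (momentumMeasure ν) := fun t =>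
    (hqm.pow_const t).mul (hrm.pow_const _)
  have hm' : ∀ t : ℝ, AEMeasurable (fun x => (1 - q x) ^ t * (1 - r x) ^ (1 - t)) (momentumMeasure ν) :=
    fun t => ((hqm.const_sub 1).pow_const t).mul ((hrm.const_sub 1).pow_const _)
  refine (hasDerivAt_integral_of_dominated_loc_of_deriv_le (s := Set.univ) Filter.univ_mem
    (F' := fun t x => (q x ^ t * r x ^ (1 - t) * (Real.log (q x) - Real.log (r x)) +
        (1 - q x) ^ t * (1 - r x) ^ (1 - t) * (Real.log (1 - q x) - Real.log (1 - r x))) /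
        (q x ^ t * r x ^ (1 - t) + (1 - q x) ^ t * (1 - r x) ^ (1 - t)))
    (bound := fun _ => |Real.log η|)
    (Eventually.of_forall fun t => (hint t).aestronglyMeasurable) (hint t) ?_ ?_
    (integrable_const _) ?_).2.differentiableAt
  · exact ((((hm t).mul (hqm.log.sub hrm.log)).add
      ((hm' t).mul ((hqm.const_sub 1).log.sub (hrm.const_sub 1).log))).div
      ((hm t).add (hm' t))).aestronglyMeasurable
  · filter_upwards [hq, hr] with x h1 h2 t _
    have h3 : 1 - q x ∈ Set.Icc η (1 - η) := ⟨by linarith [h1.2], by linarith [h1.1]⟩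
    have h4 : 1 - r x ∈ Set.Icc η (1 - η) := ⟨by linarith [h2.2], by linarith [h2.1]⟩
    have p1 : 0 < q x ^ t * r x ^ (1 - t) := mul_pos
      (Real.rpow_pos_of_pos (hη.1.trans_le h1.1) _) (Real.rpow_pos_of_pos (hη.1.trans_le h2.1) _)
    have p2 : 0 < (1 - q x) ^ t * (1 - r x) ^ (1 - t) := mul_pos
      (Real.rpow_pos_of_pos (hη.1.trans_le h3.1) _) (Real.rpow_pos_of_pos (hη.1.trans_le h4.1) _)
    rw [Real.norm_eq_abs, abs_div, abs_of_pos (add_pos p1 p2), div_le_iff₀ (add_pos p1 p2)]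
    refine (abs_add_le _ _).trans ?_
    rw [abs_mul (q x ^ t * _), abs_mul ((1 - q x) ^ t * _), abs_of_pos p1, abs_of_pos p2, mul_add, mul_comm |Real.log η|,
      mul_comm |Real.log η|]
    exact add_le_add (mul_le_mul_of_nonneg_left (abs_log_sub_log_le hη.1 h1 h2) p1.le)
      (mul_le_mul_of_nonneg_left (abs_log_sub_log_le hη.1 h3 h4) p2.le)
  · filter_upwards [hq, hr] with x h1 h2 t _
    exact hasDerivAt_log_add_rpow (hη.1.trans_le h1.1) (hη.1.trans_le h2.1)
      (by linarith [h1.2, hη.1]) (by linarith [h2.2, hη.1]) t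

end OverlapLimit

-- The theorem for quasi-free lattice states.

attribute [local instance] decidableEqSites in
theorem overlapAsymptotics_of_isQuasiFree {ν : ℕ} (hν : 0 < ν) {q r : (Fin ν → ℝ) → ℝ}
    (hq : AEMeasurable q (volume.restrict (brillouin ν)))
    (hr : AEMeasurable r (volume.restrict (brillouin ν)))
    {η : ℝ} (hη : η ∈ Set.Ioo (0 : ℝ) (1 / 2))
    (hqη : ∀ x ∈ brillouin ν, q x ∈ Set.Icc η (1 - η))
    (hrη : ∀ x ∈ brillouin ν, r x ∈ Set.Icc η (1 - η))
    {Q R : OneParticle (Site ν) →L[ℂ] OneParticle (Site ν)}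
    (hQ : IsMultiplication Q q) (hR : IsMultiplication R r)
    {ωQ ωR : AlgState (carAlgebra (Set.univ : Set (OneParticle (Site ν))))}
    (hωQ : IsQuasiFree ωQ Q) (hωR : IsQuasiFree ωR R)
    {ρ σ : ∀ n : ℕ, Matrix (LocalIndex ν n) (LocalIndex ν n) ℂ}
    (hρ : ∀ n, IsLocalDensity ωQ n (ρ n)) (hσ : ∀ n, IsLocalDensity ωR n (σ n)) :
    OverlapAsymptotics ν ρ σ (psi q r) := by
  have hqm : AEMeasurable q (momentumMeasure ν) := hq.smul_measure _
  have hrm : AEMeasurable r (momentumMeasure ν) := hr.smul_measure _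
  have hqa := ae_momentumMeasure hqη
  have hra := ae_momentumMeasure hrη
  choose hQh hl using compression_spectrum hη hQ hqa
  choose hRh hm using compression_spectrum hη hR hra
  have eρ := fun n => (hρ n).eq_quasiFreeDensity hωQ (hQh n)
  have eσ := fun n => (hσ n).eq_quasiFreeDensity hωR (hRh n)
  have pρ := fun n => posDef_quasiFreeDensity (hQh n) (hl n)
  have pσ := fun n => posDef_quasiFreeDensity (hRh n) (hm n)
  have hlim := tendsto_logOverlap hη hQ hR hqm hrm hqa hra hQh hRh
  exact
    { dim_pos := hν
      posDef_left := fun n => by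
        rw [(eρ n).1]
        exact (pρ n).submatrix (Equiv.injective _)
      posDef_right := fun n => by
        rw [(eσ n).1]
        exact (pσ n).submatrix (Equiv.injective _)
      trace_left := fun n => (eρ n).2
      trace_right := fun n => (eσ n).2
      tendsto_overlap := fun t => (hlim t).2.congr fun n => by
        rw [(eρ n).1, (eσ n).1, logOverlap_submatrix (pρ n).1 (pσ n).1]
      differentiable := differentiable_psi hη hqm hrm hqa hra fun t => (hlim t).1 }

theorem theorem4p2 (ν : ℕ) (hν : 0 < ν)
    (q r : (Fin ν → ℝ) → ℝ)
    (hq : AEMeasurable q (volume.restrict (brillouin ν)))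
    (hr : AEMeasurable r (volume.restrict (brillouin ν)))
    (η : ℝ) (hη : η ∈ Set.Ioo (0 : ℝ) (1 / 2))
    (hqη : ∀ x ∈ brillouin ν, q x ∈ Set.Icc η (1 - η))
    (hrη : ∀ x ∈ brillouin ν, r x ∈ Set.Icc η (1 - η))
    (Q R : OneParticle (Site ν) →L[ℂ] OneParticle (Site ν))
    (hQ : IsMultiplication Q q) (hR : IsMultiplication R r)
    (ωQ ωR : AlgState (carAlgebra (Set.univ : Set (OneParticle (Site ν)))))
    (hωQ : IsQuasiFree ωQ Q) (hωR : IsQuasiFree ωR R)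
    (ρ σ : ∀ n : ℕ, Matrix (LocalIndex ν n) (LocalIndex ν n) ℂ)
    (hρ : ∀ n, IsLocalDensity ωQ n (ρ n)) (hσ : ∀ n, IsLocalDensity ωR n (σ n)) :
    ∃ (C S : ℝ) (H : ℝ → ℝ),
      (HasMeanChernoff ν ρ σ C ∧
        (∀ s : ℝ, 0 ≤ s → HasMeanHoeffding ν s ρ σ (H s)) ∧
        HasMeanRelEntropy ν ρ σ S) ∧
      IsLeast (psi q r '' Set.Icc 0 1) (-C) ∧
      (∀ s : ℝ, 0 < s →
        IsGreatest ((fun t => (-t * s - psi q r t) / (1 - t)) '' Set.Ico 0 1) (H s)) ∧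
      (S = H 0 ∧ HasDerivWithinAt (psi q r) S (Set.Iio 1) 1 ∧
        IsLUB ((fun t => -psi q r t / (1 - t)) '' Set.Ico 0 1) S) ∧
      (chernoffLim ν ρ σ = (C : EReal) ∧ chernoffLiminf ν ρ σ = (C : EReal) ∧
        chernoffLimsup ν ρ σ = (C : EReal)) ∧
      (∀ s : ℝ, 0 ≤ s → hoeffdingLim ν s ρ σ = (H s : EReal) ∧
        hoeffdingLiminf ν s ρ σ = (H s : EReal) ∧ hoeffdingLimsup ν s ρ σ = (H s : EReal)) ∧
      (steinLim ν ρ σ = (S : EReal) ∧ steinLiminf ν ρ σ = (S : EReal) ∧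
        steinLimsup ν ρ σ = (S : EReal)) := by
  exact (overlapAsymptotics_of_isQuasiFree hν hq hr hη hqη hrη hQ hR hωQ hωR hρ hσ).error_exponents
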